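/- Let $D\subset\mathbb C$ be a domain (open and connected) which has a Green's function. This means that for every $x\in D$ there is a function $G_D(x,\cdot)\ge 0$ which is harmonic on $D\setminus\{x\}$, tends to $0$ at every point of the boundary $\partial D\subset\mathbb C$, satisfies $G_D(x,y)\sim\log\frac1{|x-y|}$ as $y\to x$, and is bounded outside every neighbourhood of $x$ (the last property is automatic if $D$ is bounded; it is the condition at infinity if $D$ is unbounded). These properties determine $G_D$; for example every simply connected domain $D\subsetneq\mathbb C$ has a Green's function. Let $\tilde G^x(y)=G_D(x,y)-\log\frac1{|x-y|}$ and, for $\epsilon>0$, let $$G^x_\epsilon(y)=\log\frac1{\epsilon\vee|x-y|}+\tilde G^x(y).$$ Let $\mathcal H^1=\mathcal H^1_0(D)$ be the closure of the smooth functions with compact support in $D$ for the norm associated with $\langle f,g\rangle_\nabla=\frac1{2\pi}\int_D\nabla f\cdot\nabla g$. A Gaussian free field with zero boundary conditions in $D$ is a random series $h=\sum_{n\ge1}a_n\mathbf e_n$, where $(\mathbf e_n)$ is an orthonormal basis of $\mathcal H^1$ and the $a_n$ are independent $\mathcal N(0,1)$ random variables. For $f=\sum_n\alpha_n\mathbf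 e_n\in\mathcal H^1$ put $\langle h,f\rangle_\nabla=\sum_n a_n\alpha_n$ (an almost surely convergent series), and define the circle averages of $h$ by $h_\epsilon(x)=\langle h,G^x_\epsilon\rangle_\nabla$. Let $h$ be a Gaussian free field with zero boundary conditions in $D$, let $z\in D$, and let $t_0=\inf\{t\ge0:\ B_{e^{-t}}(z)\subset D\}$. Then the process $$\mathcal B_t=h_{e^{-(t_0+t)}}(z)-h_{e^{-t_0}}(z),\qquad t\ge0,$$ is a standard Brownian motion, that is, it is a centred Gaussian process with covariance $\mathrm{Cov}(\mathcal B_s,\mathcal B_t)=s\wedge t$ for all $s,t\ge0$, and it has a modification which is a Brownian motion with almost surely continuous paths. -/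

import Mathlib

noncomputable section

namespace GFF

open MeasureTheory ProbabilityTheory Filter Topology Asymptotics
open scoped NNReal Gradient

/-! ### The space `H¹ = H¹₀(D)` -/

/-- Smooth real functions with compact support in `D`. -/
def IsTest (D : Set ℂ) (φ : ℂ → ℝ) : Prop :=
  ContDiff ℝ (⊤ : ℕ∞) φ ∧ HasCompactSupport φ ∧ tsupport φ ⊆ D

/-- The measure `(2π)⁻¹ dx` on `D`. The inner product of two gradient fields in `L²` of this
measure is the Dirichlet inner product `⟨f, g⟩_∇ = (2π)⁻¹ ∫_D ∇f · ∇g`. -/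
def dirichletMeasure (D : Set ℂ) : Measure ℂ :=
  ENNReal.ofReal (1 / (2 * Real.pi)) • volume.restrict D

theorem IsTest.differentiableAt {D : Set ℂ} {φ : ℂ → ℝ} (h : IsTest D φ) (y : ℂ) :
    DifferentiableAt ℝ φ y :=
  (h.1.differentiable (by simp)) y

theorem isTest_zero (D : Set ℂ) : IsTest D (fun _ => 0) := by
  refine ⟨contDiff_const, HasCompactSupport.zero, ?_⟩
  have : tsupport (fun _ : ℂ => (0 : ℝ)) = ∅ := by
    rw [tsupport_eq_empty_iff]; rfl
  rw [this]
  exact Set.empty_subset _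

theorem IsTest.add {D : Set ℂ} {φ ψ : ℂ → ℝ} (hφ : IsTest D φ) (hψ : IsTest D ψ) :
    IsTest D (fun y => φ y + ψ y) :=
  ⟨hφ.1.add hψ.1, hφ.2.1.add hψ.2.1,
    (tsupport_add φ ψ).trans (Set.union_subset hφ.2.2 hψ.2.2)⟩

theorem IsTest.const_mul {D : Set ℂ} {φ : ℂ → ℝ} (hφ : IsTest D φ) (c : ℝ) :
    IsTest D (fun y => c * φ y) :=
  ⟨contDiff_const.mul hφ.1, hφ.2.1.mul_left, (tsupport_mul_subset_right).trans hφ.2.2⟩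

/-- The space of gradients of test functions on `D`, inside `L²(D, (2π)⁻¹ dx)`: an isometric copy
of the space of test functions with the norm `‖·‖_∇`. -/
def testGradients (D : Set ℂ) : Submodule ℝ (Lp ℂ 2 (dirichletMeasure D)) where
  carrier := {u | ∃ φ, IsTest D φ ∧ (u : ℂ → ℂ) =ᵐ[dirichletMeasure D] ∇ φ}
  zero_mem' := by
    refine ⟨_, isTest_zero D, ?_⟩
    filter_upwards [Lp.coeFn_zero ℂ 2 (dirichletMeasure D)] with y hy
    rw [hy]
    simp [gradient]
  add_mem' := by
    rintro u v ⟨φ, hφ, hu⟩ ⟨ψ, hψ, hv⟩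
    refine ⟨_, hφ.add hψ, ?_⟩
    filter_upwards [Lp.coeFn_add u v, hu, hv] with y hy hu hv
    rw [hy, Pi.add_apply, hu, hv, gradient, gradient, gradient,
      fderiv_fun_add (hφ.differentiableAt y) (hψ.differentiableAt y), map_add]
  smul_mem' := by
    rintro c u ⟨φ, hφ, hu⟩
    refine ⟨_, hφ.const_mul c, ?_⟩
    filter_upwards [Lp.coeFn_smul c u, hu] with y hy hu
    rw [hy, Pi.smul_apply, hu, gradient, gradient,
      fderiv_const_mul (hφ.differentiableAt y)]
    simp

/-- The Hilbert space `H¹ = H¹₀(D)`, the closure of the test functions for `‖·‖_∇`; its elements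
are given by their gradient fields. -/
abbrev H1 (D : Set ℂ) : Type :=
  (testGradients D).topologicalClosure

/-- The function `f` on `D` is the element `u` of `H¹₀(D)`: there are test functions which converge
to `u` in `‖·‖_∇` and to `f` in `L¹` on the compact subsets of `D`. -/
def Represents (D : Set ℂ) (f : ℂ → ℝ) (u : H1 D) : Prop :=
  ∃ φ : ℕ → ℂ → ℝ, (∀ n, IsTest D (φ n)) ∧
    Tendsto (fun n => eLpNorm
      (fun y => ∇ (φ n) y - (u : Lp ℂ 2 (dirichletMeasure D)) y) 2 (dirichletMeasure D))
      atTop (𝓝 0) ∧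
    ∀ K ⊆ D, IsCompact K → Tendsto (fun n => ∫⁻ y in K, ‖φ n y - f y‖ₑ) atTop (𝓝 0)

open Classical in
/-- The element of `H¹₀(D)` given by the function `f` (it is unique, the field `u` being the weak
gradient of `f` on `D`), with value `0` if `f` does not belong to `H¹₀(D)`. -/
def toH1 (D : Set ℂ) (f : ℂ → ℝ) : H1 D :=
  if hf : ∃ u : H1 D, Represents D f u then hf.choose else 0

/-! ### The Gaussian free field -/

/-- A Gaussian free field `h = ∑ aₙ eₙ` in `D` with Dirichlet boundary conditions: `(eₙ)` is an
orthonormal basis of `H¹₀(D)` and the `aₙ` are independent `N(0, 1)` variables. -/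
structure GaussianFreeField {Ω : Type*} [MeasurableSpace Ω] (P : Measure Ω) (D : Set ℂ) where
  /-- the orthonormal basis `(eₙ)` -/
  basis : HilbertBasis ℕ ℝ (H1 D)
  /-- the random coefficients `(aₙ)` -/
  coeff : ℕ → Ω → ℝ
  hasLaw_coeff : ∀ n, HasLaw (coeff n) (gaussianReal 0 1) P
  indep_coeff : iIndepFun coeff P

/-- The random variable `⟨h, f⟩_∇ = ∑ aₙ αₙ`, where `f = ∑ αₙ eₙ ∈ H¹₀(D)`. The series converges
almost surely, but in general not absolutely. -/
def GaussianFreeField.pairing {Ω : Type*} [MeasurableSpace Ω] {P : Measure Ω} {D : Set ℂ}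
    (h : GaussianFreeField P D) (f : H1 D) (ω : Ω) : ℝ :=
  limUnder atTop fun N : ℕ =>
    ∑ n ∈ Finset.range N, h.coeff n ω * inner ℝ (h.basis n) f

/-! ### The Green's function -/

/-- `g` is the Green's function `y ↦ G_D(x, y)` of `D` with pole `x`. The boundary is the one in
the finite plane; the clause `bounded` is automatic if `D` is bounded, and is the usual condition
at infinity if `D` is unbounded. -/
structure IsGreenFunction (D : Set ℂ) (x : ℂ) (g : ℂ → ℝ) : Prop where
  nonneg : ∀ y ∈ D \ {x}, 0 ≤ g y
  harmonic : InnerProductSpace.HarmonicOnNhd g (D \ {x})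
  boundary : ∀ ζ ∈ frontier D, Tendsto g (𝓝[D] ζ) (𝓝 0)
  pole : g ~[𝓝[≠] x] fun y => Real.log (1 / ‖x - y‖)
  bounded : ∀ r > 0, ∃ M, ∀ y ∈ D, r ≤ ‖x - y‖ → g y ≤ M

/-- `D` has a Green's function. -/
def HasGreenFunction (D : Set ℂ) : Prop :=
  ∀ x ∈ D, ∃ g, IsGreenFunction D x g

open Classical in
/-- The Green's function `G_D(x, y)`. The clauses of `IsGreenFunction` determine it for `y` in
`D \ {x}`, the only place where it matters. -/
def greenFunction (D : Set ℂ) (x : ℂ) : ℂ → ℝ :=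
  if hx : ∃ g, IsGreenFunction D x g then hx.choose else 0

/-- The harmonic correction `G̃ˣ(y) = G_D(x, y) - log (1 / |x - y|)`; its value at the single point
`y = x` plays no role. -/
def greenCorrection (D : Set ℂ) (x y : ℂ) : ℝ :=
  greenFunction D x y - Real.log (1 / ‖x - y‖)

/-- The regularized Green's function `G_εˣ(y) = log (1 / (ε ∨ |x - y|)) + G̃ˣ(y)`. -/
def regGreen (D : Set ℂ) (ε : ℝ) (x y : ℂ) : ℝ :=
  Real.log (1 / max ε ‖x - y‖) + greenCorrection D x y

/-! ### Circle averages -/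

/-- The circle average `h_ε(x) = ⟨h, G_εˣ⟩_∇`. -/
def GaussianFreeField.circleAvg {Ω : Type*} [MeasurableSpace Ω] {P : Measure Ω} {D : Set ℂ}
    (h : GaussianFreeField P D) (ε : ℝ) (x : ℂ) : Ω → ℝ :=
  h.pairing (toH1 D (regGreen D ε x))

/-- `t₀ = inf {t ≥ 0 : B_{e^{-t}}(z) ⊆ D}`. -/
def startTime (D : Set ℂ) (z : ℂ) : ℝ :=
  sInf {t : ℝ | 0 ≤ t ∧ Metric.ball z (Real.exp (-t)) ⊆ D}

/-- The process `B_t = h_{e^{-(t₀ + t)}}(z) - h_{e^{-t₀}}(z)`, `t ≥ 0`. -/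
def GaussianFreeField.circleIncrement {Ω : Type*} [MeasurableSpace Ω] {P : Measure Ω} {D : Set ℂ}
    (h : GaussianFreeField P D) (z : ℂ) (t : ℝ≥0) (ω : Ω) : ℝ :=
  h.circleAvg (Real.exp (-(startTime D z + t))) z ω - h.circleAvg (Real.exp (-startTime D z)) z ω

end GFF

end

/-! Pairing the field with elements of `H1 D` is a linear isometry onto centred Gaussian variables:
`h.pairing f` has variance `‖f‖ ^ 2`, and by polarization `covariance_pairing` gives `inner ℝ f g`.
Every finite linear combination of pairings is almost surely again a pairing, so any family of them
is a Gaussian process. The law of the process is therefore a matter of Hilbert space geometry: the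
inner products of the increments of the regularized Green's function.

In such an increment the harmonic correction, which does not depend on the radius, cancels. What is
left has gradient `-(y - z) / |y - z| ^ 2` on the annulus between the two radii and zero elsewhere.
With `r = e ^ (-t₀)`, the inner product of the increments to radii `a, b ≤ r` is `(2π)⁻¹` times the
integral of `|y - z| ^ (-2)` over the annulus `max a b ≤ |y - z| < r`, that is `log (r / max a b)`,
which equals `min s t` for exponential radii.

The analytic work is to prove that the regularized Green's function really lies in `H¹₀(D)` with the
expected gradient (`IsGreenFunction.hasH1Gradient`, `HasH1Gradient.toH1_ae_eq`), although `D` may be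
unbounded and nothing is assumed about its boundary. The correction extends across the pole because
isolated singularities of size `o(log)` are removable. The Green's function has finite energy off
the pole, by a Caccioppoli estimate with constants independent of all truncations. A bounded `C¹`
function of finite energy vanishing at the finite boundary is a limit of compactly supported ones: a
soft threshold cuts it off near the boundary, and a logarithmic cutoff, whose energy tends to zero
in the plane, cuts it off near infinity. Uniqueness of weak gradients identifies the element chosen
by `toH1`.

Path continuity is the Kolmogorov-Chentsov argument on dyadic times, run with fourth moments. -/

noncomputable section

namespace GFF

open MeasureTheory ProbabilityTheory Filter Topology Asymptotics
open scoped NNReal Gradient ENNReal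

/-! ### Convergence of series of independent variables -/

section Series

variable {Ω : Type*} [mΩ : MeasurableSpace Ω] {P : Measure Ω}

/-- From `|S| ≤ 1 + S ^ 2`. It turns summable variances into the uniform `L¹` bound required by
martingale convergence. -/
theorem eLpNorm_one_le_of_variance_le [IsProbabilityMeasure P] {S : Ω → ℝ} {v : ℝ}
    (hS : MemLp S 2 P) (hmean : ∫ ω, S ω ∂P = 0) (hv : variance S P ≤ v) :
    eLpNorm S 1 P ≤ ENNReal.ofReal (1 + v) := by
  have hint : Integrable S P := hS.integrable (by norm_num)
  rw [eLpNorm_one_eq_lintegral_enorm, ← ofReal_integral_norm_eq_lintegral_enorm hint]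
  refine ENNReal.ofReal_le_ofReal ?_
  have hsq : Integrable (fun ω => S ω ^ 2) P := hS.integrable_sq
  have hvar : ∫ ω, S ω ^ 2 ∂P ≤ v := by
    rwa [variance_of_integral_eq_zero hS.aestronglyMeasurable.aemeasurable hmean] at hv
  calc ∫ ω, ‖S ω‖ ∂P ≤ ∫ ω, (1 + S ω ^ 2) ∂P := by
        refine integral_mono hint.norm ((integrable_const _).add hsq) fun ω => ?_
        simp only [Real.norm_eq_abs]
        nlinarith [sq_abs (S ω), sq_nonneg (|S ω| - 1), abs_nonneg (S ω)]
    _ = 1 + ∫ ω, S ω ^ 2 ∂P := by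
        rw [integral_add (integrable_const _) hsq]; simp
    _ ≤ 1 + v := by linarith

/-- A series of independent centred variables with summable variances converges almost surely. -/
theorem ae_exists_tendsto_sum_of_iIndepFun [IsProbabilityMeasure P] {X : ℕ → Ω → ℝ}
    (hX : ∀ n, MemLp (X n) 2 P) (hmean : ∀ n, ∫ ω, X n ω ∂P = 0) (hindep : iIndepFun X P)
    (hsum : Summable fun n => variance (X n) P) :
    ∀ᵐ ω ∂P, ∃ l, Tendsto (fun N : ℕ => ∑ n ∈ Finset.range N, X n ω) atTop (𝓝 l) := by
  -- The natural filtration needs genuinely measurable variables, so each one is replaced by a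
  -- measurable version.
  wlog hm : ∀ n, StronglyMeasurable (X n) generalizing X
  · have hae : ∀ n, X n =ᵐ[P] (hX n).1.mk (X n) := fun n => (hX n).1.ae_eq_mk
    have := this (X := fun n => (hX n).1.mk (X n)) (fun n => (hX n).ae_eq (hae n))
      (fun n => by rw [← hmean n]; exact integral_congr_ae (hae n).symm)
      (hindep.congr hae) (by simpa only [← variance_congr (hae _)] using hsum)
      (fun n => (hX n).1.stronglyMeasurable_mk)
    filter_upwards [this, ae_all_iff.2 hae] with ω h1 h2
    simpa only [h2] using h1
  set ℱ := Filtration.natural X hm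
  -- The sum runs up to and including `N`, so that `S N` is measurable for `ℱ N`; the shift by one
  -- is undone at the end.
  set S : ℕ → Ω → ℝ := fun N => ∑ n ∈ Finset.range (N + 1), X n with hS
  have hSL : ∀ N, MemLp (S N) 2 P := fun N => memLp_finsetSum' _ fun n _ => hX n
  have hSint : ∀ N, Integrable (S N) P := fun N => (hSL N).integrable (by norm_num)
  have hadp : StronglyAdapted ℱ S := by
    intro N
    refine Finset.stronglyMeasurable_sum _ fun n hn => ?_
    exact (Filtration.stronglyAdapted_natural hm n).mono
      (ℱ.mono (Nat.lt_succ_iff.1 (Finset.mem_range.1 hn)))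
  have hmart : Martingale S ℱ P := by
    refine martingale_of_condExp_sub_eq_zero_nat hadp hSint fun N => ?_
    have h1 : S (N + 1) - S N = X (N + 1) := by
      simp [hS, Finset.sum_range_succ X (N + 1)]
    rw [h1]
    refine (hindep.condExp_natural_ae_eq_of_lt hm (Nat.lt_succ_self N)).trans ?_
    rw [hmean]; rfl
  have hSmean : ∀ N, ∫ ω, S N ω ∂P = 0 := by
    intro N
    simp only [hS, Finset.sum_apply]
    rw [integral_finsetSum _ fun n _ => (hX n).integrable (by norm_num)]
    simp [hmean]
  have hbdd : ∀ N, eLpNorm (S N) 1 P ≤ (1 + ∑' n, variance (X n) P).toNNReal := by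
    intro N
    refine eLpNorm_one_le_of_variance_le (hSL N) (hSmean N) ?_
    rw [hS, IndepFun.variance_sum (fun n _ => hX n)
      (fun i _ j _ hij => hindep.indepFun hij)]
    exact hsum.sum_le_tsum _ fun n _ => variance_nonneg _ _
  filter_upwards [hmart.submartingale.ae_tendsto_limitProcess hbdd] with ω hω
  refine ⟨_, (tendsto_add_atTop_iff_nat 1).1 (hω.congr fun N => ?_)⟩
  simp [hS]

/-- An almost sure limit of centred Gaussian variables whose variances converge is Gaussian. -/
theorem hasLaw_gaussianReal_of_tendsto [IsProbabilityMeasure P] {S : ℕ → Ω → ℝ} {Y : Ω → ℝ}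
    {v : ℕ → ℝ≥0} {w : ℝ≥0} (hS : ∀ n, HasLaw (S n) (gaussianReal 0 (v n)) P)
    (hlim : ∀ᵐ ω ∂P, Tendsto (fun n => S n ω) atTop (𝓝 (Y ω))) (hv : Tendsto v atTop (𝓝 w)) :
    HasLaw Y (gaussianReal 0 w) P := by
  have hY : AEMeasurable Y P :=
    aemeasurable_of_tendsto_metrizable_ae atTop (fun n => (hS n).aemeasurable) hlim
  refine ⟨hY, ?_⟩
  have : IsProbabilityMeasure (P.map Y) := Measure.isProbabilityMeasure_map hY
  -- Characteristic functions converge to that of `Y` by dominated convergence, and to the Gaussian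
  -- one because the variances converge.
  refine Measure.ext_of_charFun ?_
  ext t
  have h1 : ∀ n, charFun (P.map (S n)) t = Complex.exp (-((v n : ℝ) : ℂ) * t ^ 2 / 2) := by
    intro n
    rw [(hS n).map_eq, charFun_gaussianReal]
    simp [neg_div]
  have h2 : Tendsto (fun n => charFun (P.map (S n)) t) atTop (𝓝 (charFun (P.map Y) t)) := by
    simp only [charFun_apply_real]
    have key : ∀ Z : Ω → ℝ, AEMeasurable Z P →
        ∫ x, Complex.exp (t * x * Complex.I) ∂(P.map Z)
          = ∫ ω, Complex.exp (t * Z ω * Complex.I) ∂P := by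
      intro Z hZ
      rw [integral_map hZ (by fun_prop)]
    rw [key Y hY]
    simp_rw [fun n => key (S n) (hS n).aemeasurable]
    refine tendsto_integral_of_dominated_convergence (fun _ => 1) ?_ (integrable_const _) ?_ ?_
    · intro n
      have := (hS n).aemeasurable
      have h : Measurable fun x : ℝ => Complex.exp (t * x * Complex.I) := by fun_prop
      exact (h.comp_aemeasurable this).aestronglyMeasurable
    · intro n
      refine .of_forall fun ω => ?_
      rw [← Complex.ofReal_mul, Complex.norm_exp_ofReal_mul_I]
    · filter_upwards [hlim] with ω hω
      have hc : Continuous fun x : ℝ => Complex.exp (t * x * Complex.I) := by fun_prop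
      exact (hc.tendsto _).comp hω
  have h3 : Tendsto (fun n => charFun (P.map (S n)) t) atTop
      (𝓝 (Complex.exp (-((w : ℝ) : ℂ) * t ^ 2 / 2))) := by
    simp_rw [h1]
    have hc : Continuous fun x : ℝ≥0 => Complex.exp (-((x : ℝ) : ℂ) * t ^ 2 / 2) := by fun_prop
    exact (hc.tendsto _).comp hv
  rw [tendsto_nhds_unique h2 h3, charFun_gaussianReal]
  simp [neg_div]

end Series

/-! ### The pairing of the field with elements of `H¹₀(D)` -/

section Pairing

variable {Ω : Type*} [mΩ : MeasurableSpace Ω] {P : Measure Ω} {D : Set ℂ}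

namespace GaussianFreeField

variable (h : GaussianFreeField P D)

theorem hasLaw_coeff_mul (n : ℕ) (c : ℝ) :
    HasLaw (fun ω => h.coeff n ω * c) (gaussianReal 0 (c ^ 2).toNNReal) P := by
  have := gaussianReal_mul_const (h.hasLaw_coeff n) c
  rw [Real.toNNReal_of_nonneg (sq_nonneg c)]
  simpa using this

theorem iIndepFun_coeff_mul (c : ℕ → ℝ) : iIndepFun (fun n ω => h.coeff n ω * c n) P :=
  h.indep_coeff.comp (fun n x => x * c n) fun _ => measurable_id.mul_const _

theorem memLp_coeff_mul (n : ℕ) (c : ℝ) : MemLp (fun ω => h.coeff n ω * c) 2 P :=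
  (h.hasLaw_coeff_mul n c).hasGaussianLaw.memLp_two

theorem integral_coeff_mul (n : ℕ) (c : ℝ) : ∫ ω, h.coeff n ω * c ∂P = 0 := by
  rw [(h.hasLaw_coeff_mul n c).integral_eq, integral_id_gaussianReal]

theorem variance_coeff_mul (n : ℕ) (c : ℝ) : variance (fun ω => h.coeff n ω * c) P = c ^ 2 := by
  rw [(h.hasLaw_coeff_mul n c).variance_eq, variance_id_gaussianReal,
    Real.coe_toNNReal _ (sq_nonneg _)]

theorem hasSum_sq_inner_basis (f : H1 D) :
    HasSum (fun n => (inner ℝ (h.basis n) f : ℝ) ^ 2) (‖f‖ ^ 2) := by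
  have := h.basis.hasSum_inner_mul_inner f f
  rw [real_inner_self_eq_norm_sq] at this
  refine this.congr_fun fun n => ?_
  rw [real_inner_comm, sq]

variable [IsProbabilityMeasure P]

theorem ae_tendsto_pairing (f : H1 D) :
    ∀ᵐ ω ∂P, Tendsto (fun N : ℕ => ∑ n ∈ Finset.range N, h.coeff n ω * inner ℝ (h.basis n) f)
      atTop (𝓝 (h.pairing f ω)) := by
  have := ae_exists_tendsto_sum_of_iIndepFun
    (X := fun n ω => h.coeff n ω * inner ℝ (h.basis n) f)
    (fun n => h.memLp_coeff_mul n _) (fun n => h.integral_coeff_mul n _) (h.iIndepFun_coeff_mul _)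
    (by simpa only [variance_coeff_mul] using (h.hasSum_sq_inner_basis f).summable)
  filter_upwards [this] with ω hω
  exact tendsto_nhds_limUnder hω

theorem hasLaw_pairing (f : H1 D) :
    HasLaw (h.pairing f) (gaussianReal 0 (‖f‖ ^ 2).toNNReal) P := by
  set α : ℕ → ℝ := fun n => inner ℝ (h.basis n) f
  refine hasLaw_gaussianReal_of_tendsto
    (S := fun N ω => ∑ n ∈ Finset.range N, h.coeff n ω * α n)
    (v := fun N => (∑ n ∈ Finset.range N, α n ^ 2).toNNReal)
    (fun N => ?_) (h.ae_tendsto_pairing f) ?_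
  · have hg : HasGaussianLaw (fun ω => ∑ n ∈ Finset.range N, h.coeff n ω * α n) P := by
      have hind : iIndepFun (fun (i : Finset.range N) ω => h.coeff i ω * α i) P :=
        (h.iIndepFun_coeff_mul α).precomp Subtype.val_injective
      have := iIndepFun.hasGaussianLaw_fun_sum
        (fun i : Finset.range N => (h.hasLaw_coeff_mul i (α i)).hasGaussianLaw) hind
      refine this.congr (.of_forall fun ω => ?_)
      exact Finset.sum_coe_sort (Finset.range N) fun n => h.coeff n ω * α n
    refine ⟨hg.aemeasurable, ?_⟩
    rw [hg.map_eq_gaussianReal]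
    congr 1
    · rw [integral_finsetSum _ fun n _ => (h.memLp_coeff_mul n _).integrable (by norm_num)]
      simp [integral_coeff_mul]
    · have h1 : (fun ω => ∑ n ∈ Finset.range N, h.coeff n ω * α n)
          = ∑ n ∈ Finset.range N, fun ω => h.coeff n ω * α n := by ext; simp
      rw [h1, IndepFun.variance_sum (fun n _ => h.memLp_coeff_mul n _)
        (fun i _ j _ hij => (h.iIndepFun_coeff_mul α).indepFun hij)]
      simp only [variance_coeff_mul]
  · exact (continuous_real_toNNReal.tendsto _).comp (h.hasSum_sq_inner_basis f).tendsto_sum_nat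

/-- Linearity holds only almost surely: a pairing is the limit of its series off a null set
depending on the element, and a default value where the series diverges. -/
theorem pairing_sum_smul {ι : Type*} (s : Finset ι) (c : ι → ℝ) (f : ι → H1 D) :
    h.pairing (∑ i ∈ s, c i • f i) =ᵐ[P] fun ω => ∑ i ∈ s, c i * h.pairing (f i) ω := by
  have hall : ∀ᵐ ω ∂P, ∀ i ∈ s, Tendsto
      (fun N : ℕ => ∑ n ∈ Finset.range N, h.coeff n ω * inner ℝ (h.basis n) (f i)) atTop
      (𝓝 (h.pairing (f i) ω)) :=
    (Finset.eventually_all s).2 fun i _ => h.ae_tendsto_pairing (f i)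
  filter_upwards [hall, h.ae_tendsto_pairing (∑ i ∈ s, c i • f i)] with ω h1 h2
  refine tendsto_nhds_unique h2 ?_
  refine (tendsto_finsetSum s fun i hi => (h1 i hi).const_mul (c i)).congr fun N => ?_
  simp only [inner_sum, Finset.mul_sum]
  rw [Finset.sum_comm]
  refine Finset.sum_congr rfl fun n _ => Finset.sum_congr rfl fun i _ => ?_
  have : (inner ℝ (h.basis n) (c i • f i) : ℝ) = c i * inner ℝ (h.basis n) (f i) := by
    rw [Submodule.coe_inner, Submodule.coe_smul, real_inner_smul_right, Submodule.coe_inner]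
  rw [this]; ring

theorem pairing_sub (f g : H1 D) :
    h.pairing (f - g) =ᵐ[P] fun ω => h.pairing f ω - h.pairing g ω := by
  filter_upwards [h.ae_tendsto_pairing f, h.ae_tendsto_pairing g, h.ae_tendsto_pairing (f - g)]
    with ω h1 h2 h3
  refine tendsto_nhds_unique h3 ((h1.sub h2).congr fun N => ?_)
  rw [← Finset.sum_sub_distrib]
  refine Finset.sum_congr rfl fun n _ => ?_
  rw [inner_sub_right]; ring

theorem integral_pairing (f : H1 D) : ∫ ω, h.pairing f ω ∂P = 0 := by
  rw [(h.hasLaw_pairing f).integral_eq, integral_id_gaussianReal]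

theorem variance_pairing (f : H1 D) : variance (h.pairing f) P = ‖f‖ ^ 2 := by
  rw [(h.hasLaw_pairing f).variance_eq, variance_id_gaussianReal, Real.coe_toNNReal _ (sq_nonneg _)]

theorem memLp_pairing (f : H1 D) : MemLp (h.pairing f) 2 P :=
  (h.hasLaw_pairing f).hasGaussianLaw.memLp_two

/-- Polarization: the variance of `h.pairing f - h.pairing g` is `‖f - g‖ ^ 2`. -/
theorem covariance_pairing (f g : H1 D) :
    covariance (h.pairing f) (h.pairing g) P = inner ℝ f g := by
  have h1 : variance (fun ω => h.pairing f ω - h.pairing g ω) P = ‖f - g‖ ^ 2 := by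
    rw [← h.variance_pairing, variance_congr (h.pairing_sub f g)]
  rw [variance_fun_sub (h.memLp_pairing f) (h.memLp_pairing g), variance_pairing,
    variance_pairing, norm_sub_sq_real] at h1
  linarith

theorem isGaussianProcess_pairing {T : Type*} (f : T → H1 D) :
    IsGaussianProcess (fun t => h.pairing (f t)) P where
  hasGaussianLaw I := by
    classical
    have hm : AEMeasurable (fun ω => I.restrict fun t => h.pairing (f t) ω) P :=
      aemeasurable_pi_lambda _ fun i => (h.hasLaw_pairing (f i)).aemeasurable
    refine ⟨⟨fun L => ?_⟩⟩
    -- A linear form of a finite marginal is a finite linear combination of pairings, hence almost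
    -- surely the pairing with one element of `H1 D`, which is Gaussian.
    have hL : ∀ x : I → ℝ, L x = ∑ i, L (Pi.single i 1) * x i := by
      intro x
      conv_lhs => rw [pi_eq_sum_univ' x]
      simp [map_sum, mul_comm]
    have hlaw : HasGaussianLaw (fun ω => L (I.restrict fun t => h.pairing (f t) ω)) P := by
      refine (h.hasLaw_pairing (∑ i : I, L (Pi.single i 1) • f i)).hasGaussianLaw.congr ?_
      filter_upwards [h.pairing_sum_smul Finset.univ (fun i : I => L (Pi.single i 1))
        fun i : I => f i] with ω hω
      rw [hω, hL]
      rfl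
    have hLm : Measurable L := by fun_prop
    rw [AEMeasurable.map_map_of_aemeasurable hLm.aemeasurable hm,
      integral_map hm (by fun_prop), variance_map hLm.aemeasurable hm]
    exact hlaw.map_eq_gaussianReal

end GaussianFreeField

end Pairing

/-! ### A continuous modification of a pre-Brownian motion -/

section Continuity

/-- The dyadic number of level `n` just below `t`. -/
def dyadicFloor (n : ℕ) (t : ℝ≥0) : ℝ≥0 := (⌊2 ^ n * t⌋₊ : ℝ≥0) / 2 ^ n

theorem dyadicFloor_le (n : ℕ) (t : ℝ≥0) : dyadicFloor n t ≤ t := by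
  rw [dyadicFloor, div_le_iff₀ (by positivity), mul_comm]
  exact Nat.floor_le (by positivity)

theorem lt_dyadicFloor_add (n : ℕ) (t : ℝ≥0) : t < dyadicFloor n t + (1 / 2) ^ n := by
  have h := Nat.lt_floor_add_one (2 ^ n * t)
  have h2 : (0 : ℝ≥0) < 2 ^ n := by positivity
  rw [dyadicFloor, one_div, inv_pow, ← one_div, ← add_div, lt_div_iff₀ h2, mul_comm]
  exact h

theorem tendsto_dyadicFloor (t : ℝ≥0) : Tendsto (fun n => dyadicFloor n t) atTop (𝓝 t) := by
  have h0 : Tendsto (fun n : ℕ => ((1 / 2 : ℝ≥0)) ^ n) atTop (𝓝 0) :=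
    tendsto_pow_atTop_nhds_zero_of_lt_one zero_le
      (by rw [← NNReal.coe_lt_coe]; push_cast; norm_num)
  have h1 : Tendsto (fun n : ℕ => t - (1 / 2 : ℝ≥0) ^ n) atTop (𝓝 t) := by
    simpa using (tendsto_const_nhds (x := t)).sub h0
  refine tendsto_of_tendsto_of_tendsto_of_le_of_le h1 tendsto_const_nhds (fun n => ?_)
    fun n => dyadicFloor_le n t
  exact tsub_le_iff_right.2 (lt_dyadicFloor_add n t).le

variable {f : ℝ≥0 → ℝ} {q : ℝ} {T N : ℕ}

/-- Refining the grid either leaves the dyadic floor in place or moves it right by one interval of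
the finer level. -/
theorem abs_sub_dyadicFloor_succ_le (hq : 0 ≤ q)
    (hf : ∀ n ≥ N, ∀ k < n * 2 ^ n, |f ((k + 1 : ℕ) / 2 ^ n) - f (k / 2 ^ n)| ≤ q ^ n)
    {n : ℕ} (hn : N ≤ n) {t : ℝ≥0} (ht : t < n) :
    |f (dyadicFloor (n + 1) t) - f (dyadicFloor n t)| ≤ q ^ (n + 1) := by
  set k := ⌊2 ^ n * t⌋₊ with hk
  have h2 : (0 : ℝ≥0) < 2 ^ n := by positivity
  have e0 : dyadicFloor n t = ((2 * k : ℕ) : ℝ≥0) / 2 ^ (n + 1) := by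
    rw [dyadicFloor, pow_succ]
    push_cast
    field_simp
    rw [hk]
  have hk1 : (k : ℝ≥0) ≤ 2 ^ n * t := Nat.floor_le (by positivity)
  have hk2 : 2 ^ n * t < k + 1 := Nat.lt_floor_add_one _
  have hl : 2 * k ≤ ⌊2 ^ (n + 1) * t⌋₊ := by
    refine Nat.le_floor ?_
    push_cast
    rw [pow_succ, mul_comm (2 ^ n) 2, mul_assoc]
    gcongr
  have hu : ⌊2 ^ (n + 1) * t⌋₊ < 2 * k + 2 := by
    rw [Nat.floor_lt (by positivity)]
    push_cast
    calc (2 : ℝ≥0) ^ (n + 1) * t = 2 * (2 ^ n * t) := by ring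
      _ < 2 * (k + 1) := by gcongr
      _ = _ := by ring
  have hlt : k < n * 2 ^ n := by
    have : (k : ℝ≥0) < (n * 2 ^ n : ℕ) := by
      refine hk1.trans_lt ?_
      push_cast
      rw [mul_comm]
      gcongr
    exact_mod_cast this
  have hcase : ⌊2 ^ (n + 1) * t⌋₊ = 2 * k ∨ ⌊2 ^ (n + 1) * t⌋₊ = 2 * k + 1 := by omega
  rcases hcase with h | h
  · rw [e0, dyadicFloor, h, sub_self, abs_zero]
    positivity
  · rw [e0, dyadicFloor, h]
    refine hf (n + 1) (by omega) (2 * k) ?_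
    rw [pow_succ]
    nlinarith [Nat.two_pow_pos n]

/-- Two points closer than one mesh width have floors that are equal or adjacent. -/
theorem abs_sub_dyadicFloor_le (hq : 0 ≤ q)
    (hf : ∀ n ≥ N, ∀ k < n * 2 ^ n, |f ((k + 1 : ℕ) / 2 ^ n) - f (k / 2 ^ n)| ≤ q ^ n)
    {n : ℕ} (hn : N ≤ n) {s t : ℝ≥0} (ht : t < n) (hst : s ≤ t) (hd : t < s + (1 / 2) ^ n) :
    |f (dyadicFloor n t) - f (dyadicFloor n s)| ≤ q ^ n := by
  set k := ⌊2 ^ n * s⌋₊ with hk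
  have hl : k ≤ ⌊2 ^ n * t⌋₊ := by
    rw [hk]; gcongr
  have h2 : (0 : ℝ≥0) < 2 ^ n := by positivity
  have hu : ⌊2 ^ n * t⌋₊ < k + 2 := by
    rw [Nat.floor_lt (by positivity)]
    push_cast
    calc (2 : ℝ≥0) ^ n * t < 2 ^ n * (s + (1 / 2) ^ n) := by gcongr
      _ = 2 ^ n * s + 1 := by
        rw [mul_add, ← mul_pow, mul_one_div, div_self (by norm_num), one_pow]
      _ < k + 1 + 1 := by gcongr; exact Nat.lt_floor_add_one _
      _ = _ := by ring
  have hlt : k < n * 2 ^ n := by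
    have : (k : ℝ≥0) < (n * 2 ^ n : ℕ) := by
      refine (Nat.floor_le (by positivity)).trans_lt ?_
      push_cast
      rw [mul_comm]
      gcongr
      exact hst.trans_lt ht
    exact_mod_cast this
  have hcase : ⌊2 ^ n * t⌋₊ = k ∨ ⌊2 ^ n * t⌋₊ = k + 1 := by omega
  rcases hcase with h | h
  · rw [dyadicFloor, dyadicFloor, h, sub_self, abs_zero]
    positivity
  · rw [dyadicFloor, dyadicFloor, h]
    exact hf n hn k hlt

/-- A function whose increments over dyadic intervals of level `n` are eventually at most `q ^ n`
has, along dyadic approximations, a continuous limit. -/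
theorem exists_continuous_tendsto_dyadicFloor (hq : 0 ≤ q) (hq1 : q < 1)
    (hf : ∀ᶠ n : ℕ in atTop, ∀ k < n * 2 ^ n, |f ((k + 1 : ℕ) / 2 ^ n) - f (k / 2 ^ n)| ≤ q ^ n) :
    ∃ w : ℝ≥0 → ℝ, Continuous w ∧
      ∀ t, Tendsto (fun n => f (dyadicFloor n t)) atTop (𝓝 (w t)) := by
  obtain ⟨N, hN⟩ := eventually_atTop.1 hf
  have hstep : ∀ (t : ℝ≥0) (m n : ℕ), N ≤ m → t < m → m ≤ n →
      dist (f (dyadicFloor n t)) (f (dyadicFloor (n + 1) t)) ≤ q ^ m * q ^ (n - m) := by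
    intro t m n hm ht hmn
    rw [dist_comm, Real.dist_eq, ← pow_add, Nat.add_sub_cancel' hmn]
    refine (abs_sub_dyadicFloor_succ_le hq hN (hm.trans hmn)
      (ht.trans_le (by exact_mod_cast hmn))).trans ?_
    exact pow_le_pow_of_le_one hq hq1.le (Nat.le_succ n)
  have hshift : ∀ (t : ℝ≥0) (m : ℕ), N ≤ m → t < m → ∀ n,
      dist (f (dyadicFloor (n + m) t)) (f (dyadicFloor (n + 1 + m) t)) ≤ q ^ m * q ^ n := by
    intro t m hm ht n
    have := hstep t m (n + m) hm ht (Nat.le_add_left _ _)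
    rwa [Nat.add_sub_cancel, show n + m + 1 = n + 1 + m by ring] at this
  have hlarge : ∀ t : ℝ≥0, ∃ m : ℕ, N ≤ m ∧ t < m := by
    intro t
    obtain ⟨m, hm⟩ := exists_nat_gt t
    exact ⟨max N m, le_max_left _ _, hm.trans_le (by exact_mod_cast le_max_right _ _)⟩
  have hex : ∀ t, ∃ l, Tendsto (fun n => f (dyadicFloor n t)) atTop (𝓝 l) := by
    intro t
    obtain ⟨m, hm, ht⟩ := hlarge t
    obtain ⟨l, hl⟩ := cauchySeq_tendsto_of_complete
      (cauchySeq_of_le_geometric q (q ^ m) hq1 (hshift t m hm ht))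
    exact ⟨l, (tendsto_add_atTop_iff_nat m).1 hl⟩
  choose w hw using hex
  refine ⟨w, ?_, hw⟩
  have hdist : ∀ (t : ℝ≥0) (m : ℕ), N ≤ m → t < m →
      dist (f (dyadicFloor m t)) (w t) ≤ q ^ m / (1 - q) := by
    intro t m hm ht
    have := dist_le_of_le_geometric_of_tendsto₀ q (q ^ m) hq1 (hshift t m hm ht)
      ((tendsto_add_atTop_iff_nat m).2 (hw t))
    simpa using this
  -- Chaining at level `m`: down from `s` to its floor, across one cell, and up to `t`. The two
  -- vertical moves cost geometric tails.
  have hclose : ∀ (s t : ℝ≥0) (m : ℕ), N ≤ m → t < m → s ≤ t → t < s + (1 / 2) ^ m →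
      dist (w s) (w t) ≤ q ^ m / (1 - q) + q ^ m + q ^ m / (1 - q) := by
    intro s t m hm ht hst hd
    have h1 := abs_sub_dyadicFloor_le hq hN hm ht hst hd
    rw [← Real.dist_eq, dist_comm] at h1
    calc dist (w s) (w t) ≤ dist (w s) (f (dyadicFloor m s)) +
          dist (f (dyadicFloor m s)) (f (dyadicFloor m t)) + dist (f (dyadicFloor m t)) (w t) :=
          dist_triangle4 _ _ _ _
      _ ≤ _ := by
          gcongr
          · rw [dist_comm]; exact hdist s m hm (hst.trans_lt ht)
          · exact hdist t m hm ht
  rw [continuous_iff_continuousAt]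
  intro t
  rw [Metric.continuousAt_iff]
  intro ε hε
  have hlim : Tendsto (fun m : ℕ => q ^ m / (1 - q) + q ^ m + q ^ m / (1 - q)) atTop (𝓝 0) := by
    have h0 := tendsto_pow_atTop_nhds_zero_of_lt_one hq hq1
    simpa using ((h0.div_const (1 - q)).add h0).add (h0.div_const (1 - q))
  -- The margin of one keeps every nearby `s` inside the window `[0, m)` controlled at level `m`.
  obtain ⟨m0, hm0, ht0⟩ := hlarge (t + 1)
  obtain ⟨m, hmε, hmm⟩ := ((hlim.eventually_lt_const hε).and (eventually_ge_atTop m0)).exists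
  have hpow : (0 : ℝ) < (1 / 2) ^ m := by positivity
  refine ⟨(1 / 2) ^ m, hpow, fun {s} hs => ?_⟩
  have hle1 : ((1 / 2 : ℝ)) ^ m ≤ 1 := pow_le_one₀ (by norm_num) (by norm_num)
  rw [NNReal.dist_eq, abs_lt] at hs
  have hmT : t + 1 < (m : ℝ≥0) := ht0.trans_le (by exact_mod_cast hmm)
  have hsm : s < (m : ℝ≥0) := by
    refine lt_of_le_of_lt ?_ hmT
    rw [← NNReal.coe_le_coe]; push_cast; linarith [hs.2]
  have htm : t < (m : ℝ≥0) := lt_of_le_of_lt le_self_add hmT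
  refine lt_of_le_of_lt ?_ hmε
  rcases le_total s t with h | h
  · refine hclose s t m (hm0.trans hmm) htm h ?_
    rw [← NNReal.coe_lt_coe]; push_cast; linarith [hs.1]
  · rw [dist_comm]
    refine hclose t s m (hm0.trans hmm) hsm h ?_
    rw [← NNReal.coe_lt_coe]; push_cast; linarith [hs.2]

/-! ### Dyadic increments of a pre-Brownian motion and Borel-Cantelli. -/

variable {Ω : Type*} [mΩ : MeasurableSpace Ω] {P : Measure Ω}

/-- The fourth moment of a centred Gaussian variable is proportional to the squared variance. -/
theorem lintegral_pow_four_gaussianReal (v : ℝ≥0) :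
    ∫⁻ x, ‖x‖ₑ ^ 4 ∂(gaussianReal 0 v)
      = (v : ℝ≥0∞) ^ 2 * ∫⁻ x, ‖x‖ₑ ^ 4 ∂(gaussianReal 0 1) := by
  have h : gaussianReal 0 v = (gaussianReal 0 1).map (fun x : ℝ => (NNReal.sqrt v : ℝ) * x) := by
    rw [gaussianReal_map_const_mul]
    congr 1
    · simp
    · ext; simp
  rw [h, lintegral_map (by fun_prop) (by fun_prop)]
  simp_rw [enorm_mul, mul_pow]
  rw [lintegral_const_mul _ (by fun_prop)]
  congr 1
  have : ‖((NNReal.sqrt v : ℝ≥0) : ℝ)‖ₑ = (NNReal.sqrt v : ℝ≥0∞) := by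
    rw [Real.enorm_eq_ofReal NNReal.zero_le_coe, ENNReal.ofReal_coe_nnreal]
  rw [this, show (4 : ℕ) = 2 * 2 by norm_num, pow_mul, ← ENNReal.coe_pow, NNReal.sq_sqrt]

theorem lintegral_pow_four_gaussianReal_ne_top :
    ∫⁻ x, ‖x‖ₑ ^ 4 ∂(gaussianReal 0 1) ≠ ∞ := by
  have h := (memLp_id_gaussianReal (μ := 0) (v := 1) 4).2
  rw [eLpNorm_lt_top_iff_lintegral_rpow_enorm_lt_top (by norm_num) (by norm_num)] at h
  refine ne_of_lt (lt_of_eq_of_lt ?_ h)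
  refine lintegral_congr fun x => ?_
  simp only [id]
  rw [← ENNReal.rpow_natCast]
  norm_num

/-- Markov's inequality for the fourth power. It is quadratic in the time step, and so survives a
union over about `2 ^ n` intervals, which the second moment would not. -/
theorem measure_le_abs_sub_le (X : ℝ≥0 → Ω → ℝ) (hX : IsPreBrownianReal X P) (s t : ℝ≥0)
    {c : ℝ} (hc : 0 < c) :
    P {ω | c ≤ |X s ω - X t ω|} ≤ ENNReal.ofReal ((nndist (s : ℝ) t : ℝ) ^ 2 *
      (∫⁻ x, ‖x‖ₑ ^ 4 ∂(gaussianReal 0 1)).toReal / c ^ 4) := by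
  have hlaw : HasLaw (X s - X t) (gaussianReal 0 (nndist (s : ℝ) t)) P := hX.hasLaw_sub s t
  have h4 : ∫⁻ ω, ‖(X s - X t) ω‖ₑ ^ 4 ∂P
      = (nndist (s : ℝ) t : ℝ≥0∞) ^ 2 * ∫⁻ x, ‖x‖ₑ ^ 4 ∂(gaussianReal 0 1) := by
    rw [← lintegral_pow_four_gaussianReal, ← hlaw.map_eq,
      lintegral_map' (by fun_prop) hlaw.aemeasurable]
  have hsub : {ω | c ≤ |X s ω - X t ω|} ⊆ {ω | ENNReal.ofReal (c ^ 4) ≤ ‖(X s - X t) ω‖ₑ ^ 4} := by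
    intro ω hω
    simp only [Set.mem_ofPred_eq, Pi.sub_apply] at hω ⊢
    rw [Real.enorm_eq_ofReal_abs, ← ENNReal.ofReal_pow (abs_nonneg _)]
    exact ENNReal.ofReal_le_ofReal (pow_le_pow_left₀ hc.le hω 4)
  refine (measure_mono hsub).trans ?_
  have hmk := meas_ge_le_lintegral_div (μ := P) (f := fun ω => ‖(X s - X t) ω‖ₑ ^ 4)
    (hlaw.aemeasurable.enorm.pow_const 4) (ε := ENNReal.ofReal (c ^ 4))
    (by simpa using pow_pos hc 4) ENNReal.ofReal_ne_top
  refine hmk.trans (le_of_eq ?_)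
  rw [h4, ENNReal.ofReal_div_of_pos (pow_pos hc 4),
    ENNReal.ofReal_mul (by positivity),
    ENNReal.ofReal_toReal lintegral_pow_four_gaussianReal_ne_top,
    ENNReal.ofReal_pow NNReal.zero_le_coe,
    ENNReal.ofReal_coe_nnreal]

/-- One interval of level `n` is bad with probability at most `C * (1/4) ^ n / (9/10) ^ (4n) = C *
(2500/6561) ^ n`. The `n * 2 ^ n` intervals of `[0, n]` together give `C * n * (5000/6561) ^ n`,
which is summable, so Borel-Cantelli applies. Any ratio `q < 1` with `q ^ 4 > 1/2` would do in place
of `9/10`; the window grows with `n` so as to reach every time. -/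
theorem ae_eventually_dyadic_increments_le (X : ℝ≥0 → Ω → ℝ) (hX : IsPreBrownianReal X P) :
    ∀ᵐ ω ∂P, ∀ᶠ n : ℕ in atTop, ∀ k < n * 2 ^ n,
      |X ((k + 1 : ℕ) / 2 ^ n) ω - X (k / 2 ^ n) ω| ≤ (9 / 10 : ℝ) ^ n := by
  set C := (∫⁻ x, ‖x‖ₑ ^ 4 ∂(gaussianReal 0 1)).toReal with hC
  have hC0 : 0 ≤ C := ENNReal.toReal_nonneg
  set A : ℕ → Set Ω := fun n => ⋃ k ∈ Finset.range (n * 2 ^ n),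
    {ω | (9 / 10 : ℝ) ^ n ≤ |X ((k + 1 : ℕ) / 2 ^ n) ω - X (k / 2 ^ n) ω|} with hA
  have hPA : ∀ n, P (A n) ≤ ENNReal.ofReal (C * ((n : ℝ) ^ 1 * (5000 / 6561 : ℝ) ^ n)) := by
    intro n
    refine (measure_biUnion_finset_le _ _).trans ?_
    have hterm : ∀ k ∈ Finset.range (n * 2 ^ n),
        P {ω | (9 / 10 : ℝ) ^ n ≤ |X ((k + 1 : ℕ) / 2 ^ n) ω - X (k / 2 ^ n) ω|}
          ≤ ENNReal.ofReal (C * (2500 / 6561 : ℝ) ^ n) := by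
      intro k _
      refine (measure_le_abs_sub_le X hX _ _ (by positivity)).trans (ENNReal.ofReal_le_ofReal ?_)
      have hd : (nndist (((k + 1 : ℕ) / 2 ^ n : ℝ≥0) : ℝ) ((k / 2 ^ n : ℝ≥0) : ℝ) : ℝ)
          = (1 / 2) ^ n := by
        rw [coe_nndist, Real.dist_eq]
        push_cast
        rw [← sub_div, add_sub_cancel_left, one_div, one_div, inv_pow, abs_of_pos (by positivity)]
      rw [hd, ← hC, div_le_iff₀ (by positivity), ← pow_mul, ← pow_mul, mul_comm n 2, mul_comm n 4,
        pow_mul, pow_mul, mul_assoc, ← mul_pow, mul_comm]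
      norm_num
    refine (Finset.sum_le_sum hterm).trans ?_
    rw [Finset.sum_const, Finset.card_range, nsmul_eq_mul, ← ENNReal.ofReal_natCast,
      ← ENNReal.ofReal_mul (by positivity)]
    refine ENNReal.ofReal_le_ofReal (le_of_eq ?_)
    push_cast
    rw [show (5000 / 6561 : ℝ) = 2 * (2500 / 6561) by norm_num, mul_pow]
    ring
  have hsum : ∑' n, P (A n) ≠ ∞ := by
    have hs : Summable fun n : ℕ => C * ((n : ℝ) ^ 1 * (5000 / 6561 : ℝ) ^ n) :=
      (summable_pow_mul_geometric_of_norm_lt_one 1 (by norm_num)).mul_left C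
    refine ne_top_of_le_ne_top ?_ (ENNReal.tsum_le_tsum hPA)
    rw [← ENNReal.ofReal_tsum_of_nonneg (fun n => by positivity) hs]
    exact ENNReal.ofReal_ne_top
  filter_upwards [ae_eventually_notMem hsum] with ω hω
  filter_upwards [hω] with n hn k hk
  simp only [hA, Set.mem_iUnion, Finset.mem_range, Set.mem_ofPred_eq, not_exists, not_le] at hn
  exact (hn k hk).le

/-- A pre-Brownian motion has a modification with almost surely continuous paths. -/
theorem exists_isBrownianReal_modification (X : ℝ≥0 → Ω → ℝ) (hX : IsPreBrownianReal X P) :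
    ∃ W : ℝ≥0 → Ω → ℝ, IsBrownianReal W P ∧ ∀ t, W t =ᵐ[P] X t := by
  have hP : IsProbabilityMeasure P := hX.isGaussianProcess.isProbabilityMeasure
  set W : ℝ≥0 → Ω → ℝ := fun t ω => limUnder atTop fun n => X (dyadicFloor n t) ω with hW
  have hlim : ∀ᵐ ω ∂P, Continuous (W · ω) ∧
      ∀ t, Tendsto (fun n => X (dyadicFloor n t) ω) atTop (𝓝 (W t ω)) := by
    filter_upwards [ae_eventually_dyadic_increments_le X hX] with ω hω
    obtain ⟨w, hwc, hw⟩ := exists_continuous_tendsto_dyadicFloor (f := fun t => X t ω)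
      (by norm_num) (by norm_num) hω
    have : (W · ω) = w := funext fun t => (hw t).limUnder_eq
    exact ⟨this ▸ hwc, fun t => by rw [show W t ω = w t from congrFun this t]; exact hw t⟩
  have hmod : ∀ t, W t =ᵐ[P] X t := by
    intro t
    -- `W t - X t` is an almost sure limit of centred Gaussians whose variances, the distances from
    -- `t` to its dyadic floors, tend to zero. Its law is the Dirac mass at zero.
    have hl : HasLaw (fun ω => W t ω - X t ω) (gaussianReal 0 0) P := by
      refine hasLaw_gaussianReal_of_tendsto (S := fun n => X (dyadicFloor n t) - X t)
        (v := fun n => nndist (dyadicFloor n t : ℝ) t) (fun n => hX.hasLaw_sub _ _) ?_ ?_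
      · filter_upwards [hlim] with ω hω
        exact (hω.2 t).sub_const _
      · have h1 : Tendsto (fun n => ((dyadicFloor n t : ℝ≥0) : ℝ)) atTop (𝓝 (t : ℝ)) :=
          NNReal.tendsto_coe.2 (tendsto_dyadicFloor t)
        have h2 := h1.nndist (tendsto_const_nhds (x := (t : ℝ)))
        rwa [nndist_self] at h2
    rw [gaussianReal_zero_var] at hl
    filter_upwards [hl.ae_eq_of_dirac] with ω hω
    simpa [sub_eq_zero] using hω
  exact ⟨W, ⟨hX.congr fun t => (hmod t).symm, hlim.mono fun ω hω => hω.1⟩, hmod⟩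

end Continuity

/-! ### Gradients in the plane -/

section Gradient

variable {f g : ℂ → ℝ} {D : Set ℂ}

theorem norm_gradient (f : ℂ → ℝ) (y : ℂ) : ‖∇ f y‖ = ‖fderiv ℝ f y‖ := by
  rw [gradient, LinearIsometryEquiv.norm_map]

theorem continuousOn_gradient (hD : IsOpen D) (hf : ContDiffOn ℝ 1 f D) :
    ContinuousOn (∇ f) D :=
  (LinearIsometryEquiv.continuous _).comp_continuousOn
    (hf.continuousOn_fderiv_of_isOpen hD le_rfl)

theorem continuous_gradient (hf : ContDiff ℝ 1 f) : Continuous (∇ f) :=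
  (LinearIsometryEquiv.continuous _).comp (hf.continuous_fderiv one_ne_zero)

theorem hasCompactSupport_gradient (hf : HasCompactSupport f) : HasCompactSupport (∇ f) :=
  (hf.fderiv ℝ).comp_left (g := (InnerProductSpace.toDual ℝ ℂ).symm) (map_zero _)

theorem IsTest.contDiff_one {φ : ℂ → ℝ} (h : IsTest D φ) : ContDiff ℝ 1 φ :=
  h.1.of_le (by exact_mod_cast le_top)

theorem integrable_mul_of_continuousOn {F ψ : ℂ → ℝ} (hF : ContinuousOn F D) (hψ : Continuous ψ)
    (hc : HasCompactSupport ψ) (hs : tsupport ψ ⊆ D) : Integrable fun y => F y * ψ y := by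
  have h1 : IntegrableOn (fun y => F y * ψ y) (tsupport ψ) :=
    ((hF.mono hs).mul hψ.continuousOn).integrableOn_compact hc
  refine (integrableOn_iff_integrable_of_support_subset ?_).1 h1
  exact (Function.support_mul_subset_right _ _).trans (subset_tsupport ψ)

/-- Integration by parts against a compactly supported function. -/
theorem integral_mul_fderiv_eq_neg_of_hasCompactSupport (hD : IsOpen D) {F ψ : ℂ → ℝ}
    (hF : ContDiffOn ℝ 1 F D) (hψ : ContDiff ℝ 1 ψ) (hc : HasCompactSupport ψ)
    (hs : tsupport ψ ⊆ D) (v : ℂ) :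
    ∫ y, F y * fderiv ℝ ψ y v = -∫ y, fderiv ℝ F y v * ψ y := by
  have hψv : Continuous fun y => fderiv ℝ ψ y v :=
    (hψ.continuous_fderiv one_ne_zero).clm_apply continuous_const
  have hsv : tsupport (fun y => fderiv ℝ ψ y v) ⊆ tsupport ψ :=
    closure_minimal (fun y hy => by
      by_contra h
      exact hy (by simp [fderiv_of_notMem_tsupport ℝ h])) (isClosed_tsupport ψ)
  refine integral_mul_fderiv_eq_neg_fderiv_mul_of_integrable ?_ ?_ ?_ ?_ ?_
  · refine integrable_mul_of_continuousOn ?_ hψ.continuous hc hs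
    exact (hF.continuousOn_fderiv_of_isOpen hD le_rfl).clm_apply continuousOn_const
  · exact integrable_mul_of_continuousOn hF.continuousOn hψv
      (hc.of_isClosed_subset (isClosed_tsupport _) hsv) (hsv.trans hs)
  · exact integrable_mul_of_continuousOn hF.continuousOn hψ.continuous hc hs
  · exact fun x hx => (hF.differentiableOn one_ne_zero).differentiableAt (hD.mem_nhds (hs hx))
  · exact fun x _ => (hψ.differentiable one_ne_zero) x

/-- The extension by zero of a `C¹` function which vanishes off a compact subset of `D`. -/
theorem contDiff_indicator_of_compact (hD : IsOpen D) (hf : ContDiffOn ℝ 1 f D) {S : Set ℂ}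
    (hS : IsCompact S) (hSD : S ⊆ D) (h0 : ∀ y ∈ D \ S, f y = 0) :
    ContDiff ℝ 1 (D.indicator f) ∧ tsupport (D.indicator f) ⊆ S := by
  have hz : ∀ y, y ∉ S → D.indicator f y = 0 := by
    intro y hy
    by_cases hyD : y ∈ D
    · rw [Set.indicator_of_mem hyD, h0 y ⟨hyD, hy⟩]
    · rw [Set.indicator_of_notMem hyD]
  refine ⟨contDiff_iff_contDiffAt.2 fun y => ?_, closure_minimal (fun y hy => ?_) hS.isClosed⟩
  · by_cases hyS : y ∈ S
    · have h := hD.mem_nhds (hSD hyS)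
      exact (hf.contDiffAt h).congr_of_eventuallyEq
        (eventually_of_mem h fun _ hx => Set.indicator_of_mem hx f)
    · exact (contDiffAt_const (c := (0 : ℝ))).congr_of_eventuallyEq
        (eventually_of_mem (hS.isClosed.isOpen_compl.mem_nhds hyS) hz)
  · by_contra h
    exact hy (hz y h)

theorem gradient_indicator (hD : IsOpen D) {y : ℂ} (hy : y ∈ D) :
    ∇ (D.indicator f) y = ∇ f y :=
  Filter.EventuallyEq.gradient_eq
    (eventually_of_mem (hD.mem_nhds hy) fun _ hx => Set.indicator_of_mem hx f)

end Gradient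

/-! ### The Dirichlet measure -/

section Measure

variable {D : Set ℂ}

theorem dirichletMeasure_le (D : Set ℂ) : dirichletMeasure D ≤ volume.restrict D := by
  intro s
  rw [dirichletMeasure, Measure.smul_apply, smul_eq_mul]
  refine mul_le_of_le_one_left' ?_
  rw [ENNReal.ofReal_le_one, div_le_one (by positivity)]
  nlinarith [Real.pi_gt_three]

theorem dirichletMeasure_const_ne_zero : ENNReal.ofReal (1 / (2 * Real.pi)) ≠ 0 := by
  rw [ENNReal.ofReal_ne_zero_iff]; positivity

theorem ae_dirichletMeasure_iff {p : ℂ → Prop} :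
    (∀ᵐ y ∂(dirichletMeasure D), p y) ↔ ∀ᵐ y ∂(volume.restrict D), p y :=
  Measure.ae_ennreal_smul_measure_iff dirichletMeasure_const_ne_zero

theorem restrict_eq_smul_dirichletMeasure (D : Set ℂ) :
    volume.restrict D = (ENNReal.ofReal (1 / (2 * Real.pi)))⁻¹ • dirichletMeasure D := by
  rw [dirichletMeasure, smul_smul, ENNReal.inv_mul_cancel dirichletMeasure_const_ne_zero
    ENNReal.ofReal_ne_top, one_smul]

theorem memLp_dirichletMeasure_iff {E : Type*} [NormedAddCommGroup E] {w : ℂ → E} :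
    MemLp w 2 (dirichletMeasure D) ↔ MemLp w 2 (volume.restrict D) := by
  refine ⟨fun h => ?_, fun h => h.mono_measure (dirichletMeasure_le D)⟩
  rw [restrict_eq_smul_dirichletMeasure]
  exact h.smul_measure (ENNReal.inv_ne_top.2 dirichletMeasure_const_ne_zero)

theorem integral_dirichletMeasure (F : ℂ → ℝ) :
    ∫ y, F y ∂(dirichletMeasure D) = 1 / (2 * Real.pi) * ∫ y in D, F y := by
  rw [dirichletMeasure, integral_smul_measure, ENNReal.toReal_ofReal (by positivity), smul_eq_mul]

instance : IsFiniteMeasureOnCompacts (dirichletMeasure D) :=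
  ⟨fun _ hK => ((dirichletMeasure_le D _).trans (Measure.restrict_apply_le D _)).trans_lt
    hK.measure_lt_top⟩

end Measure

/-! ### Functions which belong to `H¹₀(D)` -/

section InH

variable {D : Set ℂ} {f : ℂ → ℝ} {w : ℂ → ℂ}

/-- The function `f` belongs to `H¹₀(D)` and has the gradient field `w`. -/
def HasH1Gradient (D : Set ℂ) (f : ℂ → ℝ) (w : ℂ → ℂ) : Prop :=
  ∃ u : H1 D, Represents D f u ∧ (u : Lp ℂ 2 (dirichletMeasure D)) =ᵐ[dirichletMeasure D] w

theorem memLp_gradient {φ : ℂ → ℝ} (hφ : ContDiff ℝ 1 φ) (hc : HasCompactSupport φ) :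
    MemLp (∇ φ) 2 (dirichletMeasure D) :=
  (continuous_gradient hφ).memLp_of_hasCompactSupport (hasCompactSupport_gradient hc)

theorem HasH1Gradient.memLp (h : HasH1Gradient D f w) : MemLp w 2 (dirichletMeasure D) := by
  obtain ⟨u, -, hu⟩ := h
  exact (Lp.memLp (u : Lp ℂ 2 (dirichletMeasure D))).ae_eq hu

theorem HasH1Gradient.congr_gradient {w' : ℂ → ℂ} (h : HasH1Gradient D f w)
    (hw : w =ᵐ[dirichletMeasure D] w') : HasH1Gradient D f w' := by
  obtain ⟨u, hu, hu'⟩ := h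
  exact ⟨u, hu, hu'.trans hw⟩

theorem HasH1Gradient.exists_isTest (h : HasH1Gradient D f w) {K : Set ℂ} (hKD : K ⊆ D)
    (hK : IsCompact K) {ε : ℝ≥0∞} (hε : 0 < ε) :
    ∃ φ, IsTest D φ ∧ eLpNorm (fun y => ∇ φ y - w y) 2 (dirichletMeasure D) < ε ∧
      ∫⁻ y in K, ‖φ y - f y‖ₑ < ε := by
  obtain ⟨u, ⟨φ, hφ, h1, h2⟩, hu⟩ := h
  obtain ⟨n, hn1, hn2⟩ := ((h1.eventually_lt_const hε).and
    ((h2 K hKD hK).eventually_lt_const hε)).exists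
  refine ⟨φ n, hφ n, ?_, hn2⟩
  rwa [eLpNorm_congr_ae (g := fun y => ∇ (φ n) y - (u : Lp ℂ 2 (dirichletMeasure D)) y)]
  filter_upwards [hu] with y hy
  rw [hy]

/-- `Represents` asks for one sequence that serves all compact sets. It is obtained diagonally: the
`n`-th test function is chosen for the `n`-th set of a compact exhaustion with tolerance `1 / (n +
1)`. -/
theorem hasH1Gradient_of_forall_exists_isTest (hD : IsOpen D)
    (hw : MemLp w 2 (dirichletMeasure D))
    (h : ∀ K ⊆ D, IsCompact K → ∀ ε : ℝ≥0∞, 0 < ε → ∃ φ, IsTest D φ ∧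
      eLpNorm (fun y => ∇ φ y - w y) 2 (dirichletMeasure D) < ε ∧
      ∫⁻ y in K, ‖φ y - f y‖ₑ < ε) : HasH1Gradient D f w := by
  have : LocallyCompactSpace D := hD.locallyCompactSpace
  set K := CompactExhaustion.choice D
  have hsub : ∀ n, (Subtype.val '' K n : Set ℂ) ⊆ D := fun n => by
    rintro _ ⟨y, -, rfl⟩; exact y.2
  have hcomp : ∀ n, IsCompact (Subtype.val '' K n : Set ℂ) := fun n =>
    (K.isCompact n).image continuous_subtype_val
  have hcover : ∀ L ⊆ D, IsCompact L → ∃ n, L ⊆ Subtype.val '' K n := by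
    intro L hL hLc
    have : IsCompact (Subtype.val ⁻¹' L : Set D) :=
      Topology.IsInducing.subtypeVal.isCompact_preimage_iff (by simpa using hL) |>.2 hLc
    obtain ⟨n, hn⟩ := K.exists_superset_of_isCompact this
    exact ⟨n, fun y hy => ⟨⟨y, hL hy⟩, hn hy, rfl⟩⟩
  choose φ hφ h1 h2 using fun n : ℕ => h _ (hsub n) (hcomp n) ((n : ℝ≥0∞) + 1)⁻¹
    (ENNReal.inv_pos.2 (by simp))
  have hlim : Tendsto (fun n : ℕ => ((n : ℝ≥0∞) + 1)⁻¹) atTop (𝓝 0) := by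
    have := (tendsto_add_atTop_iff_nat 1).2 ENNReal.tendsto_inv_nat_nhds_zero
    simpa using this
  have hgrad : Tendsto (fun n => eLpNorm (fun y => ∇ (φ n) y - w y) 2 (dirichletMeasure D))
      atTop (𝓝 0) :=
    tendsto_of_tendsto_of_tendsto_of_le_of_le tendsto_const_nhds hlim (fun _ => zero_le)
      fun n => (h1 n).le
  have hφL : ∀ n, MemLp (∇ (φ n)) 2 (dirichletMeasure D) := fun n =>
    memLp_gradient (hφ n).contDiff_one (hφ n).2.1
  have hmem : hw.toLp w ∈ (testGradients D).topologicalClosure := by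
    refine mem_closure_of_tendsto (f := fun n => (hφL n).toLp _) (b := atTop) ?_
      (Eventually.of_forall fun n => ⟨φ n, hφ n, (hφL n).coeFn_toLp⟩)
    rw [Lp.tendsto_Lp_iff_tendsto_eLpNorm'' _ hφL _ hw]
    exact hgrad
  refine ⟨⟨hw.toLp w, hmem⟩, ⟨φ, hφ, ?_, fun L hL hLc => ?_⟩, hw.coeFn_toLp⟩
  · refine hgrad.congr fun n => eLpNorm_congr_ae ?_
    filter_upwards [hw.coeFn_toLp] with y hy
    rw [hy]
  · obtain ⟨m, hm⟩ := hcover L hL hLc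
    refine tendsto_of_tendsto_of_tendsto_of_le_of_le' tendsto_const_nhds hlim
      (.of_forall fun _ => zero_le) ((eventually_ge_atTop m).mono fun n hn => ?_)
    refine le_trans ?_ (h2 n).le
    exact lintegral_mono_set (hm.trans (Set.image_mono (K.subset hn)))

theorem HasH1Gradient.congr_function {g : ℂ → ℝ} (hD : IsOpen D) (h : HasH1Gradient D f w)
    (hfg : f =ᵐ[volume.restrict D] g) : HasH1Gradient D g w := by
  refine hasH1Gradient_of_forall_exists_isTest hD h.memLp fun K hKD hK ε hε => ?_
  obtain ⟨φ, hφ, h1, h2⟩ := h.exists_isTest hKD hK hε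
  refine ⟨φ, hφ, h1, lt_of_eq_of_lt (lintegral_congr_ae ?_) h2⟩
  filter_upwards [ae_mono (Measure.restrict_mono hKD le_rfl) hfg] with y hy
  rw [hy]

/-- `H¹₀(D)` is closed under limits. -/
theorem hasH1Gradient_of_tendsto (hD : IsOpen D) {fn : ℕ → ℂ → ℝ} {wn : ℕ → ℂ → ℂ}
    (h : ∀ n, HasH1Gradient D (fn n) (wn n))
    (hm : ∀ n, AEStronglyMeasurable (fn n) (volume.restrict D))
    (hw : MemLp w 2 (dirichletMeasure D))
    (hwn : Tendsto (fun n => eLpNorm (fun y => wn n y - w y) 2 (dirichletMeasure D)) atTop (𝓝 0))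
    (hfn : ∀ K ⊆ D, IsCompact K → Tendsto (fun n => ∫⁻ y in K, ‖fn n y - f y‖ₑ) atTop (𝓝 0)) :
    HasH1Gradient D f w := by
  refine hasH1Gradient_of_forall_exists_isTest hD hw fun K hKD hK ε hε => ?_
  have hε2 : 0 < ε / 2 := ENNReal.half_pos hε.ne'
  obtain ⟨n, hn1, hn2⟩ := ((hwn.eventually_lt_const hε2).and
    ((hfn K hKD hK).eventually_lt_const hε2)).exists
  obtain ⟨φ, hφ, h1, h2⟩ := (h n).exists_isTest hKD hK hε2
  have hφL : MemLp (∇ φ) 2 (dirichletMeasure D) := memLp_gradient hφ.contDiff_one hφ.2.1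
  refine ⟨φ, hφ, ?_, ?_⟩
  · have e : (fun y => ∇ φ y - w y) = (fun y => ∇ φ y - wn n y) + fun y => wn n y - w y := by
      ext y; simp
    rw [e, ← ENNReal.add_halves ε]
    refine (eLpNorm_add_le (hφL.sub (h n).memLp).1 ((h n).memLp.sub hw).1 (by norm_num)).trans_lt ?_
    exact ENNReal.add_lt_add h1 hn1
  · rw [← ENNReal.add_halves ε]
    refine lt_of_le_of_lt ?_ (ENNReal.add_lt_add h2 hn2)
    rw [← lintegral_add_left']
    · refine lintegral_mono fun y => ?_
      have : φ y - f y = (φ y - fn n y) + (fn n y - f y) := by ring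
      rw [this]
      exact enorm_add_le _ _
    · exact (hφ.1.continuous.aestronglyMeasurable.sub
        ((hm n).mono_measure (Measure.restrict_mono hKD le_rfl))).enorm

end InH

/-! ### `C¹` functions with compact support belong to `H¹₀(D)` -/

section Mollification

open scoped Convolution ContDiff

variable {D : Set ℂ} {f : ℂ → ℝ}

/-- Convolution with a narrow normed bump commutes with the derivative; `f` and `fderiv ℝ f` are
uniformly continuous, so both errors are uniformly small. -/
theorem exists_contDiff_approx (hf : ContDiff ℝ 1 f) (hc : HasCompactSupport f) {δ ε : ℝ}
    (hδ : 0 < δ) (hε : 0 < ε) :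
    ∃ g : ℂ → ℝ, ContDiff ℝ ∞ g ∧ tsupport g ⊆ Metric.cthickening δ (tsupport f) ∧
      (∀ y, |g y - f y| ≤ ε) ∧ ∀ y, ‖∇ g y - ∇ f y‖ ≤ ε := by
  have hf' : Continuous (fderiv ℝ f) := hf.continuous_fderiv one_ne_zero
  obtain ⟨δ1, hδ1, h1⟩ := Metric.uniformContinuous_iff.1
    (hc.uniformContinuous_of_continuous hf.continuous) ε hε
  obtain ⟨δ2, hδ2, h2⟩ := Metric.uniformContinuous_iff.1
    ((hc.fderiv ℝ).uniformContinuous_of_continuous hf') ε hε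
  set r := min δ (min δ1 δ2) with hr
  have hr0 : 0 < r := by positivity
  let φ : ContDiffBump (0 : ℂ) := ⟨r / 2, r, by positivity, by linarith⟩
  have hφr : φ.rOut = r := rfl
  set g := (φ.normed volume ⋆[ContinuousLinearMap.lsmul ℝ ℝ, volume] f) with hg
  have hder : ∀ y, fderiv ℝ g y
      = (φ.normed volume ⋆[ContinuousLinearMap.lsmul ℝ ℝ, volume] fderiv ℝ f) y := by
    intro y
    refine (hc.hasFDerivAt_convolution_right _ φ.continuous_normed.locallyIntegrable hf
      y).fderiv.trans ?_
    rfl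
  refine ⟨g, ?_, ?_, fun y => ?_, fun y => ?_⟩
  · exact φ.hasCompactSupport_normed.contDiff_convolution_left _ φ.contDiff_normed
      hf.continuous.locallyIntegrable
  · refine closure_minimal ?_ Metric.isClosed_cthickening
    refine (support_convolution_subset _).trans ?_
    rintro _ ⟨a, ha, b, hb, rfl⟩
    rw [φ.support_normed_eq, mem_ball_zero_iff, hφr] at ha
    refine Metric.mem_cthickening_of_dist_le _ b _ _ (subset_tsupport f hb) ?_
    simp only [dist_eq_norm, add_sub_cancel_right]
    exact ha.le.trans (min_le_left _ _)
  · rw [← Real.dist_eq]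
    refine φ.dist_normed_convolution_le hf.continuous.aestronglyMeasurable fun x hx => (h1 ?_).le
    exact (Metric.mem_ball.1 hx).trans_le ((min_le_right _ _).trans (min_le_left _ _))
  · rw [gradient, gradient, ← map_sub, LinearIsometryEquiv.norm_map, hder, ← dist_eq_norm]
    refine φ.dist_normed_convolution_le hf'.aestronglyMeasurable fun x hx => (h2 ?_).le
    exact (Metric.mem_ball.1 hx).trans_le ((min_le_right _ _).trans (min_le_right _ _))

theorem hasH1Gradient_of_hasCompactSupport (hD : IsOpen D) (hf : ContDiff ℝ 1 f)
    (hc : HasCompactSupport f) (hs : tsupport f ⊆ D) : HasH1Gradient D f (∇ f) := by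
  refine hasH1Gradient_of_forall_exists_isTest hD (memLp_gradient hf hc) fun K hKD hK ε hε => ?_
  obtain ⟨δ, hδ, hδD⟩ := hc.exists_cthickening_subset_open hD hs
  set S := Metric.cthickening δ (tsupport f) with hS
  have hSc : IsCompact S := hc.cthickening
  set V : ℝ≥0∞ := volume S + volume K with hV
  have hVtop : V ≠ ⊤ := ENNReal.add_ne_top.2 ⟨hSc.measure_lt_top.ne, hK.measure_lt_top.ne⟩
  -- With uniform error `t`, the gradient error in `L²` is at most `t * (volume S) ^ (1/2)` and the
  -- error in `L¹(K)` is at most `t * volume K`. This quantity dominates both.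
  have hlim : Tendsto (fun t : ℝ => ENNReal.ofReal t * (V ^ (1 / 2 : ℝ) + V)) (𝓝[>] 0) (𝓝 0) := by
    have hne : V ^ (1 / 2 : ℝ) + V ≠ ⊤ :=
      ENNReal.add_ne_top.2 ⟨ENNReal.rpow_ne_top_of_nonneg (by norm_num) hVtop, hVtop⟩
    have h0 : Tendsto (fun t : ℝ => ENNReal.ofReal t) (𝓝[>] 0) (𝓝 0) := by
      have := (ENNReal.continuous_ofReal.tendsto 0).mono_left (nhdsWithin_le_nhds (s := Set.Ioi 0))
      simpa using this
    simpa using ENNReal.Tendsto.mul_const h0 (Or.inr hne)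
  obtain ⟨t, ht, ht0⟩ := ((hlim.eventually_lt_const hε).and self_mem_nhdsWithin).exists
  obtain ⟨g, hg, hgs, hg1, hg2⟩ := exists_contDiff_approx hf hc hδ ht0
  have hgc : HasCompactSupport g := hSc.of_isClosed_subset (isClosed_tsupport g) hgs
  refine ⟨g, ⟨hg, hgc, hgs.trans hδD⟩, lt_of_le_of_lt ?_ ht, lt_of_le_of_lt ?_ ht⟩
  · have hz : ∀ y ∉ S, ∇ g y - ∇ f y = 0 := by
      intro y hy
      have h1 : y ∉ tsupport g := fun h => hy (hgs h)
      have h2 : y ∉ tsupport f := fun h => hy (Metric.self_subset_cthickening _ h)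
      rw [gradient, gradient, fderiv_of_notMem_tsupport ℝ h1, fderiv_of_notMem_tsupport ℝ h2,
        sub_self]
    have hle : eLpNorm (fun y => ∇ g y - ∇ f y) 2 (dirichletMeasure D)
        ≤ eLpNorm (S.indicator fun _ => t) 2 volume := by
      refine (eLpNorm_mono_measure _
        ((dirichletMeasure_le D).trans Measure.restrict_le_self)).trans ?_
      refine eLpNorm_mono fun y => ?_
      by_cases hy : y ∈ S
      · rw [Set.indicator_of_mem hy]
        exact (hg2 y).trans (le_abs_self t)
      · rw [hz y hy]; simp
    refine hle.trans ?_
    rw [eLpNorm_indicator_const hSc.measurableSet (by norm_num) (by norm_num)]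
    rw [Real.enorm_eq_ofReal (le_of_lt ht0)]
    gcongr
    refine le_trans ?_ le_self_add
    simp only [ENNReal.toReal_ofNat]
    gcongr
    exact le_self_add
  · calc ∫⁻ y in K, ‖g y - f y‖ₑ ≤ ∫⁻ _ in K, ENNReal.ofReal t := by
          refine lintegral_mono fun y => ?_
          rw [Real.enorm_eq_ofReal_abs]
          exact ENNReal.ofReal_le_ofReal (hg1 y)
      _ = ENNReal.ofReal t * volume K := by simp
      _ ≤ _ := by
          gcongr
          exact le_add_self.trans le_add_self

/-- A `C¹` function on `D` which vanishes off a compact subset of `D` belongs to `H¹₀(D)`. -/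
theorem hasH1Gradient_of_contDiffOn_of_compact (hD : IsOpen D) (hf : ContDiffOn ℝ 1 f D)
    {S : Set ℂ} (hS : IsCompact S) (hSD : S ⊆ D) (h0 : ∀ y ∈ D \ S, f y = 0) :
    HasH1Gradient D f (∇ f) := by
  obtain ⟨h1, h2⟩ := contDiff_indicator_of_compact hD hf hS hSD h0
  have h := hasH1Gradient_of_hasCompactSupport hD h1
    (hS.of_isClosed_subset (isClosed_tsupport _) h2) (h2.trans hSD)
  refine (h.congr_function hD ?_).congr_gradient ?_
  · filter_upwards [ae_restrict_mem hD.measurableSet] with y hy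
    rw [Set.indicator_of_mem hy]
  · refine ae_dirichletMeasure_iff.2 ?_
    filter_upwards [ae_restrict_mem hD.measurableSet] with y hy
    exact gradient_indicator hD hy

end Mollification

/-! ### The gradient field of an element of `H¹₀(D)` is its weak gradient -/

section WeakGradient

variable {D : Set ℂ} {f : ℂ → ℝ} {w w' : ℂ → ℂ}

theorem IsTest.hasCompactSupport_fderiv_apply {ψ : ℂ → ℝ} (hψ : IsTest D ψ) (v : ℂ) :
    HasCompactSupport (fun y => fderiv ℝ ψ y v) ∧ tsupport (fun y => fderiv ℝ ψ y v) ⊆ D := by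
  have hsv : tsupport (fun y => fderiv ℝ ψ y v) ⊆ tsupport ψ :=
    closure_minimal (fun y hy => by
      by_contra h
      exact hy (by simp [fderiv_of_notMem_tsupport ℝ h])) (isClosed_tsupport ψ)
  exact ⟨hψ.2.1.of_isClosed_subset (isClosed_tsupport _) hsv, hsv.trans hψ.2.2⟩

theorem setIntegral_eq_integral_of_tsupport_subset {F ψ : ℂ → ℝ} (hs : tsupport ψ ⊆ D) :
    ∫ y in D, F y * ψ y = ∫ y, F y * ψ y :=
  setIntegral_eq_integral_of_forall_compl_eq_zero fun y hy => by
    rw [image_eq_zero_of_notMem_tsupport fun h => hy (hs h), mul_zero]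

/-- Integration by parts for the approximating test functions passes to the limit on both sides: on
the left by `L²` convergence of gradients, on the right by `L¹` convergence on the support of `ψ`.
So `w` is the distributional gradient of `f`. -/
theorem HasH1Gradient.integral_inner_mul (h : HasH1Gradient D f w)
    (hm : AEStronglyMeasurable f (volume.restrict D)) {ψ : ℂ → ℝ} (hψ : IsTest D ψ) (v : ℂ) :
    ∫ y in D, inner ℝ (w y) v * ψ y = -∫ y in D, f y * fderiv ℝ ψ y v := by
  obtain ⟨u, ⟨φ, hφ, h1, h2⟩, hu⟩ := h
  have hw := HasH1Gradient.memLp ⟨u, ⟨φ, hφ, h1, h2⟩, hu⟩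
  have hψv := hψ.hasCompactSupport_fderiv_apply v
  have hψvc : Continuous fun y => fderiv ℝ ψ y v :=
    (hψ.contDiff_one.continuous_fderiv one_ne_zero).clm_apply continuous_const
  set K := tsupport ψ with hK
  have hKc : IsCompact K := hψ.2.1
  have hKD : K ⊆ D := hψ.2.2
  have hψL : MemLp (fun y => ψ y • v) 2 (dirichletMeasure D) :=
    (hψ.1.continuous.smul continuous_const).memLp_of_hasCompactSupport hψ.2.1.smul_right
  have hφL : ∀ n, MemLp (∇ (φ n)) 2 (dirichletMeasure D) := fun n =>
    memLp_gradient (hφ n).contDiff_one (hφ n).2.1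
  have hinner : ∀ {w : ℂ → ℂ} (hw : MemLp w 2 (dirichletMeasure D)),
      (inner ℝ (hw.toLp w) (hψL.toLp _) : ℝ)
        = 1 / (2 * Real.pi) * ∫ y in D, inner ℝ (w y) v * ψ y := by
    intro w hw
    rw [L2.inner_def, ← integral_dirichletMeasure]
    refine integral_congr_ae ?_
    filter_upwards [hw.coeFn_toLp, hψL.coeFn_toLp] with y hy1 hy2
    rw [hy1, hy2, real_inner_smul_right, mul_comm]
  have hL : Tendsto (fun n => (hφL n).toLp _) atTop (𝓝 (hw.toLp w)) := by
    rw [Lp.tendsto_Lp_iff_tendsto_eLpNorm'' _ hφL _ hw]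
    refine h1.congr fun n => eLpNorm_congr_ae ?_
    filter_upwards [hu] with y hy
    simp [hy]
  have hpi : 1 / (2 * Real.pi) ≠ 0 := by positivity
  have lim1 : Tendsto (fun n => ∫ y in D, inner ℝ (∇ (φ n) y) v * ψ y) atTop
      (𝓝 (∫ y in D, inner ℝ (w y) v * ψ y)) := by
    have := (hL.inner (tendsto_const_nhds (x := hψL.toLp _))).const_mul (1 / (2 * Real.pi))⁻¹
    simpa only [hinner, inv_mul_cancel_left₀ hpi] using this
  have lim2 : Tendsto (fun n => ∫ y in D, φ n y * fderiv ℝ ψ y v) atTop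
      (𝓝 (∫ y in D, f y * fderiv ℝ ψ y v)) := by
    have hred : ∀ F : ℂ → ℝ, ∫ y in D, F y * fderiv ℝ ψ y v = ∫ y in K, F y * fderiv ℝ ψ y v := by
      intro F
      rw [setIntegral_eq_integral_of_tsupport_subset hψv.2,
        setIntegral_eq_integral_of_tsupport_subset]
      exact closure_minimal (fun y hy => by
        by_contra h
        exact hy (by simp [fderiv_of_notMem_tsupport ℝ h])) (isClosed_tsupport ψ)
    simp only [hred]
    obtain ⟨C, hC⟩ := hψv.1.exists_bound_of_continuous hψvc
    have hmK : AEStronglyMeasurable f (volume.restrict K) :=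
      hm.mono_measure (Measure.restrict_mono hKD le_rfl)
    -- Integrability of `f` on `K` is deduced: some `φ n`, which is integrable on `K`, is within
    -- `L¹` distance one of it.
    have hfin : IntegrableOn f K := by
      obtain ⟨n, hn⟩ := ((h2 K hKD hKc).eventually_lt_const (show (0 : ℝ≥0∞) < 1 by simp)).exists
      have hφi : IntegrableOn (φ n) K := (hφ n).1.continuous.continuousOn.integrableOn_compact hKc
      have hd : IntegrableOn (fun y => φ n y - f y) K :=
        ⟨hφi.1.sub hmK, hn.trans (by simp)⟩
      exact (hφi.sub hd).congr (.of_forall fun y => by simp)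
    refine tendsto_integral_of_L1 _ ?_ (.of_forall fun n => ?_) ?_
    · exact (hfin.mul_bdd hψvc.aestronglyMeasurable (.of_forall hC)).1
    · exact (((hφ n).1.continuous.mul hψvc).continuousOn).integrableOn_compact hKc
    · have h3 := ENNReal.Tendsto.mul_const (b := ENNReal.ofReal C) (h2 K hKD hKc)
        (Or.inr ENNReal.ofReal_ne_top)
      rw [zero_mul] at h3
      refine tendsto_of_tendsto_of_tendsto_of_le_of_le tendsto_const_nhds h3 (fun _ => zero_le)
        fun n => ?_
      rw [← lintegral_mul_const' _ _ ENNReal.ofReal_ne_top]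
      refine lintegral_mono fun y => ?_
      rw [← sub_mul, enorm_mul]
      gcongr
      rw [← ofReal_norm]
      exact ENNReal.ofReal_le_ofReal (hC y)
  refine tendsto_nhds_unique lim1 (lim2.neg.congr fun n => ?_)
  rw [setIntegral_eq_integral_of_tsupport_subset hψv.2,
    setIntegral_eq_integral_of_tsupport_subset hψ.2.2,
    integral_mul_fderiv_eq_neg_of_hasCompactSupport isOpen_univ (hφ n).contDiff_one.contDiffOn
      hψ.contDiff_one hψ.2.1 (Set.subset_univ _), neg_neg]
  simp only [inner_gradient_left]

/-- The fundamental lemma of the calculus of variations, applied to the two components `v = 1` and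
`v = Complex.I`. -/
theorem ae_eq_of_forall_integral_inner_mul (hD : IsOpen D) (hw : MemLp w 2 (volume.restrict D))
    (hw' : LocallyIntegrableOn w' D)
    (h : ∀ ψ, IsTest D ψ → ∀ v : ℂ,
      ∫ y in D, inner ℝ (w y) v * ψ y = ∫ y in D, inner ℝ (w' y) v * ψ y) :
    w =ᵐ[volume.restrict D] w' := by
  have hwl : LocallyIntegrableOn w D := by
    refine (locallyIntegrableOn_iff hD.isLocallyClosed).2 fun K hKD hK => ?_
    have : IsFiniteMeasure (volume.restrict K) := ⟨by simpa using hK.measure_lt_top⟩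
    exact (hw.mono_measure (Measure.restrict_mono hKD le_rfl)).integrable (by norm_num)
  have key : ∀ v : ℂ, ∀ᵐ y, y ∈ D → inner ℝ (w y) v - inner ℝ (w' y) v = (0 : ℝ) := by
    intro v
    have hloc : ∀ {w : ℂ → ℂ}, LocallyIntegrableOn w D →
        LocallyIntegrableOn (fun y => (inner ℝ (w y) v : ℝ)) D := by
      intro w hw x hx
      obtain ⟨s, hs, hi⟩ := hw x hx
      exact ⟨s, hs, hi.inner_const v⟩
    refine hD.ae_eq_zero_of_integral_contDiff_smul_eq_zero ((hloc hwl).sub (hloc hw'))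
      fun ψ h1 h2 h3 => ?_
    have hint : ∀ {w : ℂ → ℂ}, LocallyIntegrableOn w D →
        Integrable fun y => (inner ℝ (w y) v : ℝ) * ψ y := by
      intro w hw
      have hK : IntegrableOn (fun y => (inner ℝ (w y) v : ℝ)) (tsupport ψ) :=
        ((hloc hw).mono_set h3).integrableOn_isCompact h2
      obtain ⟨C, hC⟩ := h2.exists_bound_of_continuous h1.continuous
      have := hK.mul_bdd h1.continuous.aestronglyMeasurable (.of_forall hC)
      refine (integrableOn_iff_integrable_of_support_subset ?_).1 this
      exact (Function.support_mul_subset_right _ _).trans (subset_tsupport ψ)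
    have e : (fun y => ψ y • ((inner ℝ (w y) v : ℝ) - inner ℝ (w' y) v))
        = fun y => (inner ℝ (w y) v : ℝ) * ψ y - inner ℝ (w' y) v * ψ y := by
      ext y; simp only [smul_eq_mul]; ring
    rw [e, integral_sub (hint hwl) (hint hw'), sub_eq_zero,
      ← setIntegral_eq_integral_of_tsupport_subset h3,
      ← setIntegral_eq_integral_of_tsupport_subset h3]
    exact h ψ ⟨h1, h2, h3⟩ v
  filter_upwards [ae_restrict_of_ae (key 1), ae_restrict_of_ae (key Complex.I),
    ae_restrict_mem hD.measurableSet] with y h1 h2 hy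
  have h1 := h1 hy
  have h2 := h2 hy
  simp only [Complex.inner] at h1 h2
  simp at h1 h2
  apply Complex.ext <;> linarith

theorem HasH1Gradient.unique (hD : IsOpen D) (h : HasH1Gradient D f w)
    (h' : HasH1Gradient D f w') (hm : AEStronglyMeasurable f (volume.restrict D)) :
    w =ᵐ[dirichletMeasure D] w' := by
  refine ae_dirichletMeasure_iff.2 (ae_eq_of_forall_integral_inner_mul hD
    (memLp_dirichletMeasure_iff.1 h.memLp) ?_ fun ψ hψ v => ?_)
  · have := memLp_dirichletMeasure_iff.1 h'.memLp
    refine (locallyIntegrableOn_iff hD.isLocallyClosed).2 fun K hKD hK => ?_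
    have hfin : IsFiniteMeasure (volume.restrict K) := ⟨by simpa using hK.measure_lt_top⟩
    exact (this.mono_measure (Measure.restrict_mono hKD le_rfl)).integrable (by norm_num)
  · rw [h.integral_inner_mul hm hψ, h'.integral_inner_mul hm hψ]

theorem HasH1Gradient.ae_eq_gradient (hD : IsOpen D) (h : HasH1Gradient D f w)
    (hf : ContDiffOn ℝ 1 f D) : w =ᵐ[dirichletMeasure D] ∇ f := by
  refine ae_dirichletMeasure_iff.2 (ae_eq_of_forall_integral_inner_mul hD
    (memLp_dirichletMeasure_iff.1 h.memLp)
    ((continuousOn_gradient hD hf).locallyIntegrableOn hD.measurableSet) fun ψ hψ v => ?_)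
  rw [h.integral_inner_mul (hf.continuousOn.aestronglyMeasurable hD.measurableSet) hψ,
    setIntegral_eq_integral_of_tsupport_subset (hψ.hasCompactSupport_fderiv_apply v).2,
    integral_mul_fderiv_eq_neg_of_hasCompactSupport hD hf hψ.contDiff_one hψ.2.1 hψ.2.2, neg_neg,
    setIntegral_eq_integral_of_tsupport_subset hψ.2.2]
  simp only [inner_gradient_left]

/-- `toH1` selects an unspecified representative; uniqueness of weak gradients forces its field to
be `w`. -/
theorem HasH1Gradient.toH1_ae_eq (hD : IsOpen D) (h : HasH1Gradient D f w)
    (hm : AEStronglyMeasurable f (volume.restrict D)) :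
    (toH1 D f : Lp ℂ 2 (dirichletMeasure D)) =ᵐ[dirichletMeasure D] w := by
  have hex : ∃ u : H1 D, Represents D f u := let ⟨u, hu, _⟩ := h; ⟨u, hu⟩
  have : HasH1Gradient D f (toH1 D f : Lp ℂ 2 (dirichletMeasure D)) := by
    refine ⟨toH1 D f, ?_, EventuallyEq.rfl⟩
    rw [toH1, dif_pos hex]
    exact hex.choose_spec
  exact this.unique hD h hm

end WeakGradient

/-! ### A continuously differentiable version of the positive part -/

section SoftPos

theorem hasDerivAt_posPart_sq (t : ℝ) :
    HasDerivAt (fun s : ℝ => (max s 0) ^ 2) (2 * max t 0) t := by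
  rcases lt_trichotomy t 0 with h | rfl | h
  · rw [max_eq_right h.le, mul_zero]
    refine (hasDerivAt_const t (0 : ℝ)).congr_of_eventuallyEq ?_
    filter_upwards [Iio_mem_nhds h] with s hs
    rw [max_eq_right (le_of_lt hs)]; norm_num
  · rw [max_self, mul_zero, hasDerivAt_iff_isLittleO_nhds_zero]
    simp only [zero_add, max_self, smul_zero, sub_zero]
    have h1 : (fun h : ℝ => max h 0 ^ 2 - 0 ^ 2) =O[𝓝 0] fun h => h ^ 2 := by
      refine IsBigO.of_bound 1 (.of_forall fun h => ?_)
      rw [Real.norm_eq_abs, Real.norm_eq_abs, one_mul, zero_pow two_ne_zero, sub_zero, abs_pow,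
        abs_pow]
      refine pow_le_pow_left₀ (abs_nonneg _) ?_ 2
      rcases le_total h 0 with hh | hh
      · rw [max_eq_right hh]; simp
      · rw [max_eq_left hh]
    exact h1.trans_isLittleO (isLittleO_pow_id one_lt_two)
  · rw [max_eq_left h.le]
    refine ((hasDerivAt_pow 2 t).congr_of_eventuallyEq ?_).congr_deriv (by simp)
    filter_upwards [Ioi_mem_nhds h] with s hs
    rw [max_eq_left (le_of_lt hs)]

/-- A `C¹` approximation of the positive part: `0` for `t ≤ 0` and `t - d / 2` for `t ≥ d`. -/
def softPos (d t : ℝ) : ℝ := ((max t 0) ^ 2 - (max (t - d) 0) ^ 2) / (2 * d)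

/-- The derivative of `softPos d`. -/
def softPosDeriv (d t : ℝ) : ℝ := (max t 0 - max (t - d) 0) / d

variable {d t : ℝ}

theorem hasDerivAt_softPos (hd : 0 < d) (t : ℝ) :
    HasDerivAt (softPos d) (softPosDeriv d t) t := by
  have h1 := hasDerivAt_posPart_sq t
  have h2 : HasDerivAt (fun s : ℝ => (max (s - d) 0) ^ 2) (2 * max (t - d) 0) t :=
    (hasDerivAt_posPart_sq (t - d)).comp_sub_const t d
  refine ((h1.sub h2).div_const (2 * d)).congr_deriv ?_
  rw [softPosDeriv]
  field_simp

@[fun_prop]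
theorem continuous_softPosDeriv (d : ℝ) : Continuous (softPosDeriv d) := by
  unfold softPosDeriv; fun_prop

theorem contDiff_softPos (hd : 0 < d) : ContDiff ℝ 1 (softPos d) := by
  rw [contDiff_one_iff_deriv]
  refine ⟨fun t => (hasDerivAt_softPos hd t).differentiableAt, ?_⟩
  have : deriv (softPos d) = softPosDeriv d := funext fun t => (hasDerivAt_softPos hd t).deriv
  rw [this]
  exact continuous_softPosDeriv d

theorem softPosDeriv_nonneg (hd : 0 < d) (t : ℝ) : 0 ≤ softPosDeriv d t := by
  refine div_nonneg (sub_nonneg.2 (max_le_max_right 0 (by linarith))) hd.le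

theorem softPosDeriv_le_one (hd : 0 < d) (t : ℝ) : softPosDeriv d t ≤ 1 := by
  rw [softPosDeriv, div_le_one hd]
  have : max t 0 ≤ max (t - d) 0 + d :=
    max_le (by linarith [le_max_left (t - d) 0]) (by linarith [le_max_right (t - d) 0])
  linarith

theorem softPos_of_nonpos (hd : 0 < d) (ht : t ≤ 0) : softPos d t = 0 := by
  rw [softPos, max_eq_right ht, max_eq_right (by linarith)]; simp

theorem softPosDeriv_of_nonpos (hd : 0 < d) (ht : t ≤ 0) : softPosDeriv d t = 0 := by
  rw [softPosDeriv, max_eq_right ht, max_eq_right (by linarith)]; simp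

theorem softPos_of_le (hd : 0 < d) (ht : d ≤ t) : softPos d t = t - d / 2 := by
  rw [softPos, max_eq_left (by linarith), max_eq_left (by linarith)]
  field_simp
  ring

theorem softPosDeriv_of_le (hd : 0 < d) (ht : d ≤ t) : softPosDeriv d t = 1 := by
  rw [softPosDeriv, max_eq_left (by linarith), max_eq_left (by linarith)]
  field_simp
  ring

theorem softPos_of_mem (ht0 : 0 ≤ t) (ht : t ≤ d) : softPos d t = t ^ 2 / (2 * d) := by
  rw [softPos, max_eq_left ht0, max_eq_right (by linarith)]; simp

theorem softPosDeriv_of_mem (ht0 : 0 ≤ t) (ht : t ≤ d) : softPosDeriv d t = t / d := by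
  rw [softPosDeriv, max_eq_left ht0, max_eq_right (by linarith)]; simp

theorem softPos_nonneg (hd : 0 < d) (t : ℝ) : 0 ≤ softPos d t := by
  rw [softPos]
  have : max (t - d) 0 ≤ max t 0 := max_le_max_right 0 (by linarith)
  have := pow_le_pow_left₀ (le_max_right (t - d) 0) this 2
  exact div_nonneg (by linarith) (by linarith)

theorem softPos_le_mul_softPosDeriv (hd : 0 < d) (t : ℝ) :
    softPos d t ≤ max t 0 * softPosDeriv d t := by
  rcases le_total t 0 with h | h
  · simp [softPos_of_nonpos hd h, softPosDeriv_of_nonpos hd h]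
  rcases le_total t d with h' | h'
  · rw [softPos_of_mem h h', softPosDeriv_of_mem h h', max_eq_left h, ← mul_div_assoc, ← sq]
    gcongr
    linarith
  · rw [softPos_of_le hd h', softPosDeriv_of_le hd h', max_eq_left h]
    linarith

theorem softPos_le (hd : 0 < d) (t : ℝ) : softPos d t ≤ max t 0 :=
  (softPos_le_mul_softPosDeriv hd t).trans
    (mul_le_of_le_one_right (le_max_right _ _) (softPosDeriv_le_one hd t))

/-- The inequality `B ^ 2 ≤ M ^ 2 * B'` that lets the Caccioppoli cross term, which carries `B`, be
absorbed into the energy term, which carries `B'`. -/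
theorem softPos_sq_le (hd : 0 < d) {M : ℝ} (hM : 0 ≤ M) (ht : t ≤ M) :
    softPos d t ^ 2 ≤ M ^ 2 * softPosDeriv d t := by
  have h0 := softPosDeriv_nonneg hd t
  have h1 : softPos d t ≤ M * softPosDeriv d t :=
    (softPos_le_mul_softPosDeriv hd t).trans (by gcongr; exact max_le ht hM)
  calc softPos d t ^ 2 ≤ (M * softPosDeriv d t) ^ 2 :=
        pow_le_pow_left₀ (softPos_nonneg hd t) h1 2
    _ = M ^ 2 * (softPosDeriv d t * softPosDeriv d t) := by ring
    _ ≤ M ^ 2 * (softPosDeriv d t * 1) := by gcongr; exact softPosDeriv_le_one hd t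
    _ = _ := by rw [mul_one]

theorem posPart_le_softPos_add (hd : 0 < d) (t : ℝ) : max t 0 ≤ softPos d t + d := by
  rcases le_total t 0 with h | h
  · rw [softPos_of_nonpos hd h, max_eq_right h]; linarith
  rcases le_total t d with h' | h'
  · rw [max_eq_left h]; linarith [softPos_nonneg hd t]
  · rw [softPos_of_le hd h', max_eq_left h]; linarith

end SoftPos

/-! ### Integrals over annuli -/

section Annulus

theorem setOf_annulus_measurable (x : ℂ) (a b : ℝ) :
    MeasurableSet {y : ℂ | a ≤ ‖y - x‖ ∧ ‖y - x‖ < b} :=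
  (measurableSet_le (g := fun y : ℂ => ‖y - x‖) measurable_const (by fun_prop)).inter
    (measurableSet_lt (f := fun y : ℂ => ‖y - x‖) (by fun_prop) measurable_const)

/-- Polar coordinates: the Jacobian turns `s ^ (-2)` into `s ^ (-1)`, and the constant is the
dimension times the area `π` of the unit disc. -/
theorem integral_annulus_inv_sq (x : ℂ) {a b : ℝ} (ha : 0 < a) (hab : a ≤ b) :
    ∫ y in {y : ℂ | a ≤ ‖y - x‖ ∧ ‖y - x‖ < b}, (‖y - x‖ ^ 2)⁻¹
      = 2 * Real.pi * Real.log (b / a) := by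
  rw [← integral_indicator (setOf_annulus_measurable x a b)]
  have h1 : ({y : ℂ | a ≤ ‖y - x‖ ∧ ‖y - x‖ < b}.indicator fun y => (‖y - x‖ ^ 2)⁻¹)
      = fun y => (Set.Ico a b).indicator (fun s : ℝ => (s ^ 2)⁻¹) ‖y - x‖ := by
    ext y
    by_cases h : a ≤ ‖y - x‖ ∧ ‖y - x‖ < b
    · rw [Set.indicator_of_mem (by exact h), Set.indicator_of_mem (by exact h)]
    · rw [Set.indicator_of_notMem (by exact h), Set.indicator_of_notMem (by exact h)]
  rw [h1, integral_sub_right_eq_self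
    (fun y : ℂ => (Set.Ico a b).indicator (fun s : ℝ => (s ^ 2)⁻¹) ‖y‖) x,
    integral_fun_norm_addHaar]
  have h2 : volume.real (Metric.ball (0 : ℂ) 1) = Real.pi := by
    simp [measureReal_def]
  rw [h2, Complex.finrank_real_complex]
  have h3 : ∫ y in Set.Ioi (0 : ℝ), y ^ (2 - 1) • (Set.Ico a b).indicator (fun s : ℝ => (s ^ 2)⁻¹) y
      = Real.log (b / a) := by
    have e : ∀ y : ℝ, y ^ (2 - 1) • (Set.Ico a b).indicator (fun s : ℝ => (s ^ 2)⁻¹) y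
        = (Set.Ico a b).indicator (fun s : ℝ => s⁻¹) y := by
      intro y
      by_cases h : y ∈ Set.Ico a b
      · have : y ≠ 0 := (ha.trans_le h.1).ne'
        rw [Set.indicator_of_mem h, Set.indicator_of_mem h, smul_eq_mul]
        field_simp
        norm_num
      · rw [Set.indicator_of_notMem h, Set.indicator_of_notMem h, smul_zero]
    simp_rw [e]
    have hs : Set.Ioi (0 : ℝ) ∩ Set.Ico a b = Set.Ico a b :=
      Set.inter_eq_right.2 fun y hy => ha.trans_le hy.1
    rw [setIntegral_indicator measurableSet_Ico, hs, integral_Ico_eq_integral_Ioo,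
      ← integral_Ioc_eq_integral_Ioo, ← intervalIntegral.integral_of_le hab,
      integral_inv_of_pos ha (ha.trans_le hab)]
  rw [h3]
  simp only [nsmul_eq_mul, smul_eq_mul]
  push_cast
  ring

theorem integrableOn_annulus_inv_sq (x : ℂ) {a b : ℝ} (ha : 0 < a) :
    IntegrableOn (fun y : ℂ => (‖y - x‖ ^ 2)⁻¹) {y : ℂ | a ≤ ‖y - x‖ ∧ ‖y - x‖ < b} := by
  have hsub : {y : ℂ | a ≤ ‖y - x‖ ∧ ‖y - x‖ < b} ⊆
      Metric.closedBall x b ∩ {y : ℂ | a ≤ ‖y - x‖} := fun y hy =>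
    ⟨by rw [mem_closedBall_iff_norm]; exact hy.2.le, hy.1⟩
  refine IntegrableOn.mono_set (ContinuousOn.integrableOn_compact ?_ ?_) hsub
  · exact (isCompact_closedBall x b).inter_right (isClosed_le continuous_const (by fun_prop))
  · refine ContinuousOn.inv₀ (by fun_prop) fun y hy => ?_
    have : 0 < ‖y - x‖ := ha.trans_le hy.2
    positivity

end Annulus

/-! ### Logarithmic cutoff functions -/

section Cutoff

/-- A `C¹` step function: `1` for `t ≤ 1` and `0` for `t ≥ 2`. -/
def stepDown (t : ℝ) : ℝ := 2 * (softPos (1 / 2) (2 - t) - softPos (1 / 2) (3 / 2 - t))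

/-- The derivative of `stepDown`. -/
def stepDownDeriv (t : ℝ) : ℝ :=
  -2 * (softPosDeriv (1 / 2) (2 - t) - softPosDeriv (1 / 2) (3 / 2 - t))

theorem hasDerivAt_stepDown (t : ℝ) : HasDerivAt stepDown (stepDownDeriv t) t := by
  have h : ∀ c : ℝ, HasDerivAt (fun s => softPos (1 / 2) (c - s))
      (softPosDeriv (1 / 2) (c - t) * -1) t := fun c =>
    (hasDerivAt_softPos (by norm_num) (c - t)).comp t ((hasDerivAt_id t).const_sub c)
  refine (((h 2).sub (h (3 / 2))).const_mul 2).congr_deriv ?_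
  rw [stepDownDeriv]; ring

theorem contDiff_stepDown : ContDiff ℝ 1 stepDown := by
  have := contDiff_softPos (d := 1 / 2) (by norm_num)
  unfold stepDown
  fun_prop

theorem stepDown_of_le {t : ℝ} (ht : t ≤ 1) : stepDown t = 1 := by
  rw [stepDown, softPos_of_le (by norm_num) (by linarith),
    softPos_of_le (by norm_num) (by linarith)]
  ring

theorem stepDown_of_ge {t : ℝ} (ht : 2 ≤ t) : stepDown t = 0 := by
  rw [stepDown, softPos_of_nonpos (by norm_num) (by linarith),
    softPos_of_nonpos (by norm_num) (by linarith)]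
  ring

theorem stepDownDeriv_of_le {t : ℝ} (ht : t ≤ 1) : stepDownDeriv t = 0 := by
  rw [stepDownDeriv, softPosDeriv_of_le (by norm_num) (by linarith),
    softPosDeriv_of_le (by norm_num) (by linarith)]
  ring

theorem stepDownDeriv_of_ge {t : ℝ} (ht : 2 ≤ t) : stepDownDeriv t = 0 := by
  rw [stepDownDeriv, softPosDeriv_of_nonpos (by norm_num) (by linarith),
    softPosDeriv_of_nonpos (by norm_num) (by linarith)]
  ring

theorem abs_stepDownDeriv_le (t : ℝ) : |stepDownDeriv t| ≤ 2 := by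
  have h := fun s => softPosDeriv_nonneg (d := 1 / 2) (by norm_num) s
  have h' := fun s => softPosDeriv_le_one (d := 1 / 2) (by norm_num) s
  rw [stepDownDeriv, abs_le]
  constructor <;> linarith [h (2 - t), h (3 / 2 - t), h' (2 - t), h' (3 / 2 - t)]

theorem stepDownDeriv_nonpos (t : ℝ) : stepDownDeriv t ≤ 0 := by
  rcases le_total t 1 with h | h
  · rw [stepDownDeriv_of_le h]
  · have h2 : softPosDeriv (1 / 2) (3 / 2 - t) ≤ softPosDeriv (1 / 2) (2 - t) := by
      rcases le_total t (3 / 2) with h3 | h3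
      · rw [softPosDeriv_of_le (by norm_num) (show (1 / 2 : ℝ) ≤ 2 - t by linarith)]
        exact softPosDeriv_le_one (by norm_num) _
      · rw [softPosDeriv_of_nonpos (by norm_num) (show 3 / 2 - t ≤ 0 by linarith)]
        exact softPosDeriv_nonneg (by norm_num) _
    rw [stepDownDeriv]; linarith

theorem stepDown_antitone : Antitone stepDown :=
  antitone_of_hasDerivAt_nonpos hasDerivAt_stepDown stepDownDeriv_nonpos

theorem stepDown_mem_Icc (t : ℝ) : stepDown t ∈ Set.Icc (0 : ℝ) 1 := by
  refine ⟨?_, ?_⟩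
  · rw [← stepDown_of_ge (le_max_right t 2)]
    exact stepDown_antitone (le_max_left t 2)
  · rw [← stepDown_of_le (min_le_right t 1)]
    exact stepDown_antitone (min_le_left t 1)

/-- A cutoff function whose Dirichlet energy tends to `0` as `n → ∞`. -/
def logCutoff (n : ℕ) (y : ℂ) : ℝ := stepDown (Real.log (‖y‖ ^ 2) / (n + 1))

theorem logCutoff_mem_Icc (n : ℕ) (y : ℂ) : logCutoff n y ∈ Set.Icc (0 : ℝ) 1 :=
  stepDown_mem_Icc _

theorem logCutoff_of_le {n : ℕ} {y : ℂ} (hy : ‖y‖ ^ 2 ≤ Real.exp (n + 1)) : logCutoff n y = 1 := by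
  refine stepDown_of_le ?_
  rw [div_le_one (by positivity)]
  rcases eq_or_lt_of_le (sq_nonneg ‖y‖) with h | h
  -- At the origin the convention `Real.log 0 = 0` gives the right value of the cutoff.
  · rw [← h, Real.log_zero]; positivity
  · rwa [Real.log_le_iff_le_exp h]

theorem logCutoff_of_ge {n : ℕ} {y : ℂ} (hy : Real.exp (n + 1) ≤ ‖y‖) : logCutoff n y = 0 := by
  have h0 : 0 < ‖y‖ := (Real.exp_pos _).trans_le hy
  refine stepDown_of_ge ?_
  rw [le_div_iff₀ (by positivity), Real.log_pow]
  have := (Real.le_log_iff_exp_le h0).2 hy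
  push_cast
  linarith

theorem eventually_logCutoff_eq_one (y : ℂ) : ∀ᶠ n in atTop, logCutoff n y = 1 := by
  have h : Tendsto (fun n : ℕ => Real.exp ((n : ℝ) + 1)) atTop atTop :=
    Real.tendsto_exp_atTop.comp (tendsto_atTop_add_const_right _ _ tendsto_natCast_atTop_atTop)
  filter_upwards [h.eventually_ge_atTop (‖y‖ ^ 2)] with n hn
  exact logCutoff_of_le hn

theorem hasFDerivAt_logCutoff (n : ℕ) {y : ℂ} (hy : y ≠ 0) :
    HasFDerivAt (logCutoff n) (stepDownDeriv (Real.log (‖y‖ ^ 2) / (n + 1)) •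
      ((n + 1 : ℝ)⁻¹ • ((‖y‖ ^ 2)⁻¹ • (2 • innerSL ℝ y)))) y := by
  have h1 : HasFDerivAt (fun y : ℂ => ‖y‖ ^ 2) (2 • innerSL ℝ y) y :=
    (hasStrictFDerivAt_norm_sq y).hasFDerivAt
  have h2 := h1.log (by have := norm_pos_iff.2 hy; positivity)
  have h3 : HasFDerivAt (fun y : ℂ => Real.log (‖y‖ ^ 2) / (n + 1))
      ((n + 1 : ℝ)⁻¹ • ((‖y‖ ^ 2)⁻¹ • (2 • innerSL ℝ y))) y := by
    simpa only [div_eq_inv_mul] using h2.const_mul ((n + 1 : ℝ)⁻¹)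
  exact (hasDerivAt_stepDown _).comp_hasFDerivAt y h3

theorem contDiff_logCutoff (n : ℕ) : ContDiff ℝ 1 (logCutoff n) := by
  rw [contDiff_iff_contDiffAt]
  intro y
  by_cases hy : y = 0
  · refine (contDiffAt_const (c := (1 : ℝ))).congr_of_eventuallyEq ?_
    have : ∀ᶠ x : ℂ in 𝓝 y, ‖x‖ ^ 2 < Real.exp (n + 1) :=
      (Continuous.tendsto (by fun_prop : Continuous fun x : ℂ => ‖x‖ ^ 2) y).eventually_lt_const
        (by subst hy; simpa using Real.exp_pos _)
    filter_upwards [this] with x hx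
    exact logCutoff_of_le hx.le
  · have h1 : ContDiffAt ℝ 1 (fun y : ℂ => ‖y‖ ^ 2) y := (contDiff_norm_sq ℝ).contDiffAt
    have h2 := (h1.log (by have := norm_pos_iff.2 hy; positivity)).div_const (n + 1 : ℝ)
    exact contDiff_stepDown.contDiffAt.comp y h2

/-- The argument of `stepDown` lies between `1` and `2` exactly when `e ^ ((n+1)/2) ≤ ‖y‖ ≤ e ^
(n+1)`. There the slope is at most `2` and the gradient of `log (‖y‖ ^ 2)` has norm `2 / ‖y‖`; the
`16` is the square of their product `4`. -/
theorem norm_gradient_logCutoff_sq_le (n : ℕ) (y : ℂ) :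
    ‖∇ (logCutoff n) y‖ ^ 2 ≤ {y : ℂ | Real.exp ((n + 1) / 2) ≤ ‖y - 0‖ ∧
      ‖y - 0‖ < Real.exp (n + 1)}.indicator
      (fun y => 16 / (n + 1 : ℝ) ^ 2 * (‖y - 0‖ ^ 2)⁻¹) y := by
  have hn : (0 : ℝ) < n + 1 := by positivity
  simp only [sub_zero]
  rw [norm_gradient]
  have hz : ∀ y : ℂ, y ≠ 0 → stepDownDeriv (Real.log (‖y‖ ^ 2) / (n + 1)) = 0 →
      ‖fderiv ℝ (logCutoff n) y‖ ^ 2 = 0 := by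
    intro y hy h
    rw [(hasFDerivAt_logCutoff n hy).fderiv, h, zero_smul, norm_zero]; norm_num
  by_cases h1 : ‖y‖ < Real.exp ((n + 1) / 2)
  · have h0 : fderiv ℝ (logCutoff n) y = 0 := by
      have : logCutoff n =ᶠ[𝓝 y] fun _ => 1 := by
        filter_upwards [continuous_norm.continuousAt.eventually_lt_const h1] with x hx
        refine logCutoff_of_le ?_
        have := pow_le_pow_left₀ (norm_nonneg x) hx.le 2
        rwa [← Real.exp_nat_mul,
          show ((2 : ℕ) : ℝ) * ((n + 1) / 2) = n + 1 by push_cast; ring] at this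
      rw [this.fderiv_eq, fderiv_fun_const]; rfl
    rw [h0, norm_zero]
    refine le_trans (by norm_num) (Set.indicator_nonneg (fun y _ => ?_) y)
    positivity
  have hy : y ≠ 0 := by
    rintro rfl
    exact h1 (by rw [norm_zero]; exact Real.exp_pos _)
  by_cases h2 : ‖y‖ < Real.exp (n + 1)
  · have hmem : y ∈ {y : ℂ | Real.exp ((n + 1) / 2) ≤ ‖y‖ ∧ ‖y‖ < Real.exp (n + 1)} :=
      ⟨not_lt.1 h1, h2⟩
    rw [Set.indicator_of_mem hmem, (hasFDerivAt_logCutoff n hy).fderiv]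
    have hy0 := norm_pos_iff.2 hy
    have hnorm : ‖(2 : ℕ) • innerSL ℝ y‖ ≤ 2 * ‖y‖ := by
      refine (norm_nsmul_le).trans ?_
      rw [innerSL_apply_norm]
      norm_num
    rw [norm_smul, norm_smul, norm_smul, norm_inv, norm_inv, Real.norm_of_nonneg hn.le,
      Real.norm_of_nonneg (sq_nonneg ‖y‖)]
    have hle : ‖stepDownDeriv (Real.log (‖y‖ ^ 2) / (n + 1))‖ *
        ((n + 1 : ℝ)⁻¹ * ((‖y‖ ^ 2)⁻¹ * ‖(2 : ℕ) • innerSL ℝ y‖))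
        ≤ 2 * ((n + 1 : ℝ)⁻¹ * ((‖y‖ ^ 2)⁻¹ * (2 * ‖y‖))) := by
      gcongr
      exact abs_stepDownDeriv_le _
    refine (pow_le_pow_left₀ (by positivity) hle 2).trans (le_of_eq ?_)
    field_simp
    norm_num
  · rw [hz y hy]
    · refine Set.indicator_nonneg (fun y _ => ?_) y
      positivity
    · refine stepDownDeriv_of_ge ?_
      have hy0 := norm_pos_iff.2 hy
      rw [le_div_iff₀ hn, Real.log_pow]
      have := (Real.le_log_iff_exp_le hy0).2 (not_lt.1 h2)
      push_cast
      linarith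

/-- The logarithmic width of the annulus is `(n + 1) / 2`, against a factor `(n + 1) ^ (-2)`. The
decay expresses that infinity has zero capacity in the plane, which is why unbounded domains need no
condition on gradients at infinity. -/
theorem integral_norm_gradient_logCutoff_sq_le (n : ℕ) :
    Integrable (fun y => ‖∇ (logCutoff n) y‖ ^ 2) ∧
      ∫ y, ‖∇ (logCutoff n) y‖ ^ 2 ≤ 16 * Real.pi / (n + 1) := by
  have hn : (0 : ℝ) < n + 1 := by positivity
  set A := {y : ℂ | Real.exp ((n + 1) / 2) ≤ ‖y - 0‖ ∧ ‖y - 0‖ < Real.exp (n + 1)}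
  have hA : MeasurableSet A := setOf_annulus_measurable 0 _ _
  have hint : Integrable (A.indicator fun y => 16 / (n + 1 : ℝ) ^ 2 * (‖y - 0‖ ^ 2)⁻¹) := by
    rw [integrable_indicator_iff hA]
    exact (integrableOn_annulus_inv_sq 0 (Real.exp_pos _)).const_mul _
  have hint' : Integrable fun y => ‖∇ (logCutoff n) y‖ ^ 2 := by
    refine hint.mono' ?_ (.of_forall fun y => ?_)
    · exact ((continuous_gradient (contDiff_logCutoff n)).norm.pow 2).aestronglyMeasurable
    · rw [Real.norm_of_nonneg (sq_nonneg _)]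
      exact norm_gradient_logCutoff_sq_le n y
  refine ⟨hint', (integral_mono hint' hint (norm_gradient_logCutoff_sq_le n)).trans (le_of_eq ?_)⟩
  rw [integral_indicator hA, integral_const_mul,
    integral_annulus_inv_sq 0 (Real.exp_pos _) (Real.exp_le_exp.2 (by linarith)), ← Real.exp_sub,
    Real.log_exp]
  field_simp
  ring

end Cutoff

/-! ### A criterion for membership in `H¹₀(D)` -/

section GradientCalculus

variable {f g : ℂ → ℝ} {y : ℂ}

theorem gradient_fun_add (hf : DifferentiableAt ℝ f y) (hg : DifferentiableAt ℝ g y) :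
    ∇ (fun x => f x + g x) y = ∇ f y + ∇ g y := by
  rw [gradient, gradient, gradient, fderiv_fun_add hf hg, map_add]

theorem gradient_fun_mul (hf : DifferentiableAt ℝ f y) (hg : DifferentiableAt ℝ g y) :
    ∇ (fun x => f x * g x) y = f y • ∇ g y + g y • ∇ f y := by
  rw [gradient, gradient, gradient, fderiv_fun_mul hf hg, map_add, map_smulₛₗ, map_smulₛₗ]
  rfl

theorem gradient_comp_real {B : ℝ → ℝ} {b : ℝ} (hB : HasDerivAt B b (f y))
    (hf : DifferentiableAt ℝ f y) : ∇ (fun x => B (f x)) y = b • ∇ f y := by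
  rw [gradient, gradient]
  have h : fderiv ℝ (fun x => B (f x)) y = b • fderiv ℝ f y :=
    (hB.comp_hasFDerivAt y hf.hasFDerivAt).fderiv
  rw [h, map_smulₛₗ]
  rfl

end GradientCalculus

/-! ### Cutting off near the boundary and near infinity. -/

section Criterion

theorem tendsto_eLpNorm_two_of_dominated {α E : Type*} [MeasurableSpace α] [NormedAddCommGroup E]
    {μ : Measure α} {F : ℕ → α → E} {g : α → ℝ} (hg : MemLp g 2 μ)
    (hF : ∀ n, AEStronglyMeasurable (F n) μ) (hb : ∀ n, ∀ᵐ y ∂μ, ‖F n y‖ ≤ ‖g y‖)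
    (h0 : ∀ᵐ y ∂μ, Tendsto (fun n => F n y) atTop (𝓝 0)) :
    Tendsto (fun n => eLpNorm (F n) 2 μ) atTop (𝓝 0) := by
  have hfin : ∫⁻ y, ‖g y‖ₑ ^ (2 : ℝ) ∂μ ≠ ∞ := by
    have := hg.2
    rw [eLpNorm_lt_top_iff_lintegral_rpow_enorm_lt_top (by norm_num) (by norm_num)] at this
    simpa using this.ne
  have h1 : Tendsto (fun n => ∫⁻ y, ‖F n y‖ₑ ^ (2 : ℝ) ∂μ) atTop (𝓝 (∫⁻ _, 0 ∂μ)) := by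
    refine tendsto_lintegral_of_dominated_convergence' (fun y => ‖g y‖ₑ ^ (2 : ℝ))
      (fun n => (hF n).enorm.pow_const _) (fun n => ?_) hfin ?_
    · filter_upwards [hb n] with y hy
      gcongr
      exact enorm_le_iff_norm_le.2 hy
    · filter_upwards [h0] with y hy
      have := ((ENNReal.continuous_rpow_const (y := 2)).tendsto _).comp hy.enorm
      simpa [Function.comp_def] using this
  rw [lintegral_zero] at h1
  have h2 := ((ENNReal.continuous_rpow_const (y := 1 / 2)).tendsto _).comp h1
  simp only [one_div, ENNReal.zero_rpow_of_pos (show (0 : ℝ) < 2⁻¹ by norm_num)] at h2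
  refine h2.congr fun n => ?_
  rw [eLpNorm_eq_lintegral_rpow_enorm_toReal (by norm_num) (by norm_num)]
  simp

/-- Where a function which tends to `0` at the boundary of `D` is bounded away from `0`. -/
theorem isCompact_setOf_le_abs {D C : Set ℂ} {f : ℂ → ℝ} (hD : IsOpen D) (hC : IsClosed C)
    (hf : ContinuousOn f (D ∩ C)) (h0 : ∀ ζ ∈ frontier D, Tendsto f (𝓝[D] ζ) (𝓝 0))
    {δ : ℝ} (hδ : 0 < δ) (R : ℝ) :
    IsCompact {y | y ∈ D ∧ y ∈ C ∧ δ ≤ |f y| ∧ ‖y‖ ≤ R} := by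
  refine (isCompact_closedBall (0 : ℂ) R).of_isClosed_subset ?_ fun y hy => by
    simpa using hy.2.2.2
  refine isClosed_of_closure_subset fun ζ hζ => ?_
  set S := {y | y ∈ D ∧ y ∈ C ∧ δ ≤ |f y| ∧ ‖y‖ ≤ R} with hS
  have hne : (𝓝[S] ζ).NeBot := mem_closure_iff_nhdsWithin_neBot.1 hζ
  have hζC : ζ ∈ C := hC.closure_subset (closure_mono (fun y hy => hy.2.1) hζ)
  have hζR : ‖ζ‖ ≤ R := by
    have hcl : IsClosed {y : ℂ | ‖y‖ ≤ R} := isClosed_le continuous_norm continuous_const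
    exact hcl.closure_subset (closure_mono (fun y hy => hy.2.2.2) hζ)
  have hζD : ζ ∈ closure D := closure_mono (fun y hy => hy.1) hζ
  have hev : ∀ᶠ y in 𝓝[S] ζ, δ ≤ |f y| := eventually_mem_nhdsWithin.mono fun y hy => hy.2.2.1
  by_cases hD' : ζ ∈ D
  · have h1 : Tendsto f (𝓝[S] ζ) (𝓝 (f ζ)) :=
      (hf ζ ⟨hD', hζC⟩).mono fun y hy => ⟨hy.1, hy.2.1⟩
    exact ⟨hD', hζC, ge_of_tendsto h1.abs hev, hζR⟩
  -- A limit point outside the open set `D` would be a frontier point, where `f` tends to zero; this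
  -- contradicts `δ ≤ |f|`.
  · exfalso
    have hfr : ζ ∈ frontier D := ⟨hζD, by rwa [hD.interior_eq]⟩
    have h1 : Tendsto f (𝓝[S] ζ) (𝓝 0) :=
      (h0 ζ hfr).mono_left (nhdsWithin_mono ζ fun y hy => hy.1)
    have := ge_of_tendsto h1.abs hev
    rw [abs_zero] at this
    linarith

/-- A `C¹` odd truncation of the real line, which vanishes on `[-d, d]`. -/
def softThreshold (d t : ℝ) : ℝ := softPos d (t - d) - softPos d (-t - d)

/-- The derivative of `softThreshold d`. -/
def softThresholdDeriv (d t : ℝ) : ℝ := softPosDeriv d (t - d) + softPosDeriv d (-t - d)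

theorem hasDerivAt_softThreshold {d : ℝ} (hd : 0 < d) (t : ℝ) :
    HasDerivAt (softThreshold d) (softThresholdDeriv d t) t := by
  have h1 := (hasDerivAt_softPos hd (t - d)).comp_sub_const t d
  have h2 : HasDerivAt (fun s => softPos d (-s - d)) (softPosDeriv d (-t - d) * -1) t :=
    HasDerivAt.comp (h₂ := softPos d) (h := fun s => -s - d) t (hasDerivAt_softPos hd (-t - d))
      ((hasDerivAt_neg t).sub_const d)
  exact (h1.sub h2).congr_deriv (by rw [softThresholdDeriv]; ring)

theorem contDiff_softThreshold {d : ℝ} (hd : 0 < d) : ContDiff ℝ 1 (softThreshold d) := by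
  have := contDiff_softPos hd
  unfold softThreshold
  fun_prop

theorem softThreshold_of_abs_le {d t : ℝ} (hd : 0 < d) (ht : |t| ≤ d) :
    softThreshold d t = 0 ∧ softThresholdDeriv d t = 0 := by
  obtain ⟨h1, h2⟩ := abs_le.1 ht
  rw [softThreshold, softThresholdDeriv, softPos_of_nonpos hd (by linarith),
    softPos_of_nonpos hd (by linarith), softPosDeriv_of_nonpos hd (by linarith),
    softPosDeriv_of_nonpos hd (by linarith)]
  simp

theorem abs_softThreshold_le {d : ℝ} (hd : 0 < d) (t : ℝ) : |softThreshold d t| ≤ |t| := by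
  have h1 := softPos_nonneg hd (t - d)
  have h2 := softPos_nonneg hd (-t - d)
  have h3 := softPos_le hd (t - d)
  have h4 := softPos_le hd (-t - d)
  have h5 : max (t - d) 0 ≤ |t| := max_le (by linarith [le_abs_self t]) (abs_nonneg t)
  have h6 : max (-t - d) 0 ≤ |t| := max_le (by linarith [neg_le_abs t]) (abs_nonneg t)
  rw [softThreshold, abs_le]
  constructor <;> linarith

theorem softThresholdDeriv_mem_Icc {d : ℝ} (hd : 0 < d) (t : ℝ) :
    softThresholdDeriv d t ∈ Set.Icc (0 : ℝ) 1 := by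
  have h1 := softPosDeriv_nonneg hd (t - d)
  have h2 := softPosDeriv_nonneg hd (-t - d)
  have h3 := softPosDeriv_le_one hd (t - d)
  have h4 := softPosDeriv_le_one hd (-t - d)
  rw [softThresholdDeriv]
  rcases le_total t 0 with h | h
  · rw [softPosDeriv_of_nonpos hd (show t - d ≤ 0 by linarith)]
    constructor <;> linarith
  · rw [softPosDeriv_of_nonpos hd (show -t - d ≤ 0 by linarith)]
    constructor <;> linarith

theorem abs_softThreshold_sub_le {d : ℝ} (hd : 0 < d) (t : ℝ) :
    |softThreshold d t - t| ≤ 2 * d := by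
  have h1 := softPos_le hd (t - d)
  have h2 := softPos_le hd (-t - d)
  have h3 := posPart_le_softPos_add hd (t - d)
  have h4 := posPart_le_softPos_add hd (-t - d)
  have h5 := le_max_left (t - d) 0
  have h6 := le_max_left (-t - d) 0
  rw [softThreshold, abs_le]
  rcases le_total t 0 with h | h
  · rw [max_eq_right (show t - d ≤ 0 by linarith)] at h1 h3
    have h7 : max (-t - d) 0 ≤ -t := max_le (by linarith) (by linarith)
    have := softPos_nonneg hd (t - d)
    constructor <;> linarith
  · rw [max_eq_right (show -t - d ≤ 0 by linarith)] at h2 h4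
    have h7 : max (t - d) 0 ≤ t := max_le (by linarith) h
    have := softPos_nonneg hd (-t - d)
    constructor <;> linarith

theorem softThresholdDeriv_of_le {d t : ℝ} (hd : 0 < d) (ht : 2 * d ≤ |t|) :
    softThresholdDeriv d t = 1 := by
  rw [softThresholdDeriv]
  rcases le_abs.1 ht with h | h
  · rw [softPosDeriv_of_le hd (by linarith), softPosDeriv_of_nonpos hd (by linarith), add_zero]
  · rw [softPosDeriv_of_le hd (show d ≤ -t - d by linarith),
      softPosDeriv_of_nonpos hd (by linarith),
      zero_add]

theorem eLpNorm_gradient_logCutoff_le (n : ℕ) :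
    eLpNorm (∇ (logCutoff n)) 2 volume
      ≤ ENNReal.ofReal (16 * Real.pi / (n + 1)) ^ (1 / 2 : ℝ) := by
  obtain ⟨h1, h2⟩ := integral_norm_gradient_logCutoff_sq_le n
  rw [eLpNorm_eq_lintegral_rpow_enorm_toReal (by norm_num) (by norm_num)]
  simp only [ENNReal.toReal_ofNat]
  gcongr
  refine le_trans (le_of_eq ?_) (ENNReal.ofReal_le_ofReal h2)
  rw [ofReal_integral_eq_lintegral_ofReal h1 (.of_forall fun y => sq_nonneg _)]
  refine lintegral_congr fun y => ?_
  rw [ENNReal.ofReal_pow (norm_nonneg _), ofReal_norm]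
  norm_cast

theorem tendsto_eLpNorm_gradient_logCutoff :
    Tendsto (fun n => eLpNorm (∇ (logCutoff n)) 2 volume) atTop (𝓝 0) := by
  have h1 : Tendsto (fun n : ℕ => 16 * Real.pi / ((n : ℝ) + 1)) atTop (𝓝 0) :=
    tendsto_const_nhds.div_atTop
      (tendsto_atTop_add_const_right _ _ tendsto_natCast_atTop_atTop)
  have h2 := ((ENNReal.continuous_rpow_const (y := 1 / 2)).tendsto _).comp
    ((ENNReal.continuous_ofReal.tendsto _).comp h1)
  rw [ENNReal.ofReal_zero, ENNReal.zero_rpow_of_pos (by norm_num)] at h2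
  exact tendsto_of_tendsto_of_tendsto_of_le_of_le tendsto_const_nhds h2 (fun _ => zero_le)
    eLpNorm_gradient_logCutoff_le

variable {D : Set ℂ} {f : ℂ → ℝ}

/-- A bounded `C¹` function of finite Dirichlet energy which tends to `0` at the boundary belongs
to `H¹₀(D)`. -/
theorem hasH1Gradient_of_tendsto_frontier (hD : IsOpen D) (hf : ContDiffOn ℝ 1 f D) {M : ℝ}
    (hM : ∀ y ∈ D, |f y| ≤ M) (h0 : ∀ ζ ∈ frontier D, Tendsto f (𝓝[D] ζ) (𝓝 0))
    (hg : MemLp (∇ f) 2 (dirichletMeasure D)) : HasH1Gradient D f (∇ f) := by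
  set d : ℕ → ℝ := fun n => 1 / ((n : ℝ) + 1) with hd
  have hd0 : ∀ n, 0 < d n := fun n => by positivity
  have hdlim : Tendsto d atTop (𝓝 0) := tendsto_one_div_add_atTop_nhds_zero_nat
  -- The threshold removes a neighbourhood of the finite boundary, the cutoff one of infinity, so `F
  -- n` vanishes off a compact subset of `D`.
  set F : ℕ → ℂ → ℝ := fun n y => softThreshold (d n) (f y) * logCutoff n y with hF
  -- The derivative of the threshold tends to `1` only where `f ≠ 0` and is `0` where `f = 0`, so
  -- this modified field is the pointwise limit of the truncated gradients.
  set w : ℂ → ℂ := fun y => if f y = 0 then 0 else ∇ f y with hw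
  have hfd : ∀ y ∈ D, DifferentiableAt ℝ f y := fun y hy =>
    (hf.differentiableOn one_ne_zero).differentiableAt (hD.mem_nhds hy)
  have hFC : ∀ n, ContDiffOn ℝ 1 (F n) D := fun n =>
    ((contDiff_softThreshold (hd0 n)).comp_contDiffOn hf).mul (contDiff_logCutoff n).contDiffOn
  have hFgrad : ∀ n, ∀ y ∈ D, ∇ (F n) y = softThreshold (d n) (f y) • ∇ (logCutoff n) y
      + (logCutoff n y * softThresholdDeriv (d n) (f y)) • ∇ f y := by
    intro n y hy
    have hd1 : DifferentiableAt ℝ (fun x => softThreshold (d n) (f x)) y :=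
      (hasDerivAt_softThreshold (hd0 n) _).differentiableAt.comp y (hfd y hy)
    change ∇ (fun x => softThreshold (d n) (f x) * logCutoff n x) y = _
    rw [gradient_fun_mul hd1 ((contDiff_logCutoff n).differentiable one_ne_zero y),
      gradient_comp_real (hasDerivAt_softThreshold (hd0 n) _) (hfd y hy), smul_smul]
  have hFH : ∀ n, HasH1Gradient D (F n) (∇ (F n)) := by
    intro n
    refine hasH1Gradient_of_contDiffOn_of_compact hD (hFC n)
      (isCompact_setOf_le_abs hD isClosed_univ (by simpa using hf.continuousOn) h0 (hd0 n)
        (Real.exp (n + 1))) (fun y hy => hy.1) fun y hy => ?_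
    by_cases h1 : |f y| ≤ d n
    · simp only [hF, (softThreshold_of_abs_le (hd0 n) h1).1, zero_mul]
    · by_cases h2 : ‖y‖ ≤ Real.exp (n + 1)
      · exact absurd ⟨hy.1, Set.mem_univ _, (not_le.1 h1).le, h2⟩ hy.2
      · simp only [hF, logCutoff_of_ge (not_le.1 h2).le, mul_zero]
  have hfm : AEStronglyMeasurable f (dirichletMeasure D) :=
    (hf.continuousOn.aestronglyMeasurable hD.measurableSet).mono_measure (dirichletMeasure_le D)
  have hwm : AEStronglyMeasurable w (dirichletMeasure D) := by
    have : w =ᵐ[dirichletMeasure D] fun y =>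
        (Set.indicator {0}ᶜ (fun _ => (1 : ℝ)) (f y)) • ∇ f y := by
      refine .of_forall fun y => ?_
      by_cases h : f y = 0 <;> simp [hw, h]
    refine AEStronglyMeasurable.congr ?_ this.symm
    refine AEStronglyMeasurable.fun_smul ?_ hg.1
    exact ((measurable_const.indicator (measurableSet_singleton _).compl).comp_aemeasurable
      hfm.aemeasurable).aestronglyMeasurable
  have hwL : MemLp w 2 (dirichletMeasure D) := by
    refine hg.mono hwm (.of_forall fun y => ?_)
    by_cases h : f y = 0 <;> simp [hw, h]
  have hmain : HasH1Gradient D f w := by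
    refine hasH1Gradient_of_tendsto hD hFH
      (fun n => (hFC n).continuousOn.aestronglyMeasurable hD.measurableSet) hwL ?_ ?_
    -- The error splits in two. `T n` is dominated by `‖∇ f‖` and tends to zero pointwise; the part
    -- containing the gradient of the cutoff is at most `M` times that gradient, whose energy
    -- vanishes.
    · set T : ℕ → ℂ → ℂ := fun n y =>
        (logCutoff n y * softThresholdDeriv (d n) (f y)) • ∇ f y - w y with hT
      have hTm : ∀ n, AEStronglyMeasurable (T n) (dirichletMeasure D) := by
        intro n
        refine (AEStronglyMeasurable.fun_smul ?_ hg.1).fun_sub hwm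
        refine (contDiff_logCutoff n).continuous.aestronglyMeasurable.mul ?_
        have hc : Continuous (softThresholdDeriv (d n)) := by
          unfold softThresholdDeriv; fun_prop
        exact hc.comp_aestronglyMeasurable hfm
      have hTlim : Tendsto (fun n => eLpNorm (T n) 2 (dirichletMeasure D)) atTop (𝓝 0) := by
        refine tendsto_eLpNorm_two_of_dominated hg.norm hTm (fun n => .of_forall fun y => ?_)
          (.of_forall fun y => ?_)
        · have h1 := logCutoff_mem_Icc n y
          have h2 := softThresholdDeriv_mem_Icc (hd0 n) (f y)
          have h3 : logCutoff n y * softThresholdDeriv (d n) (f y) ≤ 1 :=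
            mul_le_one₀ h1.2 h2.1 h2.2
          have h4 : 0 ≤ logCutoff n y * softThresholdDeriv (d n) (f y) := mul_nonneg h1.1 h2.1
          rw [norm_norm]
          by_cases h : f y = 0
          · simp only [hT, hw, h, if_true, sub_zero]
            rw [norm_smul]
            refine mul_le_of_le_one_left (norm_nonneg _) ?_
            rw [← h, Real.norm_of_nonneg h4]; exact h3
          · simp only [hT, hw, h, if_false]
            nth_rewrite 2 [← one_smul ℝ (∇ f y)]
            rw [← sub_smul, norm_smul]
            refine mul_le_of_le_one_left (norm_nonneg _) ?_
            rw [Real.norm_eq_abs, abs_le]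
            constructor <;> linarith
        · by_cases h : f y = 0
          · refine tendsto_const_nhds.congr fun n => ?_
            simp only [hT, hw, h, if_true, sub_zero]
            rw [(softThreshold_of_abs_le (hd0 n) (by rw [abs_zero]; exact (hd0 n).le)).2]
            simp
          · have h2 : Tendsto (fun n => 2 * d n) atTop (𝓝 0) := by
              simpa using hdlim.const_mul 2
            refine tendsto_const_nhds.congr' ?_
            filter_upwards [eventually_logCutoff_eq_one y,
              h2.eventually_le_const (abs_pos.2 h)] with n h3 h4
            simp only [hT, hw, h, if_false]
            rw [h3, softThresholdDeriv_of_le (hd0 n) h4, one_mul, one_smul, sub_self]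
      have hχlim : Tendsto (fun n => ENNReal.ofReal M * eLpNorm (∇ (logCutoff n)) 2 volume) atTop
          (𝓝 0) := by
        simpa using ENNReal.Tendsto.const_mul tendsto_eLpNorm_gradient_logCutoff
          (Or.inr (ENNReal.ofReal_ne_top (r := M)))
      have hsum := hχlim.add hTlim
      rw [add_zero] at hsum
      refine tendsto_of_tendsto_of_tendsto_of_le_of_le tendsto_const_nhds hsum (fun _ => zero_le)
        fun n => ?_
      set U : ℂ → ℂ := fun y => softThreshold (d n) (f y) • ∇ (logCutoff n) y with hU
      have hUm : AEStronglyMeasurable U (dirichletMeasure D) :=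
        ((contDiff_softThreshold (hd0 n)).continuous.comp_aestronglyMeasurable hfm).smul
          (continuous_gradient (contDiff_logCutoff n)).aestronglyMeasurable
      have hae : (fun y => ∇ (F n) y - w y) =ᵐ[dirichletMeasure D] U + T n := by
        refine ae_dirichletMeasure_iff.2 ?_
        filter_upwards [ae_restrict_mem hD.measurableSet] with y hy
        rw [hFgrad n y hy, Pi.add_apply, add_sub_assoc]
      change eLpNorm (fun y => ∇ (F n) y - w y) 2 (dirichletMeasure D) ≤ _
      rw [eLpNorm_congr_ae hae]
      refine (eLpNorm_add_le hUm (hTm n) (by norm_num)).trans ?_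
      gcongr
      have hUb : ∀ᵐ y ∂(dirichletMeasure D), ‖U y‖ ≤ M * ‖∇ (logCutoff n) y‖ := by
        refine ae_dirichletMeasure_iff.2 ?_
        filter_upwards [ae_restrict_mem hD.measurableSet] with y hy
        rw [hU, norm_smul]
        gcongr
        exact (abs_softThreshold_le (hd0 n) _).trans (hM y hy)
      refine (eLpNorm_le_mul_eLpNorm_of_ae_le_mul hUb 2).trans ?_
      gcongr
      exact (dirichletMeasure_le D).trans Measure.restrict_le_self
    · intro K hKD hK
      have hfin : ∫⁻ _ in K, ENNReal.ofReal (2 * M) ≠ ∞ := by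
        rw [setLIntegral_const]
        exact ENNReal.mul_ne_top ENNReal.ofReal_ne_top hK.measure_lt_top.ne
      have hlim := tendsto_lintegral_of_dominated_convergence' (μ := volume.restrict K)
        (F := fun n y => ‖F n y - f y‖ₑ) (f := fun _ => 0) (fun _ => ENNReal.ofReal (2 * M))
        (fun n => ?_) (fun n => ?_) hfin ?_
      · simpa using hlim
      · exact ((((hFC n).continuousOn.sub hf.continuousOn).mono hKD).aestronglyMeasurable
          hK.measurableSet).enorm
      · filter_upwards [ae_restrict_mem hK.measurableSet] with y hy
        rw [Real.enorm_eq_ofReal_abs]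
        refine ENNReal.ofReal_le_ofReal ((abs_sub _ _).trans ?_)
        have h1 := hM y (hKD hy)
        have h2 := (abs_softThreshold_le (hd0 n) (f y)).trans h1
        have h3 := logCutoff_mem_Icc n y
        have h4 : |F n y| ≤ M := by
          rw [hF, abs_mul, abs_of_nonneg h3.1]
          exact (mul_le_of_le_one_right (abs_nonneg _) h3.2).trans h2
        linarith
      · refine .of_forall fun y => ?_
        have h1 : Tendsto (fun n => 2 * d n) atTop (𝓝 0) := by
          simpa using hdlim.const_mul 2
        have h2 : Tendsto (fun n => F n y - f y) atTop (𝓝 0) := by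
          refine squeeze_zero_norm' ?_ h1
          filter_upwards [eventually_logCutoff_eq_one y] with n hn
          simp only [hF, hn, mul_one]
          exact abs_softThreshold_sub_le (hd0 n) _
        simpa using h2.enorm
  -- Both `w` and `∇ f` are weak gradients of `f`, so they agree almost everywhere; in particular `∇
  -- f = 0` almost everywhere on the zero set of `f`.
  exact hmain.congr_gradient (hmain.ae_eq_gradient hD hf)

end Criterion

/-! ### The Dirichlet energy of the Green's function away from the pole -/

section Energy

theorem inner_gradient_eq_add (f g : ℂ → ℝ) (y : ℂ) :
    inner ℝ (∇ f y) (∇ g y)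
      = fderiv ℝ f y 1 * fderiv ℝ g y 1 + fderiv ℝ f y Complex.I * fderiv ℝ g y Complex.I := by
  simp only [← inner_gradient_left, Complex.inner]
  simp
  ring

/-- A harmonic function is weakly harmonic. -/
theorem integral_inner_gradient_eq_zero {U : Set ℂ} (hU : IsOpen U) {g ψ : ℂ → ℝ}
    (hg : InnerProductSpace.HarmonicOnNhd g U) (hψ : ContDiff ℝ 1 ψ) (hc : HasCompactSupport ψ)
    (hs : tsupport ψ ⊆ U) : Integrable (fun y => inner ℝ (∇ g y) (∇ ψ y)) ∧
      ∫ y, inner ℝ (∇ g y) (∇ ψ y) = 0 := by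
  have hg1 : ContDiffOn ℝ 1 (fderiv ℝ g) U := hg.contDiffOn.fderiv_of_isOpen hU (by norm_num)
  have hF : ∀ v : ℂ, ContDiffOn ℝ 1 (fun y => fderiv ℝ g y v) U := fun v =>
    hg1.clm_apply contDiffOn_const
  have hFd : ∀ v : ℂ, ∀ y ∈ U, fderiv ℝ (fun y => fderiv ℝ g y v) y v
      = iteratedFDeriv ℝ 2 g y ![v, v] := by
    intro v y hy
    have hd : DifferentiableAt ℝ (fderiv ℝ g) y :=
      (hg1.differentiableOn one_ne_zero).differentiableAt (hU.mem_nhds hy)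
    rw [iteratedFDeriv_two_apply, fderiv_clm_apply hd (differentiableAt_const v)]
    simp
  have hψv : ∀ v : ℂ, Continuous fun y => fderiv ℝ ψ y v := fun v =>
    (hψ.continuous_fderiv one_ne_zero).clm_apply continuous_const
  have hsv : ∀ v : ℂ, tsupport (fun y => fderiv ℝ ψ y v) ⊆ tsupport ψ := fun v =>
    closure_minimal (fun y hy => by
      by_contra h
      exact hy (by simp [fderiv_of_notMem_tsupport ℝ h])) (isClosed_tsupport ψ)
  have hint1 : ∀ v : ℂ, Integrable fun y => fderiv ℝ g y v * fderiv ℝ ψ y v := fun v =>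
    integrable_mul_of_continuousOn (hF v).continuousOn (hψv v)
      (hc.of_isClosed_subset (isClosed_tsupport _) (hsv v)) ((hsv v).trans hs)
  have hint2 : ∀ v : ℂ, Integrable fun y => fderiv ℝ (fun y => fderiv ℝ g y v) y v * ψ y :=
    fun v => integrable_mul_of_continuousOn
      (((hF v).continuousOn_fderiv_of_isOpen hU le_rfl).clm_apply continuousOn_const)
      hψ.continuous hc hs
  have heq : (fun y => inner ℝ (∇ g y) (∇ ψ y)) = fun y => fderiv ℝ g y 1 * fderiv ℝ ψ y 1
      + fderiv ℝ g y Complex.I * fderiv ℝ ψ y Complex.I :=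
    funext fun y => inner_gradient_eq_add g ψ y
  rw [heq]
  refine ⟨(hint1 1).add (hint1 Complex.I), ?_⟩
  rw [integral_add (hint1 1) (hint1 Complex.I),
    integral_mul_fderiv_eq_neg_of_hasCompactSupport hU (hF 1) hψ hc hs,
    integral_mul_fderiv_eq_neg_of_hasCompactSupport hU (hF Complex.I) hψ hc hs, ← neg_add,
    ← integral_add (hint2 1) (hint2 Complex.I), neg_eq_zero]
  refine integral_eq_zero_of_ae (.of_forall fun y => ?_)
  by_cases hy : y ∈ U
  · have hΔ : Laplacian.laplacian g y = 0 := (hg y hy).2.eq_of_nhds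
    rw [InnerProductSpace.laplacian_eq_iteratedFDeriv_complexPlane] at hΔ
    change fderiv ℝ (fun y => fderiv ℝ g y 1) y 1 * ψ y
      + fderiv ℝ (fun y => fderiv ℝ g y Complex.I) y Complex.I * ψ y = 0
    rw [hFd 1 y hy, hFd Complex.I y hy, ← add_mul]
    exact mul_eq_zero_of_left hΔ _
  · have : ψ y = 0 := image_eq_zero_of_notMem_tsupport fun h => hy (hs h)
    simp [this]

/-- A `C¹` function which vanishes near `x` and equals `1` away from `x`. -/
theorem exists_contDiff_cutoff (x : ℂ) {r : ℝ} (hr : 0 < r) :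
    ∃ q : ℂ → ℝ, ContDiff ℝ 1 q ∧ (∀ y, q y ∈ Set.Icc (0 : ℝ) 1) ∧
      (∀ y, ‖y - x‖ ≤ r / 2 → q y = 0) ∧ (∀ y, r ≤ ‖y - x‖ → q y = 1) ∧
      (∀ y, ‖y - x‖ < r / 2 → ∇ q y = 0) ∧ ∀ y, r < ‖y - x‖ → ∇ q y = 0 := by
  let φ : ContDiffBump x := ⟨r / 2, r, by positivity, by linarith⟩
  have h0 : ∀ y, ‖y - x‖ ≤ r / 2 → 1 - φ y = 0 := fun y hy => by
    rw [φ.one_of_mem_closedBall (by rwa [mem_closedBall_iff_norm]), sub_self]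
  have h1 : ∀ y, r ≤ ‖y - x‖ → 1 - φ y = 1 := fun y hy => by
    rw [φ.zero_of_le_dist (by rwa [dist_eq_norm]), sub_zero]
  have hconst : ∀ (c : ℝ) (y : ℂ), (∀ᶠ s in 𝓝 y, 1 - φ s = c) →
      ∇ (fun y => 1 - φ y) y = 0 := fun c y h => by
    rw [Filter.EventuallyEq.gradient_eq (f := fun _ => c) h, gradient_fun_const]
  refine ⟨fun y => 1 - φ y, contDiff_const.sub φ.contDiff,
    fun y => ⟨by linarith [φ.le_one (x := y)], by linarith [φ.nonneg (x := y)]⟩, h0, h1, ?_, ?_⟩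
  · intro y hy
    refine hconst 0 y ?_
    filter_upwards [(Continuous.tendsto (f := fun s : ℂ => ‖s - x‖)
      (by fun_prop) y).eventually_lt_const hy] with s hs
    exact h0 s hs.le
  · intro y hy
    refine hconst 1 y ?_
    filter_upwards [(Continuous.tendsto (f := fun s : ℂ => ‖s - x‖)
      (by fun_prop) y).eventually_const_lt hy] with s hs
    exact h1 s hs.le

/-- The pointwise form of the Caccioppoli inequality. -/
theorem caccioppoli_pointwise {B B' χ q M a c e : ℝ} {v w z : ℂ} (hM : 0 < M) (hB0 : 0 ≤ B)
    (hBM : B ≤ M) (hB : B ^ 2 ≤ M ^ 2 * B') (hχ0 : 0 ≤ χ) (hχ : χ ≤ 1) (hq0 : 0 ≤ q) (hq : q ≤ 1)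
    (ha : ‖v‖ = a) (hc : ‖w‖ = c) (he : ‖z‖ = e) :
    1 / 2 * (B' * χ ^ 2 * q * a ^ 2) ≤ inner ℝ v ((B' * χ ^ 2 * q) • v + (2 * B * χ * q) • w
      + (B * χ ^ 2) • z) + 2 * M ^ 2 * c ^ 2 + M * (a * e) := by
  rw [inner_add_right, inner_add_right, inner_smul_right, inner_smul_right, inner_smul_right,
    real_inner_self_eq_norm_sq]
  have h1 := (abs_le.1 (abs_real_inner_le_norm v w)).1
  have h2 := (abs_le.1 (abs_real_inner_le_norm v z)).1
  rw [ha, hc] at h1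
  rw [ha, he] at h2
  rw [ha]
  have ha0 : 0 ≤ a := ha ▸ norm_nonneg v
  have hc0 : 0 ≤ c := hc ▸ norm_nonneg w
  have he0 : 0 ≤ e := he ▸ norm_nonneg z
  have h3 : -(2 * B * χ * q * (a * c)) ≤ 2 * B * χ * q * inner ℝ v w := by
    rw [← mul_neg]; gcongr
  have h4 : -(M * (a * e)) ≤ B * χ ^ 2 * inner ℝ v z := by
    have h5 : B * χ ^ 2 ≤ M := (mul_le_of_le_one_right hB0 (pow_le_one₀ hχ0 hχ)).trans hBM
    have h6 : B * χ ^ 2 * -(a * e) ≤ B * χ ^ 2 * inner ℝ v z := by gcongr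
    have h7 : B * χ ^ 2 * (a * e) ≤ M * (a * e) := by gcongr
    linarith
  have h8 : 2 * B * χ * q * (a * c) ≤ 1 / 2 * (B' * χ ^ 2 * q * a ^ 2) + 2 * M ^ 2 * c ^ 2 := by
    have h9 : (B / M) ^ 2 ≤ B' := by
      rw [div_pow, div_le_iff₀ (by positivity)]; linarith
    -- With `X = (B / M) * χ * a` and `Y = M * c` this is `2XY ≤ X ^ 2 / 2 + 2Y ^ 2`, the expansion
    -- of `(X - 2Y) ^ 2 ≥ 0`.
    have h10 : 2 * B * χ * (a * c) ≤ 1 / 2 * ((B / M) ^ 2 * χ ^ 2 * a ^ 2) + 2 * M ^ 2 * c ^ 2 := by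
      have h11 : B = B / M * M := by field_simp
      have := sq_nonneg (B / M * χ * a - 2 * (M * c))
      have h12 : 2 * B * χ * (a * c) = 2 * (B / M * M) * χ * (a * c) := by rw [← h11]
      rw [h12]
      nlinarith [this]
    have h13 : 1 / 2 * ((B / M) ^ 2 * χ ^ 2 * a ^ 2) ≤ 1 / 2 * (B' * χ ^ 2 * a ^ 2) := by gcongr
    have h14 := mul_le_mul_of_nonneg_left (h10.trans (add_le_add_left h13 _)) hq0
    have h15 : q * (2 * M ^ 2 * c ^ 2) ≤ 2 * M ^ 2 * c ^ 2 :=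
      mul_le_of_le_one_left (by positivity) hq
    nlinarith [h14, h15]
  nlinarith [h3, h4, h8]

variable {D : Set ℂ} {x : ℂ} {g : ℂ → ℝ} {r : ℝ}

/-- Since `g ≥ 0`, a zero is a local minimum. This handles the points that no truncation level `δ >
0` ever reaches. -/
theorem IsGreenFunction.gradient_eq_zero (hD : IsOpen D) (hg : IsGreenFunction D x g) {y : ℂ}
    (hy : y ∈ D \ {x}) (h0 : g y = 0) : ∇ g y = 0 := by
  have hU : IsOpen (D \ {x}) := hD.sdiff isClosed_singleton
  have hmin : IsLocalMin g y := by
    filter_upwards [hU.mem_nhds hy] with s hs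
    rw [h0]; exact hg.nonneg s hs
  rw [gradient, hmin.fderiv_eq_zero, map_zero]

/-- The Caccioppoli estimate: harmonicity of `g` is tested against `softPos δ (g - δ) * χ ^ 2 * q`,
with `χ = logCutoff n`. The three factors vanish near the finite boundary, near infinity and near
the pole, so the product has compact support. The bound `K` precedes `n` and `δ`, which permits
Fatou's lemma afterwards. -/
theorem IsGreenFunction.lintegral_truncated_le (hD : IsOpen D) (hg : IsGreenFunction D x g)
    (hr : 0 < r) (hrD : Metric.closedBall x r ⊆ D) :
    ∃ K : ℝ, ∀ (n : ℕ) (δ : ℝ), 0 < δ → ∫⁻ y in D \ Metric.ball x r,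
      ENNReal.ofReal (softPosDeriv δ (g y - δ) * logCutoff n y ^ 2 * ‖∇ g y‖ ^ 2)
        ≤ ENNReal.ofReal K := by
  obtain ⟨q, hqC, hq01, hq0, hq1, hqg0, hqg1⟩ := exists_contDiff_cutoff x hr
  obtain ⟨M', hM'⟩ := hg.bounded (r / 2) (by positivity)
  set M := max M' 1 with hMdef
  have hM : 0 < M := lt_max_of_lt_right one_pos
  set U := D \ {x} with hUdef
  have hU : IsOpen U := hD.sdiff isClosed_singleton
  have hg2 : ContDiffOn ℝ 1 g U := hg.harmonic.contDiffOn.of_le (by norm_num)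
  have hgc : ContinuousOn (∇ g) U := continuousOn_gradient hU hg2
  set C := {y : ℂ | r / 2 ≤ ‖y - x‖} with hC
  have hCc : IsClosed C := isClosed_le continuous_const (by fun_prop)
  have hCU : D ∩ C ⊆ U := fun y hy => ⟨hy.1, fun h => by
    have := hy.2
    rw [hC, Set.mem_ofPred_eq, h, sub_self, norm_zero] at this
    linarith⟩
  have hgM : ∀ y ∈ D ∩ C, g y ≤ M := fun y hy =>
    (hM' y hy.1 (by rw [norm_sub_rev]; exact hy.2)).trans (le_max_left _ _)
  have hqint : Integrable fun y => ‖∇ g y‖ * ‖∇ q y‖ := by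
    set A := Metric.closedBall x r ∩ C with hA
    have hAc : IsCompact A := (isCompact_closedBall x r).inter_right hCc
    have hAU : A ⊆ U := fun y hy => hCU ⟨hrD hy.1, hy.2⟩
    refine (integrableOn_iff_integrable_of_support_subset (s := A) ?_).1
      (((hgc.mono hAU).norm.mul (continuous_gradient hqC).norm.continuousOn).integrableOn_compact
        hAc)
    intro y hy
    by_contra hyA
    refine hy ?_
    have : ∇ q y = 0 := by
      by_cases h : y ∈ C
      · refine hqg1 y (not_le.1 fun h' => hyA ⟨?_, h⟩)
        rwa [mem_closedBall_iff_norm]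
      · exact hqg0 y (not_le.1 h)
    simp [this]
  -- The outer `2` undoes the `1/2` of the pointwise inequality, `16π` bounds the energy of every
  -- `logCutoff n`, and the last integrand lives on the transition annulus of `q`.
  refine ⟨2 * (2 * M ^ 2 * (16 * Real.pi) + M * ∫ y, ‖∇ g y‖ * ‖∇ q y‖), fun n δ hδ => ?_⟩
  obtain ⟨hχi, hχle⟩ := integral_norm_gradient_logCutoff_sq_le n
  set Ψ : ℂ → ℝ := fun y => softPos δ (g y - δ) * (logCutoff n y ^ 2 * q y) with hΨ
  have hΨC : ContDiffOn ℝ 1 Ψ U :=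
    ((contDiff_softPos hδ).comp_contDiffOn (hg2.sub contDiffOn_const)).mul
      (((contDiff_logCutoff n).pow 2).mul hqC).contDiffOn
  set S := {y | y ∈ D ∧ y ∈ C ∧ δ ≤ |g y| ∧ ‖y‖ ≤ Real.exp (n + 1)} with hS
  have hSc : IsCompact S := isCompact_setOf_le_abs hD hCc (hg2.continuousOn.mono hCU)
    hg.boundary hδ _
  have hSU : S ⊆ U := fun y hy => hCU ⟨hy.1, hy.2.1⟩
  have hΨ0 : ∀ y ∈ U \ S, Ψ y = 0 := by
    intro y hy
    by_cases h1 : y ∈ C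
    · by_cases h2 : g y ≤ δ
      · simp only [hΨ, softPos_of_nonpos hδ (sub_nonpos.2 h2), zero_mul]
      · by_cases h3 : ‖y‖ ≤ Real.exp (n + 1)
        · exact absurd ⟨hy.1.1, h1, (not_le.1 h2).le.trans (le_abs_self _), h3⟩ hy.2
        · simp only [hΨ, logCutoff_of_ge (not_le.1 h3).le]; ring
    · simp only [hΨ, hq0 y (not_le.1 h1).le, mul_zero]
  obtain ⟨hIC, hIs⟩ := contDiff_indicator_of_compact hU hΨC hSc hSU hΨ0
  obtain ⟨hwi, hw0⟩ := integral_inner_gradient_eq_zero hU hg.harmonic hIC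
    (hSc.of_isClosed_subset (isClosed_tsupport _) hIs) (hIs.trans hSU)
  have hgrad : ∀ y ∈ U, ∇ (U.indicator Ψ) y
      = (softPosDeriv δ (g y - δ) * logCutoff n y ^ 2 * q y) • ∇ g y
        + (2 * softPos δ (g y - δ) * logCutoff n y * q y) • ∇ (logCutoff n) y
        + (softPos δ (g y - δ) * logCutoff n y ^ 2) • ∇ q y := by
    intro y hy
    have hgd : DifferentiableAt ℝ g y :=
      (hg2.differentiableOn one_ne_zero).differentiableAt (hU.mem_nhds hy)
    have hχd : DifferentiableAt ℝ (logCutoff n) y :=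
      (contDiff_logCutoff n).differentiable one_ne_zero y
    have hqd : DifferentiableAt ℝ q y := hqC.differentiable one_ne_zero y
    have hB : HasDerivAt (fun s => softPos δ (s - δ)) (softPosDeriv δ (g y - δ)) (g y) :=
      (hasDerivAt_softPos hδ (g y - δ)).comp_sub_const _ _
    have hsq : HasDerivAt (fun s : ℝ => s ^ 2) (2 * logCutoff n y) (logCutoff n y) := by
      simpa using hasDerivAt_pow 2 (logCutoff n y)
    have hd1 : DifferentiableAt ℝ (fun y => softPos δ (g y - δ)) y :=
      hB.differentiableAt.comp y hgd
    rw [gradient_indicator hU hy]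
    change ∇ (fun y => softPos δ (g y - δ) * (logCutoff n y ^ 2 * q y)) y = _
    rw [gradient_fun_mul hd1 ((hχd.fun_pow 2).fun_mul hqd),
      gradient_fun_mul (hχd.fun_pow 2) hqd, gradient_comp_real hB hgd, gradient_comp_real hsq hχd]
    module
  have hpt : ∀ y ∈ U, 1 / 2 * (softPosDeriv δ (g y - δ) * logCutoff n y ^ 2 * q y * ‖∇ g y‖ ^ 2)
      ≤ inner ℝ (∇ g y) (∇ (U.indicator Ψ) y) + 2 * M ^ 2 * ‖∇ (logCutoff n) y‖ ^ 2
        + M * (‖∇ g y‖ * ‖∇ q y‖) := by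
    intro y hy
    rw [hgrad y hy]
    by_cases h1 : y ∈ C
    · have hgy : g y - δ ≤ M := by linarith [hgM y ⟨hy.1, h1⟩]
      exact caccioppoli_pointwise hM (softPos_nonneg hδ _)
        ((softPos_le hδ _).trans (max_le hgy hM.le)) (softPos_sq_le hδ hM.le hgy)
        (logCutoff_mem_Icc n y).1 (logCutoff_mem_Icc n y).2 (hq01 y).1 (hq01 y).2 rfl rfl rfl
    · rw [hq0 y (not_le.1 h1).le, hqg0 y (not_le.1 h1)]
      simp only [mul_zero, zero_mul, zero_smul, smul_zero, add_zero, inner_zero_right, zero_add,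
        norm_zero]
      positivity
  have hR : Integrable fun y => inner ℝ (∇ g y) (∇ (U.indicator Ψ) y)
      + 2 * M ^ 2 * ‖∇ (logCutoff n) y‖ ^ 2 + M * (‖∇ g y‖ * ‖∇ q y‖) :=
    (hwi.add (hχi.const_mul _)).add (hqint.const_mul _)
  have hUc : ∀ y ∉ U, inner ℝ (∇ g y) (∇ (U.indicator Ψ) y) = 0 := by
    intro y hy
    have : y ∉ tsupport (U.indicator Ψ) := fun h => hy (hSU (hIs h))
    rw [gradient, gradient, fderiv_of_notMem_tsupport ℝ this, map_zero, inner_zero_right]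
  have hRnn : ∀ y, 0 ≤ inner ℝ (∇ g y) (∇ (U.indicator Ψ) y)
      + 2 * M ^ 2 * ‖∇ (logCutoff n) y‖ ^ 2 + M * (‖∇ g y‖ * ‖∇ q y‖) := by
    intro y
    by_cases hy : y ∈ U
    · refine le_trans ?_ (hpt y hy)
      have := softPosDeriv_nonneg hδ (g y - δ)
      have := (hq01 y).1
      positivity
    · rw [hUc y hy]; positivity
  have hmeas : MeasurableSet (D \ Metric.ball x r) :=
    hD.measurableSet.diff Metric.isOpen_ball.measurableSet
  calc ∫⁻ y in D \ Metric.ball x r,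
        ENNReal.ofReal (softPosDeriv δ (g y - δ) * logCutoff n y ^ 2 * ‖∇ g y‖ ^ 2)
      ≤ ∫⁻ y in D \ Metric.ball x r, ENNReal.ofReal (2 * (inner ℝ (∇ g y) (∇ (U.indicator Ψ) y)
          + 2 * M ^ 2 * ‖∇ (logCutoff n) y‖ ^ 2 + M * (‖∇ g y‖ * ‖∇ q y‖))) := by
        refine setLIntegral_mono' hmeas fun y hy => ENNReal.ofReal_le_ofReal ?_
        have hyr : r ≤ ‖y - x‖ := by
          simpa [dist_eq_norm] using hy.2
        have hyU : y ∈ U := hCU ⟨hy.1, by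
          change r / 2 ≤ ‖y - x‖
          linarith⟩
        have := hpt y hyU
        rw [hq1 y hyr, mul_one] at this
        linarith
    _ ≤ ∫⁻ y, ENNReal.ofReal (2 * (inner ℝ (∇ g y) (∇ (U.indicator Ψ) y)
          + 2 * M ^ 2 * ‖∇ (logCutoff n) y‖ ^ 2 + M * (‖∇ g y‖ * ‖∇ q y‖))) :=
        setLIntegral_le_lintegral _ _
    _ = ENNReal.ofReal (∫ y, 2 * (inner ℝ (∇ g y) (∇ (U.indicator Ψ) y)
          + 2 * M ^ 2 * ‖∇ (logCutoff n) y‖ ^ 2 + M * (‖∇ g y‖ * ‖∇ q y‖))) := by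
        rw [ofReal_integral_eq_lintegral_ofReal (hR.const_mul 2)
          (.of_forall fun y => mul_nonneg zero_le_two (hRnn y))]
    _ ≤ _ := by
        refine ENNReal.ofReal_le_ofReal ?_
        rw [integral_const_mul, integral_add (hwi.fun_add (hχi.const_mul _)) (hqint.const_mul _),
          integral_add hwi (hχi.const_mul _), hw0, zero_add, integral_const_mul, integral_const_mul]
        gcongr
        refine hχle.trans (div_le_self (by positivity) ?_)
        have : (0 : ℝ) ≤ n := n.cast_nonneg
        linarith

/-- The Green's function has finite Dirichlet energy away from its pole. -/
theorem IsGreenFunction.memLp_gradient (hD : IsOpen D) (hg : IsGreenFunction D x g)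
    (hr : 0 < r) (hrD : Metric.closedBall x r ⊆ D) :
    MemLp (∇ g) 2 (volume.restrict (D \ Metric.ball x r)) := by
  have hU : IsOpen (D \ {x}) := hD.sdiff isClosed_singleton
  have hg2 : ContDiffOn ℝ 1 g (D \ {x}) := hg.harmonic.contDiffOn.of_le (by norm_num)
  have hmeas : MeasurableSet (D \ Metric.ball x r) :=
    hD.measurableSet.diff Metric.isOpen_ball.measurableSet
  have hsub : D \ Metric.ball x r ⊆ D \ {x} := fun y hy => ⟨hy.1, fun h => hy.2 (by
    rw [h]; exact Metric.mem_ball_self hr)⟩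
  have hgc : ContinuousOn (∇ g) (D \ Metric.ball x r) := (continuousOn_gradient hU hg2).mono hsub
  refine ⟨hgc.aestronglyMeasurable hmeas, ?_⟩
  rw [eLpNorm_lt_top_iff_lintegral_rpow_enorm_lt_top (by norm_num) (by norm_num)]
  obtain ⟨K, hK⟩ := hg.lintegral_truncated_le hD hr hrD
  set d : ℕ → ℝ := fun n => 1 / ((n : ℝ) + 1) with hd
  have hd0 : ∀ n, 0 < d n := fun n => by positivity
  have hdlim : Tendsto (fun n => 2 * d n) atTop (𝓝 0) := by
    simpa [hd] using tendsto_one_div_add_atTop_nhds_zero_nat.const_mul (2 : ℝ)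
  set T : ℕ → ℂ → ℝ≥0∞ := fun n y =>
    ENNReal.ofReal (softPosDeriv (d n) (g y - d n) * logCutoff n y ^ 2 * ‖∇ g y‖ ^ 2) with hT
  have hTm : ∀ n, AEMeasurable (T n) (volume.restrict (D \ Metric.ball x r)) := by
    intro n
    refine (ContinuousOn.aemeasurable ?_ hmeas).ennreal_ofReal
    exact (((continuous_softPosDeriv (d n)).comp_continuousOn
      ((hg2.continuousOn.mono hsub).sub continuousOn_const)).mul
        ((contDiff_logCutoff n).continuous.pow 2).continuousOn).mul (hgc.norm.pow 2)
  have hlim : ∀ y ∈ D \ Metric.ball x r, ‖∇ g y‖ₑ ^ (2 : ℝ) = liminf (fun n => T n y) atTop := by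
    intro y hy
    symm
    refine Tendsto.liminf_eq ?_
    have he : ‖∇ g y‖ₑ ^ (2 : ℝ) = ENNReal.ofReal (‖∇ g y‖ ^ 2) := by
      rw [ENNReal.ofReal_pow (norm_nonneg _), ofReal_norm]
      norm_cast
    rcases (hg.nonneg y (hsub hy)).eq_or_lt with h | h
    · have h0 := hg.gradient_eq_zero hD (hsub hy) h.symm
      simp [hT, h0]
    · rw [he]
      refine tendsto_const_nhds.congr' ?_
      filter_upwards [eventually_logCutoff_eq_one y, hdlim.eventually_le_const h] with n h3 h4
      simp only [hT]
      rw [h3, softPosDeriv_of_le (hd0 n) (by linarith), one_pow, one_mul, one_mul]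
  -- Fatou's lemma along `δ = 1 / (n + 1)`: the truncated densities converge pointwise to `‖∇ g‖ ^
  -- 2`.
  calc ∫⁻ y in D \ Metric.ball x r, ‖∇ g y‖ₑ ^ (2 : ℝ≥0∞).toReal
      = ∫⁻ y in D \ Metric.ball x r, liminf (fun n => T n y) atTop := by
        refine setLIntegral_congr_fun hmeas fun y hy => ?_
        simpa using hlim y hy
    _ ≤ liminf (fun n => ∫⁻ y in D \ Metric.ball x r, T n y) atTop := lintegral_liminf_le' hTm
    _ ≤ ENNReal.ofReal K := by
        refine liminf_le_of_le (by isBoundedDefault) fun b hb => ?_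
        obtain ⟨n, hn⟩ := hb.exists
        exact hn.trans (hK n (d n) (hd0 n))
    _ < ⊤ := ENNReal.ofReal_lt_top

end Energy

/-! ### Removable singularities of harmonic functions -/

section Removable

open InnerProductSpace

/-- The real linear form `v ↦ Re (a v)`. -/
def reMul (a : ℂ) : ℂ →L[ℝ] ℝ := Complex.reCLM.comp (ContinuousLinearMap.mul ℝ ℂ a)

@[simp] theorem reMul_apply (a v : ℂ) : reMul a v = (a * v).re := rfl

theorem hasFDerivAt_real_of_hasDerivAt {F : ℂ → ℂ} {a y : ℂ} (hF : HasDerivAt F a y) :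
    HasFDerivAt F (ContinuousLinearMap.mul ℝ ℂ a) y :=
  (hF.hasFDerivAt.restrictScalars ℝ).congr_fderiv (by ext; simp [mul_comm])

theorem hasFDerivAt_re_of_hasDerivAt {F : ℂ → ℂ} {a y : ℂ} (hF : HasDerivAt F a y) :
    HasFDerivAt (fun z => (F z).re) (reMul a) y :=
  Complex.reCLM.hasFDerivAt.comp y (hasFDerivAt_real_of_hasDerivAt hF)

/-- The holomorphic function `∂₁u - i ∂₂u` attached to a harmonic function `u`. -/
def complexGradient (u : ℂ → ℝ) (y : ℂ) : ℂ := fderiv ℝ u y 1 - Complex.I * fderiv ℝ u y Complex.I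

theorem hasFDerivAt_complexGradient {u : ℂ → ℝ} {y : ℂ} (hu : DifferentiableAt ℝ u y) :
    HasFDerivAt u (reMul (complexGradient u y)) y := by
  refine hu.hasFDerivAt.congr_fderiv ?_
  ext v
  have hv : v = (v.re : ℝ) • (1 : ℂ) + (v.im : ℝ) • Complex.I := by
    simp [Complex.re_add_im]
  nth_rewrite 1 [hv]
  rw [map_add, map_smul, map_smul, reMul_apply, complexGradient]
  simp
  ring

theorem complexGradient_re_of_hasDerivAt {F : ℂ → ℂ} {a y : ℂ} {u : ℂ → ℝ}
    (hF : HasDerivAt F a y) (hu : u =ᶠ[𝓝 y] fun z => (F z).re) : complexGradient u y = a := by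
  have h := ((hasFDerivAt_re_of_hasDerivAt hF).congr_of_eventuallyEq hu).fderiv
  rw [complexGradient, h]
  apply Complex.ext <;> simp

/-- Interior gradient estimate. -/
theorem norm_complexGradient_le {u : ℂ → ℝ} {y : ℂ} {s A : ℝ} (hs : 0 < s) (hA : 0 < A)
    (hu : HarmonicOnNhd u (Metric.ball y s)) (hb : ∀ w ∈ Metric.ball y s, |u w| ≤ A) :
    ‖complexGradient u y‖ ≤ 8 * A / s := by
  obtain ⟨F, hF, hFu⟩ := hu.exists_analyticOnNhd_ball_re_eq
  have hy : y ∈ Metric.ball y s := Metric.mem_ball_self hs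
  have hFd : HasDerivAt F (deriv F y) y := (hF y hy).differentiableAt.hasDerivAt
  have hev : u =ᶠ[𝓝 y] fun z => (F z).re :=
    eventually_of_mem (Metric.isOpen_ball.mem_nhds hy) fun z hz => (hFu hz).symm
  rw [complexGradient_re_of_hasDerivAt hFd hev]
  refine hFd.le_of_lip' (by positivity) ?_
  filter_upwards [Metric.ball_mem_nhds y (half_pos hs)] with w hw
  have hshift : ∀ z ∈ Metric.ball (0 : ℂ) s, y + z ∈ Metric.ball y s := fun z hz => by
    simpa [mem_ball_iff_norm] using hz
  have hw' : ‖w - y‖ < s / 2 := by rwa [← mem_ball_iff_norm]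
  have hwz : w - y ∈ Metric.ball (0 : ℂ) s := by rw [mem_ball_zero_iff]; linarith
  -- Borel-Carathéodory for `F (y + z) - F y`, whose real part is at most `2A`, gives `4A‖z‖ / (s -
  -- ‖z‖)`; this is at most `8A‖z‖ / s` when `‖z‖ < s / 2`.
  have h := Complex.borelCaratheodory_zero (f := fun z => F (y + z) - F y) (M := 2 * A)
    (by positivity) (R := s) (z := w - y) ?_ ?_ hs hwz (by simp)
  · simp only [add_sub_cancel] at h
    refine h.trans ?_
    rw [div_le_iff₀ (by linarith)]
    have h1 : s / 2 ≤ s - ‖w - y‖ := by linarith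
    have h2 : 8 * A / s * ‖w - y‖ * (s / 2) ≤ 8 * A / s * ‖w - y‖ * (s - ‖w - y‖) := by gcongr
    refine le_trans (le_of_eq ?_) h2
    field_simp
    ring
  · intro z hz
    have h1 : DifferentiableAt ℂ F (y + z) := (hF _ (hshift z hz)).differentiableAt
    exact ((h1.comp z ((differentiableAt_id).const_add y)).sub_const _).differentiableWithinAt
  · intro z hz
    change (F (y + z) - F y).re ≤ 2 * A
    rw [Complex.sub_re]
    have h1 := hFu (hshift z hz)
    have h2 := hFu hy
    simp only at h1 h2
    rw [h1, h2]
    have h3 := abs_le.1 (hb _ (hshift z hz))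
    have h4 := abs_le.1 (hb _ hy)
    linarith

variable {x : ℂ} {R : ℝ} {u : ℂ → ℝ}

/-- The gradient estimate on the ball of radius `ρ / 2` about `y`, where `ρ = ‖y - x‖`, bounds the
gradient by a multiple of `|log (ρ / 2)| / ρ`. Multiplied by `ρ ^ 2` this tends to zero, which is
the growth condition for removing the singularity of `(y - x) * complexGradient u y`. -/
theorem isLittleO_sub_mul_complexGradient (hR : 0 < R)
    (hu : HarmonicOnNhd u (Metric.ball x R \ {x}))
    (ho : u =o[𝓝[≠] x] fun y => Real.log ‖y - x‖) :
    (fun y => (y - x) * complexGradient u y) =o[𝓝[≠] x] fun y => (y - x)⁻¹ := by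
  obtain ⟨r, hr0, hr⟩ : ∃ r > 0, ∀ y, ‖y - x‖ < r → y ≠ x → |u y| ≤ |Real.log ‖y - x‖| := by
    have h1 := ho.bound one_pos
    rw [eventually_nhdsWithin_iff, Metric.eventually_nhds_iff] at h1
    obtain ⟨r, hr0, hr⟩ := h1
    refine ⟨r, hr0, fun y hy hyx => ?_⟩
    simpa using hr (by rwa [dist_eq_norm]) hyx
  have hbound : ∀ᶠ y in 𝓝[≠] x, ‖(y - x) * complexGradient u y * (y - x)‖
      ≤ 32 * |Real.log (‖y - x‖ / 2) * (‖y - x‖ / 2)| := by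
    have hnear : ∀ᶠ y in 𝓝 x, ‖y - x‖ < min (min r R) 1 / 2 := by
      have : Tendsto (fun y => ‖y - x‖) (𝓝 x) (𝓝 ‖x - x‖) :=
        Continuous.tendsto (by fun_prop) x
      rw [sub_self, norm_zero] at this
      exact this.eventually_lt_const (by positivity)
    filter_upwards [nhdsWithin_le_nhds hnear, self_mem_nhdsWithin] with y hy hyx
    set ρ := ‖y - x‖ with hρ
    have hρ0 : 0 < ρ := norm_pos_iff.2 (sub_ne_zero.2 hyx)
    have hr' : min (min r R) 1 ≤ r := (min_le_left _ _).trans (min_le_left _ _)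
    have hR' : min (min r R) 1 ≤ R := (min_le_left _ _).trans (min_le_right _ _)
    have h1' : min (min r R) 1 ≤ 1 := min_le_right _ _
    have hsub : ∀ w ∈ Metric.ball y (ρ / 2), ρ / 2 < ‖w - x‖ ∧ ‖w - x‖ < 3 / 2 * ρ := by
      intro w hw
      rw [mem_ball_iff_norm] at hw
      have h1 : ‖w - x‖ ≤ ‖w - y‖ + ‖y - x‖ := norm_sub_le_norm_sub_add_norm_sub w y x
      have h2 : ‖y - x‖ ≤ ‖y - w‖ + ‖w - x‖ := norm_sub_le_norm_sub_add_norm_sub y w x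
      rw [norm_sub_rev y w] at h2
      constructor <;> linarith
    have hlog : Real.log (ρ / 2) < 0 := Real.log_neg (by linarith) (by linarith)
    have hA : 0 < |Real.log (ρ / 2)| := abs_pos.2 hlog.ne
    have hgrad := norm_complexGradient_le (u := u) (y := y) (half_pos hρ0) hA ?_ ?_
    · rw [norm_mul, norm_mul, ← hρ, abs_mul, abs_of_pos (half_pos hρ0)]
      calc ρ * ‖complexGradient u y‖ * ρ ≤ ρ * (8 * |Real.log (ρ / 2)| / (ρ / 2)) * ρ := by gcongr
        _ = 32 * (|Real.log (ρ / 2)| * (ρ / 2)) := by field_simp; ring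
    · intro w hw
      obtain ⟨h1, h2⟩ := hsub w hw
      refine hu w ⟨?_, fun h => ?_⟩
      · rw [mem_ball_iff_norm]; linarith
      · rw [Set.mem_singleton_iff.1 h, sub_self, norm_zero] at h1; linarith
    · intro w hw
      obtain ⟨h1, h2⟩ := hsub w hw
      have h0 : 0 < ‖w - x‖ := by linarith
      refine (hr w (by linarith) (sub_ne_zero.1 (norm_pos_iff.1 h0))).trans ?_
      rw [abs_of_nonpos (Real.log_nonpos h0.le (by linarith)), abs_of_neg hlog]
      exact neg_le_neg (Real.log_le_log (by linarith) h1.le)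
  have hlim : Tendsto (fun y => (y - x) * complexGradient u y * (y - x)) (𝓝[≠] x) (𝓝 0) := by
    refine squeeze_zero_norm' hbound ?_
    have h1 : Tendsto (fun y : ℂ => ‖y - x‖ / 2) (𝓝[≠] x) (𝓝 0) := by
      have : Tendsto (fun y : ℂ => ‖y - x‖ / 2) (𝓝 x) (𝓝 (‖x - x‖ / 2)) :=
        Continuous.tendsto (by fun_prop) x
      simpa using this.mono_left nhdsWithin_le_nhds
    have h2 : Continuous fun t : ℝ => 32 * |Real.log t * t| := by
      have h3 : Continuous fun t : ℝ => Real.log t * t := by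
        simpa [mul_comm] using Real.continuous_mul_log
      fun_prop
    have h3 := (h2.tendsto 0).comp h1
    simpa [Function.comp_def] using h3
  refine (isLittleO_iff_tendsto' ?_).2 (hlim.congr fun y => by rw [div_inv_eq_mul])
  filter_upwards [self_mem_nhdsWithin] with y hy h
  exact absurd h (inv_ne_zero (sub_ne_zero.2 hy))

/-- An isolated singularity of `∂₁u - i ∂₂u`, where `u = o(log)`, is at most a simple pole. -/
theorem exists_complexGradient_eq_add (hR : 0 < R)
    (hu : HarmonicOnNhd u (Metric.ball x R \ {x}))
    (ho : u =o[𝓝[≠] x] fun y => Real.log ‖y - x‖) :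
    ∃ (c : ℂ) (h : ℂ → ℂ), DifferentiableOn ℂ h (Metric.ball x R) ∧
      ∀ y ∈ Metric.ball x R \ {x}, complexGradient u y = c / (y - x) + h y := by
  have hnhd : Metric.ball x R ∈ 𝓝 x := Metric.ball_mem_nhds x hR
  set φ : ℂ → ℂ := fun y => (y - x) * complexGradient u y with hφ
  have hd : DifferentiableOn ℂ φ (Metric.ball x R \ {x}) := by
    intro y hy
    refine DifferentiableAt.differentiableWithinAt ?_
    have h1 : DifferentiableAt ℂ (complexGradient u) y :=
      HarmonicAt.differentiableAt_complex_partial (hu y hy)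
    exact (differentiableAt_id.sub_const x).mul h1
  have hφo : (fun y => φ y - φ x) =o[𝓝[≠] x] fun y => (y - x)⁻¹ := by
    simpa [hφ] using isLittleO_sub_mul_complexGradient hR hu ho
  have hΦ := Complex.differentiableOn_update_limUnder_of_isLittleO hnhd hd hφo
  set Φ := Function.update φ x (limUnder (𝓝[≠] x) φ) with hΦdef
  -- The value of the extended function at `x` is the residue, and its difference quotient is the
  -- holomorphic remainder.
  refine ⟨Φ x, dslope Φ x, (Complex.differentiableOn_dslope hnhd).2 hΦ, fun y hy => ?_⟩
  have hyx : y - x ≠ 0 := sub_ne_zero.2 hy.2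
  have hΦy : Φ y = (y - x) * complexGradient u y := by
    rw [hΦdef, Function.update_of_ne hy.2]
  rw [dslope_of_ne _ hy.2, slope_def_field, hΦy]
  field_simp
  ring

/-- An isolated singularity of a harmonic function which is `o(log)` is removable. -/
theorem exists_harmonicOnNhd_of_isLittleO_log (hR : 0 < R)
    (hu : HarmonicOnNhd u (Metric.ball x R \ {x}))
    (ho : u =o[𝓝[≠] x] fun y => Real.log ‖y - x‖) :
    ∃ v, HarmonicOnNhd v (Metric.ball x R) ∧ ∀ y ∈ Metric.ball x R \ {x}, u y = v y := by
  obtain ⟨c, h, hh, hch⟩ := exists_complexGradient_eq_add hR hu ho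
  obtain ⟨H, hH⟩ := hh.isExactOn_ball
  set P : Set ℂ := {ζ | ζ.re < Real.log R} with hP
  have hPo : IsOpen P := isOpen_lt Complex.continuous_re continuous_const
  have hPc : Convex ℝ P := convex_halfSpace_re_lt _
  have hmem : ∀ ζ ∈ P, x + Complex.exp ζ ∈ Metric.ball x R \ {x} := by
    intro ζ hζ
    refine ⟨?_, by simp [Complex.exp_ne_zero]⟩
    rw [mem_ball_iff_norm, add_sub_cancel_left, Complex.norm_exp]
    exact (Real.lt_log_iff_exp_lt hR).1 hζ
  -- The exponential lifts the punctured disc to the half-plane `P`, where the multivalued `c * log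
  -- (y - x)` becomes `c * ζ`. There `W` has zero derivative, so it is constant.
  set W : ℂ → ℝ := fun ζ => u (x + Complex.exp ζ) - (H (x + Complex.exp ζ)).re - (c * ζ).re with hW
  have hWd : ∀ ζ ∈ P, HasFDerivAt W (0 : ℂ →L[ℝ] ℝ) ζ := by
    intro ζ hζ
    have hm := hmem ζ hζ
    have h1 := (hasFDerivAt_complexGradient ((hu _ hm).1.differentiableAt two_ne_zero)).sub
      (hasFDerivAt_re_of_hasDerivAt (hH _ hm.1))
    have h2 : HasFDerivAt (fun ζ => x + Complex.exp ζ)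
        (ContinuousLinearMap.mul ℝ ℂ (Complex.exp ζ)) ζ :=
      hasFDerivAt_real_of_hasDerivAt ((Complex.hasDerivAt_exp ζ).const_add x)
    have h3 : HasFDerivAt (fun ζ : ℂ => (c * ζ).re) (reMul c) ζ := by
      simpa using hasFDerivAt_re_of_hasDerivAt ((hasDerivAt_id ζ).const_mul c)
    refine ((HasFDerivAt.comp ζ h1 h2).sub h3).congr_fderiv ?_
    ext v
    have hne := Complex.exp_ne_zero ζ
    rw [hch _ hm]
    simp only [add_sub_cancel_left, sub_apply, ContinuousLinearMap.comp_apply,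
      reMul_apply, ContinuousLinearMap.mul_apply', zero_apply]
    rw [← Complex.sub_re, ← Complex.sub_re]
    have : (c / Complex.exp ζ + h (x + Complex.exp ζ)) * (Complex.exp ζ * v)
        - h (x + Complex.exp ζ) * (Complex.exp ζ * v) - c * v = 0 := by
      field_simp; ring
    rw [this, Complex.zero_re]
  obtain ⟨k, hk⟩ := hPo.exists_is_const_of_fderiv_eq_zero hPc.isPreconnected
    (fun ζ hζ => (hWd ζ hζ).differentiableAt.differentiableWithinAt) fun ζ hζ => (hWd ζ hζ).fderiv
  -- The other terms are `2πi`-periodic, so `Re (c * 2πi) = -2π * c.im` must vanish.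
  have hcim : c.im = 0 := by
    have hζ0 : ((Real.log R - 1 : ℝ) : ℂ) ∈ P := by
      change (((Real.log R - 1 : ℝ) : ℂ)).re < Real.log R
      rw [Complex.ofReal_re]; linarith
    have hζ1 : ((Real.log R - 1 : ℝ) : ℂ) + 2 * Real.pi * Complex.I ∈ P := by
      change (((Real.log R - 1 : ℝ) : ℂ) + 2 * Real.pi * Complex.I).re < Real.log R
      simp
    have h1 := (hk _ hζ0).trans (hk _ hζ1).symm
    simp only [hW, Complex.exp_periodic _] at h1
    have h2 : (c * (2 * Real.pi * Complex.I)).re = 0 := by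
      rw [mul_add, Complex.add_re] at h1
      linarith
    simp only [Complex.mul_re, Complex.mul_im, Complex.I_re, Complex.I_im, Complex.ofReal_re,
      Complex.ofReal_im, Complex.re_ofNat, Complex.im_ofNat] at h2
    have hpi := Real.pi_pos
    have h3 : c.im * (2 * Real.pi) = 0 := by linarith
    exact (mul_eq_zero.1 h3).resolve_right (by positivity)
  have hE : Tendsto (fun t : ℝ => x + Complex.exp (t : ℂ)) atBot (𝓝[≠] x) := by
    refine tendsto_nhdsWithin_iff.2 ⟨?_, .of_forall fun t => by simp [Complex.exp_ne_zero]⟩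
    have h1 : Tendsto (fun t : ℝ => Complex.exp (t : ℂ)) atBot (𝓝 0) := by
      have := (Complex.continuous_ofReal.tendsto 0).comp Real.tendsto_exp_atBot
      simpa [Function.comp_def] using this
    simpa using h1.const_add x
  -- Along real `t → -∞` the terms from `u` and `H` and the constant are `o(t)`, hence so is `c.re *
  -- t`.
  have hcre : c.re = 0 := by
    have h1 : (fun t : ℝ => u (x + Complex.exp (t : ℂ))) =o[atBot] fun t => t := by
      refine (ho.comp_tendsto hE).congr' EventuallyEq.rfl (.of_forall fun t => ?_)
      simp [Complex.norm_exp]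
    have h2 : (fun t : ℝ => (H (x + Complex.exp (t : ℂ))).re) =o[atBot] fun t => t := by
      have hcont : Tendsto (fun y => (H y).re) (𝓝[≠] x) (𝓝 (H x).re) :=
        ((Complex.continuous_re.tendsto _).comp
          (hH x (Metric.mem_ball_self hR)).continuousAt.tendsto).mono_left nhdsWithin_le_nhds
      refine ((hcont.comp hE).isBigO_one ℝ).trans_isLittleO ?_
      exact (isLittleO_const_id_atBot (1 : ℝ))
    have h3 : (fun _ : ℝ => k) =o[atBot] fun t => t := isLittleO_const_id_atBot k
    have h4 : (fun t : ℝ => c.re * t) =o[atBot] fun t => t := by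
      refine ((h1.sub h2).sub h3).congr' ?_ EventuallyEq.rfl
      filter_upwards [eventually_lt_atBot (Real.log R)] with t ht
      have := hk (t : ℂ) (by
        change ((t : ℂ)).re < Real.log R
        rwa [Complex.ofReal_re])
      simp only [hW, Complex.mul_re, Complex.ofReal_re, Complex.ofReal_im, mul_zero, sub_zero]
        at this
      linarith
    by_contra hne
    have h5 := (isLittleO_const_mul_left_iff hne).1 h4
    have h6 := h5.tendsto_div_nhds_zero
    have h7 : Tendsto (fun t : ℝ => t / t) atBot (𝓝 1) := by
      refine tendsto_const_nhds.congr' ?_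
      filter_upwards [eventually_lt_atBot (0 : ℝ)] with t ht
      rw [div_self ht.ne]
    exact zero_ne_one (tendsto_nhds_unique h6 h7)
  have hc0 : c = 0 := Complex.ext hcre hcim
  refine ⟨fun y => (H y).re + k, fun y hy => ?_, fun y hy => ?_⟩
  · have hHd : DifferentiableOn ℂ H (Metric.ball x R) := fun y hy =>
      (hH y hy).differentiableAt.differentiableWithinAt
    have h1 := (hHd.analyticAt (Metric.isOpen_ball.mem_nhds hy)).harmonicAt_re
    exact h1.add (harmonicAt_const k)
  · have hyx : y - x ≠ 0 := sub_ne_zero.2 hy.2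
    have hm : Complex.log (y - x) ∈ P := by
      change (Complex.log (y - x)).re < Real.log R
      rw [Complex.log_re]
      exact Real.log_lt_log (norm_pos_iff.2 hyx) (mem_ball_iff_norm.1 hy.1)
    have := hk _ hm
    simp only [hW, Complex.exp_log hyx, add_sub_cancel, hc0, zero_mul, Complex.zero_re,
      sub_zero] at this
    linarith

end Removable

/-! ### The regularized Green's function belongs to `H¹₀(D)` -/

section LogNorm

variable {x y : ℂ}

/-- The gradient `(y - x) / |y - x|²` of `y ↦ log |y - x|`. -/
def gradLogNorm (x y : ℂ) : ℂ := (‖y - x‖ ^ 2)⁻¹ • (y - x)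

theorem hasFDerivAt_norm_sub_sq (x y : ℂ) :
    HasFDerivAt (fun s : ℂ => ‖s - x‖ ^ 2) (2 • innerSL ℝ (y - x)) y := by
  have := ((hasFDerivAt_id (𝕜 := ℝ) y).sub_const x).norm_sq
  simpa using this

theorem gradient_norm_sub_sq (x y : ℂ) :
    ∇ (fun s : ℂ => ‖s - x‖ ^ 2) y = (2 : ℝ) • (y - x) := by
  refine HasGradientAt.gradient ?_
  rw [hasGradientAt_iff_hasFDerivAt]
  refine (hasFDerivAt_norm_sub_sq x y).congr_fderiv ?_
  ext v
  simp [two_mul]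

theorem gradient_log_norm (hy : y ≠ x) :
    ∇ (fun s : ℂ => Real.log ‖s - x‖) y = gradLogNorm x y := by
  have h0 : 0 < ‖y - x‖ := norm_pos_iff.2 (sub_ne_zero.2 hy)
  have h1 : HasDerivAt (fun t : ℝ => 1 / 2 * Real.log t) (1 / 2 * (‖y - x‖ ^ 2)⁻¹) (‖y - x‖ ^ 2) :=
    (Real.hasDerivAt_log (by positivity)).const_mul _
  have h2 : (fun s : ℂ => Real.log ‖s - x‖) = fun s => 1 / 2 * Real.log (‖s - x‖ ^ 2) := by
    ext s
    rw [Real.log_pow]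
    push_cast
    ring
  rw [h2, gradient_comp_real h1 (hasFDerivAt_norm_sub_sq x y).differentiableAt,
    gradient_norm_sub_sq, smul_smul, gradLogNorm]
  congr 1
  ring

theorem norm_gradLogNorm (x y : ℂ) : ‖gradLogNorm x y‖ = ‖y - x‖⁻¹ := by
  rcases eq_or_ne y x with rfl | hy
  · simp [gradLogNorm]
  have h0 : 0 < ‖y - x‖ := norm_pos_iff.2 (sub_ne_zero.2 hy)
  rw [gradLogNorm, norm_smul, norm_inv, norm_pow, norm_norm]
  field_simp

theorem measurable_gradLogNorm (x : ℂ) : Measurable (gradLogNorm x) := by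
  unfold gradLogNorm
  fun_prop

theorem contDiffAt_log_norm (hy : y ≠ x) : ContDiffAt ℝ 1 (fun s : ℂ => Real.log ‖s - x‖) y :=
  ((contDiffAt_id.sub contDiffAt_const).norm ℝ (sub_ne_zero.2 hy)).log
    (norm_ne_zero_iff.2 (sub_ne_zero.2 hy))

end LogNorm

/-! ### A continuously differentiable maximum. -/

section SmoothMax

/-- A `C¹` approximation of `max e s`. -/
def smoothMax (e d s : ℝ) : ℝ := e - d / 2 + softPos d (s - (e - d))

variable {e d s : ℝ}

theorem hasDerivAt_smoothMax (hd : 0 < d) (s : ℝ) :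
    HasDerivAt (smoothMax e d) (softPosDeriv d (s - (e - d))) s :=
  ((hasDerivAt_softPos hd (s - (e - d))).comp_sub_const s (e - d)).const_add _

theorem contDiff_smoothMax (hd : 0 < d) : ContDiff ℝ 1 (smoothMax e d) := by
  have := contDiff_softPos hd
  unfold smoothMax
  fun_prop

theorem smoothMax_of_le (hd : 0 < d) (hs : e ≤ s) :
    smoothMax e d s = s ∧ softPosDeriv d (s - (e - d)) = 1 := by
  rw [smoothMax, softPos_of_le hd (by linarith), softPosDeriv_of_le hd (by linarith)]
  exact ⟨by ring, rfl⟩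

theorem le_smoothMax (hd : 0 < d) (s : ℝ) : e - d / 2 ≤ smoothMax e d s := by
  rw [smoothMax]
  linarith [softPos_nonneg hd (s - (e - d))]

theorem half_le_smoothMax (hd : 0 < d) (hde : d ≤ e) (s : ℝ) : e / 2 ≤ smoothMax e d s :=
  le_trans (by linarith) (le_smoothMax hd s)

theorem smoothMax_le (hd : 0 < d) (s : ℝ) : smoothMax e d s ≤ max e s := by
  rcases le_total e s with h | h
  · rw [(smoothMax_of_le hd h).1]; exact le_max_right _ _
  · refine le_trans ?_ (le_max_left _ _)
    rw [smoothMax]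
    rcases le_total (s - (e - d)) 0 with h' | h'
    · rw [softPos_of_nonpos hd h']; linarith
    · have h1 : s - (e - d) ≤ d := by linarith
      rw [softPos_of_mem h' h1]
      have : (s - (e - d)) ^ 2 / (2 * d) ≤ d / 2 := by
        rw [div_le_div_iff₀ (by linarith) two_pos]
        nlinarith
      linarith

theorem max_le_smoothMax_add (hd : 0 < d) (s : ℝ) : max e s ≤ smoothMax e d s + d / 2 := by
  rcases le_total e s with h | h
  · rw [(smoothMax_of_le hd h).1, max_eq_right h]; linarith
  · rw [max_eq_left h]; linarith [le_smoothMax (e := e) hd s]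

/-- The gap to the true maximum is at most `d / 2` while the smooth one is at least `e / 2`;
conclude with `log u ≤ u - 1`. -/
theorem abs_log_smoothMax_sub_le (hd : 0 < d) (hde : d ≤ e) (s : ℝ) :
    |Real.log (smoothMax e d s) - Real.log (max e s)| ≤ d / e := by
  have he : 0 < e := hd.trans_le hde
  have h1 := half_le_smoothMax hd hde s
  have h0 : 0 < smoothMax e d s := lt_of_lt_of_le (by positivity) h1
  have hm : 0 < max e s := lt_max_of_lt_left he
  have h2 := Real.log_le_log h0 (smoothMax_le hd s)
  have h3 : Real.log (max e s) - Real.log (smoothMax e d s) ≤ d / e := by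
    rw [← Real.log_div hm.ne' h0.ne']
    refine (Real.log_le_sub_one_of_pos (by positivity)).trans ?_
    rw [div_sub_one h0.ne', div_le_div_iff₀ h0 he]
    have h4 := max_le_smoothMax_add (e := e) hd s
    nlinarith
  rw [abs_le]
  constructor <;> linarith [div_pos hd he]

end SmoothMax

/-! ### The gradient and boundary values of the regularized Green's function. -/

section RegularizedGreen

open InnerProductSpace

variable {D : Set ℂ} {x : ℂ} {g G : ℂ → ℝ} {ε : ℝ}

/-- The harmonic correction `G̃ˣ` extends across the pole. -/
theorem IsGreenFunction.exists_contDiffOn_extension (hD : IsOpen D) (hx : x ∈ D)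
    (hg : IsGreenFunction D x g) :
    ∃ G : ℂ → ℝ, ContDiffOn ℝ 1 G D ∧ ∀ y ∈ D, y ≠ x → G y = g y + Real.log ‖y - x‖ := by
  obtain ⟨R, hR, hRD⟩ := Metric.isOpen_iff.1 hD x hx
  have hlog : ∀ y ≠ x, HarmonicAt (fun s : ℂ => Real.log ‖s - x‖) y := fun y hy =>
    AnalyticAt.harmonicAt_log_norm (f := fun s => s - x) (by fun_prop) (sub_ne_zero.2 hy)
  have hu : HarmonicOnNhd (fun y => g y + Real.log ‖y - x‖) (D \ {x}) := fun y hy =>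
    (hg.harmonic y hy).add (hlog y hy.2)
  have heq : (fun y : ℂ => Real.log (1 / ‖x - y‖)) = fun y => -Real.log ‖y - x‖ := by
    ext y; rw [one_div, Real.log_inv, norm_sub_rev]
  -- The asymptotic equivalence at the pole says precisely that the correction is `o(log)`; no
  -- boundedness is assumed there.
  have ho : (fun y => g y + Real.log ‖y - x‖) =o[𝓝[≠] x] fun y => Real.log ‖y - x‖ := by
    have h1 : (g - fun y : ℂ => Real.log (1 / ‖x - y‖)) =o[𝓝[≠] x]
        fun y => Real.log (1 / ‖x - y‖) := hg.pole
    rw [heq] at h1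
    refine (isLittleO_neg_right.1 h1).congr_left fun y => ?_
    simp
  obtain ⟨v, hv, huv⟩ := exists_harmonicOnNhd_of_isLittleO_log hR
    (hu.mono (Set.sdiff_subset_sdiff_left hRD)) ho
  refine ⟨fun y => if y = x then v x else g y + Real.log ‖y - x‖, fun y hy => ?_,
    fun y hy hyx => if_neg hyx⟩
  refine ContDiffAt.contDiffWithinAt ?_
  by_cases hyx : y = x
  · subst hyx
    have hmem := Metric.ball_mem_nhds y hR
    refine ((hv y (Metric.mem_ball_self hR)).1.of_le (by norm_num)).congr_of_eventuallyEq ?_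
    filter_upwards [hmem] with s hs
    by_cases hsy : s = y
    · rw [if_pos hsy, hsy]
    · rw [if_neg hsy]; exact huv s ⟨hs, hsy⟩
  · refine ((hu y ⟨hy, hyx⟩).1.of_le (by norm_num)).congr_of_eventuallyEq ?_
    filter_upwards [isOpen_ne.mem_nhds hyx] with s hs
    rw [if_neg hs]

/-- The gradient of the regularized Green's function, `G` being the extension of `G̃ˣ`. -/
def regGreenGradient (G : ℂ → ℝ) (ε : ℝ) (x y : ℂ) : ℂ :=
  ∇ G y - {s : ℂ | ε ≤ ‖s - x‖}.indicator (gradLogNorm x) y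

theorem IsGreenFunction.gradient_extension (hD : IsOpen D) (hg : IsGreenFunction D x g)
    (hG : ∀ y ∈ D, y ≠ x → G y = g y + Real.log ‖y - x‖) {y : ℂ} (hy : y ∈ D) (hyx : y ≠ x) :
    ∇ G y = ∇ g y + gradLogNorm x y := by
  have hU : IsOpen (D \ {x}) := hD.sdiff isClosed_singleton
  have hev : G =ᶠ[𝓝 y] fun s => g s + Real.log ‖s - x‖ := by
    filter_upwards [hU.mem_nhds ⟨hy, hyx⟩] with s hs
    exact hG s hs.1 hs.2
  rw [hev.gradient_eq, gradient_fun_add ((hg.harmonic y ⟨hy, hyx⟩).1.differentiableAt two_ne_zero)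
    ((contDiffAt_log_norm hyx).differentiableAt one_ne_zero), gradient_log_norm hyx]

/-- Three square integrable pieces: `∇ G` on the ball of radius `r = ε / 2`, where it is bounded; `∇
g` outside, of finite energy; and `gradLogNorm` on `r ≤ ‖y - x‖ < ε`, bounded by `1 / r`. The radius
is halved because the closed ball of radius `ε` need not lie in `D`. -/
theorem IsGreenFunction.memLp_regGreenGradient (hD : IsOpen D) (hg : IsGreenFunction D x g)
    (hGC : ContDiffOn ℝ 1 G D) (hG : ∀ y ∈ D, y ≠ x → G y = g y + Real.log ‖y - x‖)
    (hε : 0 < ε) (hball : Metric.ball x ε ⊆ D) :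
    MemLp (regGreenGradient G ε x) 2 (dirichletMeasure D) := by
  set r := ε / 2 with hr
  have hr0 : 0 < r := by positivity
  have hrD : Metric.closedBall x r ⊆ D :=
    (Metric.closedBall_subset_ball (by rw [hr]; linarith)).trans hball
  refine memLp_dirichletMeasure_iff.2 ?_
  have hbm : MeasurableSet (Metric.ball x r) := Metric.isOpen_ball.measurableSet
  have hAm := setOf_annulus_measurable x r ε
  set A := {y : ℂ | r ≤ ‖y - x‖ ∧ ‖y - x‖ < ε} with hA
  have h1 : MemLp ((Metric.ball x r).indicator (∇ G)) 2 (volume.restrict D) := by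
    rw [memLp_indicator_iff_restrict hbm, Measure.restrict_restrict hbm,
      Set.inter_eq_left.2 (Metric.ball_subset_closedBall.trans hrD)]
    have hcont := (continuousOn_gradient hD hGC).mono hrD
    obtain ⟨C, hC⟩ := (isCompact_closedBall x r).exists_bound_of_continuousOn hcont
    have : IsFiniteMeasure (volume.restrict (Metric.ball x r)) :=
      ⟨by rw [Measure.restrict_apply_univ]; exact Metric.isBounded_ball.measure_lt_top⟩
    refine MemLp.of_bound ((hcont.mono Metric.ball_subset_closedBall).aestronglyMeasurable hbm) C ?_
    filter_upwards [ae_restrict_mem hbm] with y hy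
    exact hC y (Metric.ball_subset_closedBall hy)
  have h2 : MemLp ((Metric.ball x r)ᶜ.indicator (∇ g)) 2 (volume.restrict D) := by
    rw [memLp_indicator_iff_restrict hbm.compl, Measure.restrict_restrict hbm.compl,
      Set.inter_comm, ← Set.sdiff_eq]
    exact hg.memLp_gradient hD hr0 hrD
  have h3 : MemLp (A.indicator (gradLogNorm x)) 2 (volume.restrict D) := by
    refine MemLp.mono_measure Measure.restrict_le_self ?_
    rw [memLp_indicator_iff_restrict hAm]
    have : IsFiniteMeasure (volume.restrict A) := by
      refine ⟨?_⟩
      rw [Measure.restrict_apply_univ]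
      refine (measure_mono fun y hy => ?_).trans_lt
        (Metric.isBounded_ball (x := x) (r := ε)).measure_lt_top
      rw [mem_ball_iff_norm]; exact hy.2
    refine MemLp.of_bound (measurable_gradLogNorm x).aestronglyMeasurable r⁻¹ ?_
    filter_upwards [ae_restrict_mem hAm] with y hy
    rw [norm_gradLogNorm]
    exact inv_anti₀ hr0 hy.1
  refine ((h1.add h2).add h3).ae_eq ?_
  filter_upwards [ae_restrict_mem hD.measurableSet] with y hy
  rw [Pi.add_apply, Pi.add_apply, regGreenGradient]
  by_cases hyr : ‖y - x‖ < r
  · have hyb : y ∈ Metric.ball x r := by rwa [mem_ball_iff_norm]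
    have hyA : y ∉ A := fun h => (not_lt.2 h.1) hyr
    have hyE : y ∉ {s : ℂ | ε ≤ ‖s - x‖} := fun h => by
      have h' : ε ≤ ‖y - x‖ := h
      linarith
    rw [Set.indicator_of_mem hyb, Set.indicator_of_notMem (Set.notMem_compl_iff.2 hyb),
      Set.indicator_of_notMem hyA, Set.indicator_of_notMem hyE]
    simp
  · have hyb : y ∉ Metric.ball x r := by rwa [mem_ball_iff_norm]
    have hyx : y ≠ x := fun h => hyr (by rw [h, sub_self, norm_zero]; exact hr0)
    rw [Set.indicator_of_notMem hyb, Set.indicator_of_mem (show y ∈ (Metric.ball x r)ᶜ from hyb),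
      hg.gradient_extension hD hG hy hyx]
    by_cases hye : ε ≤ ‖y - x‖
    · have hyA : y ∉ A := fun h => (not_lt.2 hye) h.2
      rw [Set.indicator_of_notMem hyA,
        Set.indicator_of_mem (show y ∈ {s : ℂ | ε ≤ ‖s - x‖} from hye)]
      simp
    · have hyA : y ∈ A := ⟨not_lt.1 hyr, not_le.1 hye⟩
      rw [Set.indicator_of_mem hyA,
        Set.indicator_of_notMem (show y ∉ {s : ℂ | ε ≤ ‖s - x‖} from hye)]
      simp

/-- A `C¹` approximation of the regularized Green's function. -/
def smoothGreen (G : ℂ → ℝ) (e d : ℝ) (x y : ℂ) : ℝ :=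
  -(1 / 2) * Real.log (smoothMax e d (‖y - x‖ ^ 2)) + G y

section SmoothGreen

variable {d e : ℝ}

theorem contDiffOn_smoothGreen (hd : 0 < d) (hde : d ≤ e) (hGC : ContDiffOn ℝ 1 G D) :
    ContDiffOn ℝ 1 (smoothGreen G e d x) D := by
  have h0 : ∀ s, smoothMax e d s ≠ 0 := fun s =>
    (lt_of_lt_of_le (by linarith) (half_le_smoothMax hd hde s)).ne'
  have h1 : ContDiff ℝ 1 fun y : ℂ => ‖y - x‖ ^ 2 := (contDiff_id.sub contDiff_const).norm_sq ℝ
  exact (contDiff_const.mul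
    (((contDiff_smoothMax hd).comp h1).log fun y => h0 _)).contDiffOn.add hGC

theorem gradient_smoothGreen (hD : IsOpen D) (hd : 0 < d) (hde : d ≤ e)
    (hGC : ContDiffOn ℝ 1 G D) {y : ℂ} (hy : y ∈ D) :
    ∇ (smoothGreen G e d x) y = ∇ G y - (softPosDeriv d (‖y - x‖ ^ 2 - (e - d))
      / smoothMax e d (‖y - x‖ ^ 2)) • (y - x) := by
  have h0 : ∀ s, smoothMax e d s ≠ 0 := fun s =>
    (lt_of_lt_of_le (by linarith) (half_le_smoothMax hd hde s)).ne'
  have hB : HasDerivAt (fun s => -(1 / 2) * Real.log (smoothMax e d s))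
      (-(1 / 2) * (softPosDeriv d (‖y - x‖ ^ 2 - (e - d)) / smoothMax e d (‖y - x‖ ^ 2)))
      (‖y - x‖ ^ 2) := ((hasDerivAt_smoothMax hd _).log (h0 _)).const_mul _
  have hn := (hasFDerivAt_norm_sub_sq x y).differentiableAt
  have hdG : DifferentiableAt ℝ G y :=
    (hGC.differentiableOn one_ne_zero).differentiableAt (hD.mem_nhds hy)
  have hd1 : DifferentiableAt ℝ (fun y => -(1 / 2) * Real.log (smoothMax e d (‖y - x‖ ^ 2))) y :=
    DifferentiableAt.comp (g := fun s => -(1 / 2) * Real.log (smoothMax e d s)) y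
      hB.differentiableAt hn
  change ∇ (fun y => -(1 / 2) * Real.log (smoothMax e d (‖y - x‖ ^ 2)) + G y) y = _
  rw [gradient_fun_add hd1 hdG, gradient_comp_real hB hn, gradient_norm_sub_sq]
  module

/-- Off the pole, the smooth approximation differs from the Green's function by a function which
vanishes outside the ball of radius `√e`. -/
theorem smoothGreen_eq_add (hG : ∀ y ∈ D, y ≠ x → G y = g y + Real.log ‖y - x‖) {y : ℂ}
    (hy : y ∈ D) (hyx : y ≠ x) : smoothGreen G e d x y
      = g y + (Real.log ‖y - x‖ - 1 / 2 * Real.log (smoothMax e d (‖y - x‖ ^ 2))) := by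
  rw [smoothGreen, hG y hy hyx]; ring

theorem log_norm_sub_log_smoothMax (hd : 0 < d) {y : ℂ} (hy : e ≤ ‖y - x‖ ^ 2) :
    Real.log ‖y - x‖ - 1 / 2 * Real.log (smoothMax e d (‖y - x‖ ^ 2)) = 0 := by
  rw [(smoothMax_of_le hd hy).1, Real.log_pow]
  push_cast
  ring

theorem continuousAt_log_norm_sub_log_smoothMax (hd : 0 < d) (hde : d ≤ e) {y : ℂ} (hy : y ≠ x) :
    ContinuousAt (fun y : ℂ =>
      Real.log ‖y - x‖ - 1 / 2 * Real.log (smoothMax e d (‖y - x‖ ^ 2))) y := by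
  have h0 : ∀ s, smoothMax e d s ≠ 0 := fun s =>
    (lt_of_lt_of_le (by linarith) (half_le_smoothMax hd hde s)).ne'
  have h1 : Continuous fun y : ℂ => smoothMax e d (‖y - x‖ ^ 2) :=
    (contDiff_smoothMax hd).continuous.comp (by fun_prop)
  exact (contDiffAt_log_norm hy).continuousAt.sub
    ((h1.log fun y => h0 _).continuousAt.const_mul _)

/-- Frontier points are at distance at least `ε` from the pole. There the difference from `g` is
continuous with value zero, even when the circle of radius `ε` touches the frontier. -/
theorem IsGreenFunction.tendsto_smoothGreen (hD : IsOpen D) (hg : IsGreenFunction D x g)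
    (hx : x ∈ D) (hd : 0 < d) (hde : d ≤ ε ^ 2)
    (hG : ∀ y ∈ D, y ≠ x → G y = g y + Real.log ‖y - x‖)
    (hε : 0 < ε) (hball : Metric.ball x ε ⊆ D) {ζ : ℂ} (hζ : ζ ∈ frontier D) :
    Tendsto (smoothGreen G (ε ^ 2) d x) (𝓝[D] ζ) (𝓝 0) := by
  have hζD : ζ ∉ D := by
    have := hζ.2
    rwa [hD.interior_eq] at this
  have hζx : ζ ≠ x := fun h => hζD (h ▸ hx)
  have hζε : ε ^ 2 ≤ ‖ζ - x‖ ^ 2 := by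
    have : ε ≤ ‖ζ - x‖ := not_lt.1 fun h => hζD (hball (by rwa [mem_ball_iff_norm]))
    gcongr
  have h1 := (continuousAt_log_norm_sub_log_smoothMax hd hde hζx).tendsto.mono_left
    (nhdsWithin_le_nhds (s := D))
  rw [log_norm_sub_log_smoothMax hd hζε] at h1
  have h2 := (hg.boundary ζ hζ).add h1
  rw [add_zero] at h2
  refine h2.congr' ?_
  filter_upwards [self_mem_nhdsWithin, nhdsWithin_le_nhds (isOpen_ne.mem_nhds hζx)] with y hy hyx
  exact (smoothGreen_eq_add hG hy hyx).symm

theorem IsGreenFunction.exists_abs_smoothGreen_le (hg : IsGreenFunction D x g)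
    (hd : 0 < d) (hde : d ≤ ε ^ 2) (hGC : ContDiffOn ℝ 1 G D)
    (hG : ∀ y ∈ D, y ≠ x → G y = g y + Real.log ‖y - x‖)
    (hε : 0 < ε) (hball : Metric.ball x ε ⊆ D) :
    ∃ M, ∀ y ∈ D, |smoothGreen G (ε ^ 2) d x y| ≤ M := by
  set r := ε / 2 with hr
  have hr0 : 0 < r := by positivity
  have hrD : Metric.closedBall x r ⊆ D :=
    (Metric.closedBall_subset_ball (by rw [hr]; linarith)).trans hball
  obtain ⟨M1, hM1⟩ := (isCompact_closedBall x r).exists_bound_of_continuousOn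
    ((contDiffOn_smoothGreen (x := x) hd hde hGC).continuousOn.mono hrD)
  obtain ⟨M2, hM2⟩ := hg.bounded r hr0
  set A := Metric.closedBall x ε ∩ {y : ℂ | r ≤ ‖y - x‖} with hA
  have hAc : IsCompact A := (isCompact_closedBall x ε).inter_right
    (isClosed_le continuous_const (by fun_prop))
  have hAx : ∀ y, r ≤ ‖y - x‖ → y ≠ x := fun y hy h => by
    rw [h, sub_self, norm_zero] at hy; linarith
  obtain ⟨M3, hM3⟩ := hAc.exists_bound_of_continuousOn fun y hy =>
    (continuousAt_log_norm_sub_log_smoothMax hd hde (hAx y hy.2)).continuousWithinAt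
  refine ⟨|M1| + (|M2| + |M3|), fun y hy => ?_⟩
  by_cases hyr : ‖y - x‖ ≤ r
  · have := hM1 y (by rwa [mem_closedBall_iff_norm])
    rw [Real.norm_eq_abs] at this
    linarith [le_abs_self M1, abs_nonneg M2, abs_nonneg M3]
  · have hyr' := (not_le.1 hyr).le
    have hyx := hAx y hyr'
    rw [smoothGreen_eq_add hG hy hyx]
    refine (abs_add_le _ _).trans ?_
    have h1 : |g y| ≤ |M2| := by
      rw [abs_of_nonneg (hg.nonneg y ⟨hy, hyx⟩)]
      exact (hM2 y hy (by rwa [norm_sub_rev])).trans (le_abs_self _)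
    have h2 : |Real.log ‖y - x‖ - 1 / 2 * Real.log (smoothMax (ε ^ 2) d (‖y - x‖ ^ 2))|
        ≤ |M3| := by
      by_cases hyε : ‖y - x‖ ≤ ε
      · exact (hM3 y ⟨by rwa [mem_closedBall_iff_norm], hyr'⟩).trans (le_abs_self _)
      · rw [log_norm_sub_log_smoothMax hd (by have := (not_le.1 hyε).le; gcongr), abs_zero]
        exact abs_nonneg _
    linarith [abs_nonneg M1]

/-- The two fields coincide off the ball. Inside it, the slope is at most `1`, the smooth maximum at
least `ε ^ 2 / 2`, and `‖y - x‖ < ε`, which gives `2 / ε`. -/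
theorem norm_gradient_smoothGreen_sub_le (hD : IsOpen D) (hd : 0 < d) (hde : d ≤ ε ^ 2)
    (hε : 0 < ε) (hGC : ContDiffOn ℝ 1 G D) {y : ℂ} (hy : y ∈ D) :
    ‖∇ (smoothGreen G (ε ^ 2) d x) y - regGreenGradient G ε x y‖
      ≤ ‖(Metric.ball x ε).indicator (fun _ => 2 / ε) y‖ := by
  rw [gradient_smoothGreen hD hd hde hGC hy, regGreenGradient]
  by_cases hyε : ε ≤ ‖y - x‖
  · obtain ⟨h1, h2⟩ := smoothMax_of_le hd (show ε ^ 2 ≤ ‖y - x‖ ^ 2 by gcongr)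
    rw [Set.indicator_of_mem (show y ∈ {s : ℂ | ε ≤ ‖s - x‖} from hyε), h1, h2, gradLogNorm,
      one_div, sub_self, norm_zero]
    exact norm_nonneg _
  · have hyε' := not_le.1 hyε
    rw [Set.indicator_of_notMem (show y ∉ {s : ℂ | ε ≤ ‖s - x‖} from hyε),
      Set.indicator_of_mem (show y ∈ Metric.ball x ε by rwa [mem_ball_iff_norm]), sub_zero,
      sub_sub_cancel_left, norm_neg, norm_smul, Real.norm_of_nonneg (by positivity : 0 ≤ 2 / ε),
      Real.norm_eq_abs]
    have h1 := half_le_smoothMax hd hde (‖y - x‖ ^ 2)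
    have h0 : 0 < ε ^ 2 / 2 := by positivity
    have h2 : |softPosDeriv d (‖y - x‖ ^ 2 - (ε ^ 2 - d)) / smoothMax (ε ^ 2) d (‖y - x‖ ^ 2)|
        ≤ 1 / (ε ^ 2 / 2) := by
      rw [abs_of_nonneg (div_nonneg (softPosDeriv_nonneg hd _) (h0.trans_le h1).le)]
      exact div_le_div₀ zero_le_one (softPosDeriv_le_one hd _) h0 h1
    calc _ ≤ 1 / (ε ^ 2 / 2) * ε := by gcongr
      _ = 2 / ε := by field_simp

end SmoothGreen

/-- The regularized Green's function belongs to `H¹₀(D)`. -/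
theorem IsGreenFunction.hasH1Gradient (hD : IsOpen D) (hx : x ∈ D) (hg : IsGreenFunction D x g)
    (hGC : ContDiffOn ℝ 1 G D) (hG : ∀ y ∈ D, y ≠ x → G y = g y + Real.log ‖y - x‖)
    (hε : 0 < ε) (hball : Metric.ball x ε ⊆ D) :
    HasH1Gradient D (fun y => Real.log (1 / max ε ‖x - y‖) + (g y - Real.log (1 / ‖x - y‖)))
      (regGreenGradient G ε x) := by
  have hw := hg.memLp_regGreenGradient hD hGC hG hε hball
  set d : ℕ → ℝ := fun n => ε ^ 2 * (1 / ((n : ℝ) + 1)) with hdef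
  have hd0 : ∀ n, 0 < d n := fun n => by positivity
  have hde : ∀ n, d n ≤ ε ^ 2 := fun n => by
    refine mul_le_of_le_one_right (by positivity) ?_
    rw [div_le_one (by positivity)]
    have : (0 : ℝ) ≤ n := n.cast_nonneg
    linarith
  have hdlim : Tendsto d atTop (𝓝 0) := by
    simpa [hdef] using tendsto_one_div_add_atTop_nhds_zero_nat.const_mul (ε ^ 2)
  set f : ℕ → ℂ → ℝ := fun n => smoothGreen G (ε ^ 2) (d n) x with hf
  have hfC : ∀ n, ContDiffOn ℝ 1 (f n) D := fun n => contDiffOn_smoothGreen (hd0 n) (hde n) hGC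
  have hdom : MemLp ((Metric.ball x ε).indicator fun _ => 2 / ε) 2 (dirichletMeasure D) :=
    (memLp_indicator_const 2 Metric.isOpen_ball.measurableSet (2 / ε)
      (Or.inr Metric.isBounded_ball.measure_lt_top.ne)).mono_measure
      ((dirichletMeasure_le D).trans Measure.restrict_le_self)
  have hTm : ∀ n, AEStronglyMeasurable (fun y => ∇ (f n) y - regGreenGradient G ε x y)
      (dirichletMeasure D) := fun n =>
    (((continuousOn_gradient hD (hfC n)).aestronglyMeasurable hD.measurableSet).mono_measure
      (dirichletMeasure_le D)).fun_sub hw.1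
  have hTb : ∀ n, ∀ᵐ y ∂(dirichletMeasure D), ‖∇ (f n) y - regGreenGradient G ε x y‖
      ≤ ‖(Metric.ball x ε).indicator (fun _ => 2 / ε) y‖ := by
    refine fun n => ae_dirichletMeasure_iff.2 ?_
    filter_upwards [ae_restrict_mem hD.measurableSet] with y hy
    exact norm_gradient_smoothGreen_sub_le hD (hd0 n) (hde n) hε hGC hy
  have hT0 : ∀ᵐ y ∂(dirichletMeasure D),
      Tendsto (fun n => ∇ (f n) y - regGreenGradient G ε x y) atTop (𝓝 0) := by
    refine ae_dirichletMeasure_iff.2 ?_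
    filter_upwards [ae_restrict_mem hD.measurableSet] with y hy
    refine tendsto_const_nhds.congr' ?_
    by_cases hyε : ε ≤ ‖y - x‖
    · refine .of_forall fun n => ?_
      have := norm_gradient_smoothGreen_sub_le (x := x) hD (hd0 n) (hde n) hε hGC hy
      rw [Set.indicator_of_notMem (show y ∉ Metric.ball x ε by
        rwa [mem_ball_iff_norm, not_lt]), norm_zero] at this
      exact (norm_le_zero_iff.1 this).symm
    · have hlt : ‖y - x‖ ^ 2 < ε ^ 2 := by
        have := not_le.1 hyε
        gcongr
      filter_upwards [hdlim.eventually_le_const (sub_pos.2 hlt)] with n hn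
      rw [hf, gradient_smoothGreen hD (hd0 n) (hde n) hGC hy, regGreenGradient,
        softPosDeriv_of_nonpos (hd0 n) (by linarith),
        Set.indicator_of_notMem (show y ∉ {s : ℂ | ε ≤ ‖s - x‖} from hyε)]
      simp
  have hfH : ∀ n, HasH1Gradient D (f n) (∇ (f n)) := by
    intro n
    obtain ⟨M, hM⟩ := hg.exists_abs_smoothGreen_le (hd0 n) (hde n) hGC hG hε hball
    refine hasH1Gradient_of_tendsto_frontier hD (hfC n) hM
      (fun ζ hζ => hg.tendsto_smoothGreen hD hx (hd0 n) (hde n) hG hε hball hζ) ?_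
    have h1 : MemLp (fun y => ∇ (f n) y - regGreenGradient G ε x y) 2 (dirichletMeasure D) :=
      hdom.mono (hTm n) (hTb n)
    refine (h1.add hw).ae_eq (.of_forall fun y => ?_)
    simp
  -- The pole is a null set, so the unspecified value of the correction there has no effect.
  have hne : ∀ᵐ y : ℂ, y ≠ x := by
    rw [ae_iff]
    simp
  refine hasH1Gradient_of_tendsto hD hfH
    (fun n => (hfC n).continuousOn.aestronglyMeasurable hD.measurableSet) hw
    (tendsto_eLpNorm_two_of_dominated hdom hTm hTb hT0) fun K hKD hK => ?_
  have hbound : ∀ n, ∫⁻ y in K, ‖f n y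
      - (Real.log (1 / max ε ‖x - y‖) + (g y - Real.log (1 / ‖x - y‖)))‖ₑ
      ≤ ENNReal.ofReal (1 / ((n : ℝ) + 1)) * volume K := by
    intro n
    rw [← setLIntegral_const]
    refine lintegral_mono_ae ?_
    filter_upwards [ae_restrict_mem hK.measurableSet, ae_restrict_of_ae hne] with y hy hyx
    rw [Real.enorm_eq_ofReal_abs]
    refine ENNReal.ofReal_le_ofReal ?_
    have h1 := abs_log_smoothMax_sub_le (hd0 n) (hde n) (‖y - x‖ ^ 2)
    have h2 : d n / ε ^ 2 = 1 / ((n : ℝ) + 1) := by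
      rw [hdef]; field_simp
    have h3 : Real.log (max (ε ^ 2) (‖y - x‖ ^ 2)) = 2 * Real.log (max ε ‖y - x‖) := by
      have : max (ε ^ 2) (‖y - x‖ ^ 2) = max ε ‖y - x‖ ^ 2 := by
        rcases le_total ε ‖y - x‖ with h | h
        · rw [max_eq_right h, max_eq_right (by gcongr)]
        · rw [max_eq_left h, max_eq_left (by gcongr)]
      rw [this, Real.log_pow]
      push_cast
      ring
    have h4 : f n y - (Real.log (1 / max ε ‖x - y‖) + (g y - Real.log (1 / ‖x - y‖)))
        = -(1 / 2) * (Real.log (smoothMax (ε ^ 2) (d n) (‖y - x‖ ^ 2))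
          - Real.log (max (ε ^ 2) (‖y - x‖ ^ 2))) := by
      rw [h3, norm_sub_rev x y, one_div, one_div, Real.log_inv, Real.log_inv, hf]
      simp only [smoothGreen]
      rw [hG y (hKD hy) hyx]
      ring
    rw [h4, abs_mul, ← h2]
    refine le_trans ?_ h1
    refine mul_le_of_le_one_left (abs_nonneg _) ?_
    norm_num
  have hlim : Tendsto (fun n : ℕ => ENNReal.ofReal (1 / ((n : ℝ) + 1)) * volume K) atTop (𝓝 0) := by
    have h1 := (ENNReal.continuous_ofReal.tendsto _).comp
      (tendsto_one_div_add_atTop_nhds_zero_nat (𝕜 := ℝ))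
    rw [ENNReal.ofReal_zero] at h1
    simpa using ENNReal.Tendsto.mul_const h1 (Or.inr hK.measure_lt_top.ne)
  exact tendsto_of_tendsto_of_tendsto_of_le_of_le tendsto_const_nhds hlim (fun _ => zero_le) hbound

end RegularizedGreen

/-! ### Circle averages -/

section CircleAverage

variable {D : Set ℂ} {z : ℂ}

/-- The infimum is attained because the balls are open: a point strictly inside the limiting ball
already lies in a slightly smaller admissible one. The centre is treated apart, as its distance has
no logarithm. -/
theorem ball_exp_neg_startTime_subset (hD : IsOpen D) (hz : z ∈ D) :
    Metric.ball z (Real.exp (-startTime D z)) ⊆ D := by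
  set S := {t : ℝ | 0 ≤ t ∧ Metric.ball z (Real.exp (-t)) ⊆ D} with hS
  have hne : S.Nonempty := by
    obtain ⟨R, hR, hRD⟩ := Metric.isOpen_iff.1 hD z hz
    refine ⟨max 0 (-Real.log R), le_max_left _ _, (Metric.ball_subset_ball ?_).trans hRD⟩
    rw [← Real.le_log_iff_exp_le hR]
    linarith [le_max_right 0 (-Real.log R)]
  intro y hy
  rcases eq_or_ne y z with rfl | hyz
  · exact hz
  have h0 : 0 < ‖y - z‖ := norm_pos_iff.2 (sub_ne_zero.2 hyz)
  rw [mem_ball_iff_norm, ← Real.log_lt_iff_lt_exp h0] at hy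
  obtain ⟨t, ht, htlt⟩ := exists_lt_of_csInf_lt hne (show sInf S < -Real.log ‖y - z‖ by
    change startTime D z < _
    linarith)
  refine ht.2 ?_
  rw [mem_ball_iff_norm, ← Real.log_lt_iff_lt_exp h0]
  linarith

theorem greenFunction_spec (hDG : HasGreenFunction D) (hz : z ∈ D) :
    IsGreenFunction D z (greenFunction D z) := by
  rw [greenFunction, dif_pos (hDG z hz)]
  exact (hDG z hz).choose_spec

/-- A single `G` serves all radii, so it cancels when two regularizations are subtracted. -/
theorem exists_toH1_regGreen_ae_eq (hD : IsOpen D) (hDG : HasGreenFunction D) (hz : z ∈ D) :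
    ∃ G : ℂ → ℝ, ∀ ε > 0, Metric.ball z ε ⊆ D →
      (toH1 D (regGreen D ε z) : Lp ℂ 2 (dirichletMeasure D)) =ᵐ[dirichletMeasure D]
        regGreenGradient G ε z := by
  have hg := greenFunction_spec hDG hz
  obtain ⟨G, hGC, hG⟩ := hg.exists_contDiffOn_extension hD hz
  refine ⟨G, fun ε hε hball =>
    (hg.hasH1Gradient hD hz hGC hG hε hball).toH1_ae_eq hD ?_⟩
  have hcont : ContinuousOn (fun y => -Real.log (max ε ‖y - z‖) + G y) D := by
    refine ContinuousOn.add (Continuous.continuousOn ?_) hGC.continuousOn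
    exact (Continuous.log (by fun_prop) fun y => (lt_max_of_lt_left hε).ne').neg
  refine (hcont.aestronglyMeasurable hD.measurableSet).congr ?_
  have hne : ∀ᵐ y : ℂ, y ≠ z := by
    rw [ae_iff]
    simp
  filter_upwards [ae_restrict_mem hD.measurableSet, ae_restrict_of_ae hne] with y hy hyz
  rw [hG y hy hyz, regGreen, greenCorrection, norm_sub_rev z y, one_div, one_div,
    Real.log_inv, Real.log_inv]
  ring

/-- The Dirichlet inner product of increments of the regularized Green's function. -/
theorem inner_toH1_regGreen_sub (hD : IsOpen D) (hDG : HasGreenFunction D) (hz : z ∈ D)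
    {a b r : ℝ} (ha : 0 < a) (hb : 0 < b) (har : a ≤ r) (hbr : b ≤ r)
    (hball : Metric.ball z r ⊆ D) :
    inner ℝ (toH1 D (regGreen D a z) - toH1 D (regGreen D r z))
      (toH1 D (regGreen D b z) - toH1 D (regGreen D r z)) = Real.log (r / max a b) := by
  obtain ⟨G, hG⟩ := exists_toH1_regGreen_ae_eq hD hDG hz
  have hr : 0 < r := ha.trans_le har
  have hdiff : ∀ c, 0 < c → c ≤ r →
      ((toH1 D (regGreen D c z) - toH1 D (regGreen D r z) : H1 D) :
        Lp ℂ 2 (dirichletMeasure D)) =ᵐ[dirichletMeasure D]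
        fun y => -{y : ℂ | c ≤ ‖y - z‖ ∧ ‖y - z‖ < r}.indicator (gradLogNorm z) y := by
    intro c hc hcr
    rw [Submodule.coe_sub]
    filter_upwards [Lp.coeFn_sub (toH1 D (regGreen D c z) : Lp ℂ 2 (dirichletMeasure D))
      (toH1 D (regGreen D r z) : Lp ℂ 2 (dirichletMeasure D)),
      hG c hc ((Metric.ball_subset_ball hcr).trans hball), hG r hr hball] with y h1 h2 h3
    rw [h1, Pi.sub_apply, h2, h3, regGreenGradient, regGreenGradient]
    by_cases h4 : r ≤ ‖y - z‖
    · rw [Set.indicator_of_mem (show y ∈ {s : ℂ | r ≤ ‖s - z‖} from h4),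
        Set.indicator_of_mem (show y ∈ {s : ℂ | c ≤ ‖s - z‖} from hcr.trans h4),
        Set.indicator_of_notMem (fun h => not_lt.2 h4 h.2)]
      simp
    · rw [Set.indicator_of_notMem (show y ∉ {s : ℂ | r ≤ ‖s - z‖} from h4)]
      by_cases h5 : c ≤ ‖y - z‖
      · rw [Set.indicator_of_mem (show y ∈ {s : ℂ | c ≤ ‖s - z‖} from h5),
          Set.indicator_of_mem
            (show y ∈ {y : ℂ | c ≤ ‖y - z‖ ∧ ‖y - z‖ < r} from ⟨h5, not_le.1 h4⟩)]
        simp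
      · rw [Set.indicator_of_notMem (show y ∉ {s : ℂ | c ≤ ‖s - z‖} from h5),
          Set.indicator_of_notMem (fun h => h5 h.1)]
        simp
  have hm := setOf_annulus_measurable z (max a b) r
  rw [Submodule.coe_inner, L2.inner_def]
  -- Both annuli have outer radius `r`; they meet where `‖y - z‖ ≥ max a b`, and there the two
  -- fields are equal.
  calc _ = ∫ y, {y : ℂ | max a b ≤ ‖y - z‖ ∧ ‖y - z‖ < r}.indicator
        (fun y => (‖y - z‖ ^ 2)⁻¹) y ∂(dirichletMeasure D) := by
        refine integral_congr_ae ?_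
        filter_upwards [hdiff a ha har, hdiff b hb hbr] with y h1 h2
        rw [h1, h2, inner_neg_neg]
        by_cases h : max a b ≤ ‖y - z‖ ∧ ‖y - z‖ < r
        · have h3 := max_le_iff.1 h.1
          rw [Set.indicator_of_mem (show y ∈ {y : ℂ | a ≤ ‖y - z‖ ∧ ‖y - z‖ < r} from ⟨h3.1, h.2⟩),
            Set.indicator_of_mem (show y ∈ {y : ℂ | b ≤ ‖y - z‖ ∧ ‖y - z‖ < r} from ⟨h3.2, h.2⟩),
            Set.indicator_of_mem (show y ∈ {y : ℂ | max a b ≤ ‖y - z‖ ∧ ‖y - z‖ < r} from h),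
            real_inner_self_eq_norm_sq, norm_gradLogNorm, inv_pow]
        · rw [Set.indicator_of_notMem
            (show y ∉ {y : ℂ | max a b ≤ ‖y - z‖ ∧ ‖y - z‖ < r} from h)]
          by_cases h4 : a ≤ ‖y - z‖ ∧ ‖y - z‖ < r
          · rw [Set.indicator_of_notMem (s := {y : ℂ | b ≤ ‖y - z‖ ∧ ‖y - z‖ < r})
              (fun h5 => h ⟨max_le h4.1 h5.1, h4.2⟩), inner_zero_right]
          · rw [Set.indicator_of_notMem (s := {y : ℂ | a ≤ ‖y - z‖ ∧ ‖y - z‖ < r}) h4,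
              inner_zero_left]
    _ = 1 / (2 * Real.pi) * ∫ y in {y : ℂ | max a b ≤ ‖y - z‖ ∧ ‖y - z‖ < r},
        (‖y - z‖ ^ 2)⁻¹ := by
        rw [integral_dirichletMeasure, setIntegral_indicator hm, Set.inter_eq_right.2]
        intro y hy
        exact hball (by rw [mem_ball_iff_norm]; exact hy.2)
    _ = Real.log (r / max a b) := by
        rw [integral_annulus_inv_sq z (lt_max_of_lt_left ha) (max_le har hbr)]
        field_simp

end CircleAverage

/-! ### Mean and covariance of the circle average increments. -/

section Increment

variable {Ω : Type*} [MeasurableSpace Ω] {P : Measure Ω} [IsProbabilityMeasure P] {D : Set ℂ}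
  (h : GaussianFreeField P D) (z : ℂ)

/-- The element of `H¹₀(D)` which represents `circleIncrement`. -/
def incrementH1 (D : Set ℂ) (z : ℂ) (t : ℝ≥0) : H1 D :=
  toH1 D (regGreen D (Real.exp (-(startTime D z + t))) z)
    - toH1 D (regGreen D (Real.exp (-startTime D z)) z)

/-- With `r = e ^ (-t₀)` the larger inner radius belongs to the smaller time, and `log (r / e ^
(-(t₀ + min s t))) = min s t`. -/
theorem inner_incrementH1 {z : ℂ} (hD : IsOpen D) (hDG : HasGreenFunction D) (hz : z ∈ D)
    (s t : ℝ≥0) : inner ℝ (incrementH1 D z s) (incrementH1 D z t) = ((min s t : ℝ≥0) : ℝ) := by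
  have hle : ∀ t : ℝ≥0, Real.exp (-(startTime D z + t)) ≤ Real.exp (-startTime D z) := fun t =>
    Real.exp_le_exp.2 (by linarith [t.coe_nonneg])
  rw [incrementH1, incrementH1, inner_toH1_regGreen_sub hD hDG hz (Real.exp_pos _) (Real.exp_pos _)
    (hle s) (hle t) (ball_exp_neg_startTime_subset hD hz), ← Real.exp_monotone.map_max,
    ← Real.exp_sub, Real.log_exp, max_neg_neg, min_add_add_left, NNReal.coe_min]
  ring

theorem GaussianFreeField.pairing_incrementH1 (t : ℝ≥0) :
    h.pairing (incrementH1 D z t) =ᵐ[P] h.circleIncrement z t :=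
  h.pairing_sub _ _

theorem GaussianFreeField.isGaussianProcess_circleIncrement :
    IsGaussianProcess (h.circleIncrement z) P :=
  (h.isGaussianProcess_pairing (incrementH1 D z)).congr (h.pairing_incrementH1 z)

theorem GaussianFreeField.integral_circleIncrement (t : ℝ≥0) :
    ∫ ω, h.circleIncrement z t ω ∂P = 0 := by
  rw [← integral_congr_ae (h.pairing_incrementH1 z t), h.integral_pairing]

theorem GaussianFreeField.covariance_circleIncrement {z : ℂ} (hD : IsOpen D)
    (hDG : HasGreenFunction D) (hz : z ∈ D) (s t : ℝ≥0) :
    covariance (h.circleIncrement z s) (h.circleIncrement z t) P = ((min s t : ℝ≥0) : ℝ) := by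
  rw [← inner_incrementH1 hD hDG hz, ← h.covariance_pairing, covariance, covariance,
    h.integral_circleIncrement, h.integral_circleIncrement, h.integral_pairing, h.integral_pairing]
  refine integral_congr_ae ?_
  filter_upwards [h.pairing_incrementH1 z s, h.pairing_incrementH1 z t] with ω h1 h2
  rw [h1, h2]

end Increment

end GFF

end

theorem mainTheorem3 {Ω : Type*} [MeasurableSpace Ω] (P : MeasureTheory.Measure Ω)
    [MeasureTheory.IsProbabilityMeasure P]
    (D : Set ℂ) (hDo : IsOpen D) (hDc : IsConnected D) (hDG : GFF.HasGreenFunction D)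
    (h : GFF.GaussianFreeField P D) (z : ℂ) (hz : z ∈ D) :
    ProbabilityTheory.IsGaussianProcess (h.circleIncrement z) P ∧
    (∀ t : NNReal, ∫ ω, h.circleIncrement z t ω ∂P = 0) ∧
    (∀ s t : NNReal, ProbabilityTheory.covariance (h.circleIncrement z s) (h.circleIncrement z t) P
      = ((min s t : NNReal) : ℝ)) ∧
    (∃ W : NNReal → Ω → ℝ, ProbabilityTheory.IsBrownianReal W P ∧
      ∀ t : NNReal, W t =ᵐ[P] h.circleIncrement z t) := by
  have h1 := h.isGaussianProcess_circleIncrement z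
  have h2 := h.integral_circleIncrement z
  have h3 := h.covariance_circleIncrement hDo hDG hz
  refine ⟨h1, h2, h3, GFF.exists_isBrownianReal_modification _
    (h1.isPreBrownianReal_of_covariance h2 fun s t hst => ?_)⟩
  rw [h3, min_eq_left hst]
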